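/- All graphs are finite, simple and have at least one vertex; $d(v)$ is the degree of $v$ and $N(v)$ its set of neighbours. A \emph{dynamic $k$-coloring} of $G$ is a surjective map $c:V(G)\to\{1,\dots,k\}$ such that $c(u)\ne c(v)$ for adjacent $u,v$, and $|c(N(v))|\ge\min\{d(v),2\}$ for every vertex $v$. $G$ is \emph{dynamically 3-colorable} if it has a dynamic $k$-coloring for some $1\le k\le 3$. For $i \ge 2$, an $A_i$ in $G$ is a path with $i$ vertices whose two end-vertices have degree 3 in $G$ and whose internal vertices have degree 2 in $G$. Let $\mathscr{C}$ be the class of graphs of maximum degree at most 3 that are claw-free (no induced $K_{1,3}$) and contain no $A_{3j+1}$ for any integer $j\ge1$. Let $\mathscr{E}$ be the class of graphs isomorphic to a graph obtained from $K_4$ by replacing one edge by a path $P_i$ on $i$ vertices (the ends of the edge being the ends of the path), where $i=3j$ or $i=3j-1$ for some integer $j\ge1$. The machine model is a unit-cost random access machine whose only arithmetic operations are successor and predecessor. The input is a graph on the vertices $0,\dots,n-1$ given by its number $n$ of vertices and its adjacency lists, in arbitrary order, stored one after another in an array together with an array of their starting positions. (1) There is an algorithm that decides in $O(n)$ time whether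 a given graph belongs to $\mathscr{C}$. (2) There is an algorithm that decides in $O(n)$ time whether a given connected graph in $\mathscr{C}$ is dynamically 3-colorable. (3) The following determination procedure can be carried out in $O(n)$ time on connected graphs $G$ in $\mathscr{C}$: if $G$ has a vertex of degree 1, answer "yes"; otherwise, if the number of vertices of degree 3 is not 4, answer "yes"; otherwise, answer "no" if $G\in\mathscr{E}$ and "yes" if $G\notin\mathscr{E}$. (4) For every connected graph $G$ in $\mathscr{C}$ that is not a cycle (that is, not all vertices have degree 2), the procedure in (3) answers "yes" if and only if $G$ is dynamically 3-colorable. -/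

import Mathlib

namespace DynCol

/-! ### Graph notions -/

section Graphs

variable {V : Type*} (G : SimpleGraph V)

/-- The degree `d(v) = |N_G(v)|`. It is only used for finite graphs. -/
noncomputable def deg (v : V) : ℕ := (G.neighborSet v).ncard

/-- `c` is a proper dynamic `k`-coloring: a surjective map to `k` colors such that adjacent
vertices get different colors and `|c(N_G(v))| ≥ min {d(v), 2}` for every vertex `v`. -/
def IsDynamicColoring (k : ℕ) (c : V → Fin k) : Prop :=
  Function.Surjective c ∧
  (∀ u v, G.Adj u v → c u ≠ c v) ∧
  ∀ v, min (deg G v) 2 ≤ (c '' G.neighborSet v).ncard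

/-- `G` is dynamically 3-colorable: the least `k > 0` for which there is a proper dynamic
`k`-coloring of `G` is at most `3`. -/
def DynThreeColorable : Prop :=
  ∃ k : ℕ, 0 < k ∧ k ≤ 3 ∧ ∃ c : V → Fin k, IsDynamicColoring G k c

/-- No induced `K_{1,3}`. -/
def ClawFree : Prop :=
  ∀ v x y z, G.Adj v x → G.Adj v y → G.Adj v z → x ≠ y → y ≠ z → x ≠ z →
    G.Adj x y ∨ G.Adj y z ∨ G.Adj x z

/-- `G` contains an `A_i`: a path with `i` vertices whose two ends have degree 3 in `G` and whose
internal vertices have degree 2 in `G`. -/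
def HasA (i : ℕ) : Prop :=
  ∃ (u v : V) (p : G.Walk u v), p.IsPath ∧ p.length + 1 = i ∧ deg G u = 3 ∧ deg G v = 3 ∧
    ∀ w ∈ p.support, w ≠ u → w ≠ v → deg G w = 2

/-- The class `𝒞`: maximum degree at most 3, claw-free, and `A_i`-free for all
`i = 3j + 1`, `j ≥ 1`. (Connectedness is stated separately where it is needed.) -/
def InC : Prop :=
  (∀ v, deg G v ≤ 3) ∧ ClawFree G ∧ ∀ j : ℕ, 1 ≤ j → ¬ HasA G (3 * j + 1)

/-- `K₄` with one edge replaced by a path `P_i` on `i` vertices (`i ≥ 2`): the path is `Fin i`, its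
ends `0` and `i - 1` are the ends of the replaced edge, and `Fin 2` are the two other vertices
of `K₄`. (`fromRel` symmetrizes and removes loops.) -/
def k4Path (i : ℕ) : SimpleGraph (Fin i ⊕ Fin 2) :=
  SimpleGraph.fromRel fun x y =>
    match x, y with
    | .inl a, .inl b => a.val + 1 = b.val
    | .inl a, .inr _ => a.val = 0 ∨ a.val + 1 = i
    | .inr _, .inl _ => False
    | .inr _, .inr _ => True

/-- The exceptional class `ℰ`: the graphs obtained from `K₄` by replacing one edge by a `P_i`,
where `i = 3j` or `i = 3j - 1` with `j ≥ 1`. -/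
def InE : Prop :=
  ∃ i j : ℕ, 1 ≤ j ∧ (i = 3 * j ∨ i = 3 * j - 1) ∧ Nonempty (G ≃g k4Path i)

/-- The determination algorithm answers "dynamically 3-colorable": there is a vertex of degree 1,
or else the number of vertices of degree 3 is not 4, or else the graph is not in `ℰ`. -/
def DeterminationAnswer : Prop :=
  (∃ v, deg G v = 1) ∨ {v | deg G v = 3}.ncard ≠ 4 ∨ ¬ InE G

end Graphs

/-! ### Machine model

A random access machine with unit cost, programmed by structured programs. Its memory consists of
registers and arrays of natural numbers. The only arithmetic is successor and predecessor, so
after `t` steps no value exceeds `t` plus the largest number in the input and the program: unit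
cost cannot be exploited by building long numbers. -/

/-- Memory: registers `reg r` and array cells `arr a i`. -/
structure Mem where
  reg : ℕ → ℕ
  arr : ℕ → ℕ → ℕ

/-- Write `k` to register `x`. -/
def Mem.setReg (s : Mem) (x k : ℕ) : Mem :=
  { s with reg := Function.update s.reg x k }

/-- Write `k` to cell `i` of array `a`. -/
def Mem.setArr (s : Mem) (a i k : ℕ) : Mem :=
  { s with arr := Function.update s.arr a (Function.update (s.arr a) i k) }

/-- Comparisons of two registers. -/
inductive Test where
  | eq (x y : ℕ)
  | lt (x y : ℕ)

def Test.Holds : Test → Mem → Prop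
  | .eq x y, s => s.reg x = s.reg y
  | .lt x y, s => s.reg x < s.reg y

/-- Programs. All letters `x`, `y` are register names, `a` is an array name. -/
inductive Prog where
  /-- `x := k` for a fixed number `k` -/
  | const (x k : ℕ)
  /-- `x := y` -/
  | copy (x y : ℕ)
  /-- `x := y + 1` -/
  | succ (x y : ℕ)
  /-- `x := y - 1`, where `0 - 1 = 0` -/
  | pred (x y : ℕ)
  /-- `x := a[y]` -/
  | load (x a y : ℕ)
  /-- `a[x] := y` -/
  | store (a x y : ℕ)
  | seq (P Q : Prog)
  | ite (b : Test) (P Q : Prog)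
  | loop (b : Test) (P : Prog)

/-- `Runs P s t s'`: started in memory `s`, the program `P` halts after exactly `t` steps, in
memory `s'`. Every assignment and every evaluation of a test is one step;
`loop b P` is "while `b` do `P`". -/
inductive Runs : Prog → Mem → ℕ → Mem → Prop where
  | const (s : Mem) (x k : ℕ) : Runs (.const x k) s 1 (s.setReg x k)
  | copy (s : Mem) (x y : ℕ) : Runs (.copy x y) s 1 (s.setReg x (s.reg y))
  | succ (s : Mem) (x y : ℕ) : Runs (.succ x y) s 1 (s.setReg x (s.reg y + 1))
  | pred (s : Mem) (x y : ℕ) : Runs (.pred x y) s 1 (s.setReg x (s.reg y - 1))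
  | load (s : Mem) (x a y : ℕ) : Runs (.load x a y) s 1 (s.setReg x (s.arr a (s.reg y)))
  | store (s : Mem) (a x y : ℕ) : Runs (.store a x y) s 1 (s.setArr a (s.reg x) (s.reg y))
  | seq {P Q : Prog} {s s' s'' : Mem} {t t' : ℕ} :
      Runs P s t s' → Runs Q s' t' s'' → Runs (.seq P Q) s (t + t') s''
  | ite_true {b : Test} {P Q : Prog} {s s' : Mem} {t : ℕ} :
      b.Holds s → Runs P s t s' → Runs (.ite b P Q) s (t + 1) s'
  | ite_false {b : Test} {P Q : Prog} {s s' : Mem} {t : ℕ} :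
      ¬ b.Holds s → Runs Q s t s' → Runs (.ite b P Q) s (t + 1) s'
  | loop_false {b : Test} {P : Prog} {s : Mem} :
      ¬ b.Holds s → Runs (.loop b P) s 1 s
  | loop_true {b : Test} {P : Prog} {s s' s'' : Mem} {t t' : ℕ} :
      b.Holds s → Runs P s t s' → Runs (.loop b P) s' t' s'' →
      Runs (.loop b P) s (t + t' + 1) s''

/-- `adj` gives adjacency lists of `G`, each in an arbitrary order and without repetitions. -/
def IsAdjLists {n : ℕ} (G : SimpleGraph (Fin n)) (adj : Fin n → List (Fin n)) : Prop :=
  ∀ v, (adj v).Nodup ∧ ∀ u, u ∈ adj v ↔ G.Adj v u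

/-- The memory at the start. Register 0 holds the number `n` of vertices, array 1 holds the
concatenated adjacency lists of the vertices `0, …, n - 1`, and cell `v ≤ n` of array 0 holds the
position in array 1 at which the list of `v` starts (for `v = n`, the total length).
Everything else is 0. -/
def initialMem {n : ℕ} (adj : Fin n → List (Fin n)) : Mem where
  reg r := if r = 0 then n else 0
  arr a i :=
    if a = 0 then (if i ≤ n then ((List.ofFn adj).take i).flatten.length else 0)
    else if a = 1 then ((List.ofFn adj).flatten.map Fin.val).getD i 0
    else 0

/-- On every graph with `n ≥ 1` vertices that satisfies `inputs`, given by any adjacency lists,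
`P` halts after `O(n)` steps, and register 0 then holds 1 if the graph satisfies `property`
and 0 if it does not. -/
def DecidesInLinearTime (P : Prog)
    (inputs property : (n : ℕ) → SimpleGraph (Fin n) → Prop) : Prop :=
  ∃ C : ℕ, ∀ n : ℕ, 0 < n → ∀ (G : SimpleGraph (Fin n)) (adj : Fin n → List (Fin n)),
    IsAdjLists G adj → inputs n G →
    ∃ (t : ℕ) (s : Mem), Runs P (initialMem adj) t s ∧ t ≤ C * n ∧
      (property n G → s.reg 0 = 1) ∧ (¬ property n G → s.reg 0 = 0)

end DynCol

namespace DynCol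

/-! ### Neighbours of vertices of small degree -/

section Degree

variable {V : Type*} {G : SimpleGraph V}


/-! In a claw-free graph a vertex of degree 3 lies in a triangle, so a proper coloring already shows
it two colors. For graphs in `𝒞`, a proper 3-coloring is therefore dynamic as soon as the two
neighbours of every vertex of degree 2 differ in color. Three consecutive vertices around a vertex
of degree 2 then carry all three colors, so along a thread (a walk through vertices of degree 2) the
colors form an arithmetic progression in ℤ/3 with nonzero slope.

A thread with `k` edges between distinct vertices of degree 3 has `k` not divisible by 3, because
`A_{k+1}` would be forbidden. Hence it forces its ends to have different colors, and any two
different colors at the ends are realised by some slope (`IsThread.exists_slope`). A closed thread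
at a vertex of degree 3 is a triangle and imposes nothing. So, unless the graph is a cycle, it is
enough to color properly the `core`, whose vertices of degree 3 are joined when a thread joins them
(`exists_coloring_of_core`). The core is again claw-free of maximum degree at most 3, and such a
graph without `K₄` is 3-colorable (`exists_coloring_of_reduced`). A `K₄` in the core forces a
connected graph into `ℰ` (`reduced_core`, `inE_of_diamond`). On `ℰ` itself the ends of the path must
share a color, while their thread forces different ones (`not_dynThreeColorable_of_inE`). Cycles are
colorable exactly when 3 divides their length.

For the algorithms, membership in `ℰ` is replaced by counting: without leaves and with four vertices
of degree 3, it means that at least two vertices of degree 3 have only neighbours of degree 3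
(`determinationAnswer_iff`). One pass over the vertices suffices. Recognition of `𝒞` tests degrees
and claws locally and walks along every thread that leaves a vertex of degree 3. This is linear
because these threads share no oriented edge (`sum_threadWork_le`). -/

lemma exists_nbrs_of_deg_three {v : V} (hd : deg G v = 3) :
    ∃ a b c, a ≠ b ∧ a ≠ c ∧ b ≠ c ∧ G.Adj v a ∧ G.Adj v b ∧ G.Adj v c ∧
      ∀ w, G.Adj v w → w = a ∨ w = b ∨ w = c := by
  obtain ⟨a, b, c, hab, hac, hbc, h⟩ := Set.ncard_eq_three.1 hd
  have h' : ∀ w, G.Adj v w ↔ w = a ∨ w = b ∨ w = c := fun w => by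
    rw [← SimpleGraph.mem_neighborSet, h]; simp
  exact ⟨a, b, c, hab, hac, hbc, by simp [h'], by simp [h'], by simp [h'], fun w => (h' w).1⟩

/-- In a claw-free graph, a vertex of degree 3 lies in a triangle. -/
lemma exists_triangle_of_deg_three {v : V} (hcf : ClawFree G) (hd : deg G v = 3) :
    ∃ a b c, a ≠ b ∧ c ≠ a ∧ c ≠ b ∧ G.Adj v a ∧ G.Adj v b ∧ G.Adj a b ∧ G.Adj v c ∧
      ∀ w, G.Adj v w → w = a ∨ w = b ∨ w = c := by
  obtain ⟨x, y, z, hxy, hxz, hyz, hx, hy, hz, h⟩ := exists_nbrs_of_deg_three hd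
  rcases hcf v x y z hx hy hz hxy hyz hxz with h' | h' | h'
  · exact ⟨x, y, z, hxy, hxz.symm, hyz.symm, hx, hy, h', hz, h⟩
  · exact ⟨y, z, x, hyz, hxy, hxz, hy, hz, h', hx, fun w hw => by have := h w hw; tauto⟩
  · exact ⟨x, z, y, hxz, hxy.symm, hyz, hx, hz, h', hy, fun w hw => by have := h w hw; tauto⟩

variable [Finite V]

lemma deg_le_of_subset {v : V} {S : Set V} (h : ∀ w, G.Adj v w → w ∈ S) : deg G v ≤ S.ncard :=
  Set.ncard_le_ncard (fun w hw => h w hw) (Set.toFinite _)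

lemma eq_or_eq_of_deg_le_two {v a b w : V} (hd : deg G v ≤ 2) (ha : G.Adj v a) (hb : G.Adj v b)
    (hab : a ≠ b) (hw : G.Adj v w) : w = a ∨ w = b := by
  by_contra! h
  have : ({w, a, b} : Set V).ncard ≤ deg G v :=
    Set.ncard_le_ncard (by rintro x (rfl | rfl | rfl) <;> assumption) (Set.toFinite _)
  rw [Set.ncard_eq_three.2 ⟨w, a, b, h.1, h.2, hab, rfl⟩] at this
  omega

lemma eq_of_deg_le_one {v a w : V} (hd : deg G v ≤ 1) (ha : G.Adj v a) (hw : G.Adj v w) :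
    w = a := by
  by_contra h
  have : ({w, a} : Set V).ncard ≤ deg G v :=
    Set.ncard_le_ncard (by rintro x (rfl | rfl) <;> assumption) (Set.toFinite _)
  rw [Set.ncard_pair h] at this
  omega

lemma eq_of_deg_le_three {v a b c w : V} (hd : deg G v ≤ 3) (ha : G.Adj v a) (hb : G.Adj v b)
    (hc : G.Adj v c) (hab : a ≠ b) (hac : a ≠ c) (hbc : b ≠ c) (hw : G.Adj v w) :
    w = a ∨ w = b ∨ w = c := by
  by_contra! h
  have : (insert w {a, b, c} : Set V).ncard ≤ deg G v :=
    Set.ncard_le_ncard (by rintro x (rfl | rfl | rfl | rfl) <;> assumption) (Set.toFinite _)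
  rw [Set.ncard_insert_of_notMem (by simp [h]) (Set.toFinite _),
    Set.ncard_eq_three.2 ⟨a, b, c, hab, hac, hbc, rfl⟩] at this
  omega

lemma exists_ne_of_deg_two {v : V} (hd : deg G v = 2) (a : V) :
    ∃ b, b ≠ a ∧ G.Adj v b := by
  by_contra! h
  have := deg_le_of_subset (G := G) (v := v) (S := {a})
    (fun w hw => by_contra fun hne => h w hne hw)
  rw [Set.ncard_singleton] at this
  omega

lemma exists_third_of_deg_three {v a b : V} (hd : deg G v = 3) (ha : G.Adj v a) (hb : G.Adj v b)
    (hab : a ≠ b) : ∃ c, c ≠ a ∧ c ≠ b ∧ G.Adj v c ∧ ∀ w, G.Adj v w → w = a ∨ w = b ∨ w = c := by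
  have : ∃ c, c ≠ a ∧ c ≠ b ∧ G.Adj v c := by
    by_contra! h
    have := deg_le_of_subset (G := G) (v := v) (S := {a, b})
      (fun w hw => by
        by_contra hne
        simp only [Set.mem_insert_iff, Set.mem_singleton_iff, not_or] at hne
        exact h w hne.1 hne.2 hw)
    rw [Set.ncard_pair hab] at this
    omega
  obtain ⟨c, hca, hcb, hc⟩ := this
  exact ⟨c, hca, hcb, hc, fun w hw =>
    eq_of_deg_le_three hd.le ha hb hc hab hca.symm hcb.symm hw⟩

lemma deg_pos_iff {v : V} : 0 < deg G v ↔ ∃ w, G.Adj v w := by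
  rw [deg, Set.ncard_pos (Set.toFinite _)]
  rfl

end Degree

/-! ### Three-coloring claw-free subcubic graphs -/

section Coloring

variable {V : Type*} [Finite V]

/-- The graph `G` with all edges at vertices of `D` removed. -/
def isolate (G : SimpleGraph V) (D : Set V) : SimpleGraph V where
  Adj u v := G.Adj u v ∧ u ∉ D ∧ v ∉ D
  symm := ⟨fun _ _ h => ⟨h.1.symm, h.2.2, h.2.1⟩⟩
  loopless := ⟨fun _ h => G.loopless.irrefl _ h.1⟩

/-- Maximum degree at most 3, claw-free, without `K₄`. -/
def Reduced (G : SimpleGraph V) : Prop :=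
  (∀ v, deg G v ≤ 3) ∧ ClawFree G ∧
    ∀ a b c d, G.Adj a b → G.Adj a c → G.Adj a d → G.Adj b c → G.Adj b d → G.Adj c d → False

/-- All neighbours of a vertex in the new graph lie outside `D`, so an edge of `G` between two of
them survives and no claw arises. Isolating instead of deleting keeps the vertex type fixed during
the induction. -/
lemma reduced_isolate {G : SimpleGraph V} (h : Reduced G) (D : Set V) :
    Reduced (isolate G D) := by
  obtain ⟨h1, h2, h3⟩ := h
  refine ⟨fun v => (deg_le_of_subset (G := isolate G D) (S := G.neighborSet v) fun w hw => hw.1).trans (h1 v), ?_, ?_⟩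
  · intro v x y z hx hy hz hxy hyz hxz
    rcases h2 v x y z hx.1 hy.1 hz.1 hxy hyz hxz with h | h | h
    · exact Or.inl ⟨h, hx.2.2, hy.2.2⟩
    · exact Or.inr (Or.inl ⟨h, hy.2.2, hz.2.2⟩)
    · exact Or.inr (Or.inr ⟨h, hx.2.2, hz.2.2⟩)
  · intro a b c d h1 h2 h3' h4 h5 h6
    exact h3 a b c d h1.1 h2.1 h3'.1 h4.1 h5.1 h6.1

/-- The induction measure of the coloring theorem is the number of non-isolated vertices: it drops
when `x` loses its edges and no isolated vertex gains one. -/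
lemma support_ncard_lt {G H : SimpleGraph V} {x y : V} (hx : G.Adj x y) (hx' : ∀ w, ¬ H.Adj x w)
    (hle : ∀ u w, H.Adj u w → ∃ w', G.Adj u w') :
    {v | ∃ w, H.Adj v w}.ncard < {v | ∃ w, G.Adj v w}.ncard := by
  apply Set.ncard_lt_ncard _ (Set.toFinite _)
  refine ⟨fun u ⟨w, hw⟩ => hle u w hw, fun h => ?_⟩
  obtain ⟨w, hw⟩ := h ⟨y, hx⟩
  exact hx' w hw

/-- Distinct colors for the vertices of a triangle, avoiding one given color at each of them. -/
lemma exists_triangle_colors : ∀ p q r : Fin 3, p ≠ q →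
    ∃ a b c : Fin 3, a ≠ b ∧ a ≠ c ∧ b ≠ c ∧ a ≠ p ∧ b ≠ q ∧ c ≠ r := by decide

/-- Used for a diamond whose ends have outer neighbours colored `p` and `q`: both ends, which are
not adjacent, receive `a`, and the two middle vertices receive `b` and `c`. -/
lemma exists_diamond_colors : ∀ p q : Fin 3,
    ∃ a b c : Fin 3, a ≠ b ∧ a ≠ c ∧ b ≠ c ∧ a ≠ p ∧ a ≠ q := by decide

lemma exists_color_ne_two : ∀ p q : Fin 3, ∃ a : Fin 3, a ≠ p ∧ a ≠ q := by decide

/-- Removal of a triangle `x y z` with outer neighbours `x'`, `y'`, and addition of the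
edge `x' y'`. -/
def bypass (G : SimpleGraph V) (D : Set V) (x' y' : V) (hne : x' ≠ y') : SimpleGraph V where
  Adj u v := (isolate G D).Adj u v ∨ (u = x' ∧ v = y') ∨ (u = y' ∧ v = x')
  symm := ⟨fun _ _ h => by
    rcases h with h | h | h
    · exact Or.inl h.symm
    · exact Or.inr (Or.inr ⟨h.2, h.1⟩)
    · exact Or.inr (Or.inl ⟨h.2, h.1⟩)⟩
  loopless := ⟨fun u h => by
    rcases h with h | h | h
    · exact (isolate G D).loopless.irrefl _ h
    · exact hne (h.1.symm.trans h.2)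
    · exact hne (h.2.symm.trans h.1)⟩

/-- The neighbourhood of the outer neighbour `x'` of `x` after removal of the triangle. -/
lemma outer_nbrs {G : SimpleGraph V} (hG : Reduced G) (hreg : ∀ v w, G.Adj v w → deg G v = 3)
    (hdia : ∀ a b u v, G.Adj a b → G.Adj a u → G.Adj a v → G.Adj b u → G.Adj b v → u = v)
    {x y z x' : V} (hxy : G.Adj x y) (hxz : G.Adj x z) (hyz : G.Adj y z) (hx' : G.Adj x x')
    (hx'y : x' ≠ y) (hx'z : x' ≠ z) :
    ¬ G.Adj x' y ∧ ¬ G.Adj x' z ∧ ∃ s t, G.Adj s t ∧ G.Adj x' s ∧ G.Adj x' t ∧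
      s ≠ x ∧ t ≠ x ∧ ∀ w, G.Adj x' w → w = x ∨ w = s ∨ w = t := by
  -- With such an edge, `x'` and `z` would be two common neighbours of `x` and `y`, against `hdia`.
  have hy : ¬ G.Adj x' y := fun h => hx'z (hdia x y x' z hxy hx' hxz h.symm hyz)
  have hz : ¬ G.Adj x' z := fun h => hx'y (hdia x z x' y hxz hx' hxy h.symm hyz.symm)
  obtain ⟨a, b, c, hab, hca, hcb, ha, hb, hadj, hc, hall⟩ :=
    exists_triangle_of_deg_three hG.2.1 (hreg x' x hx'.symm)
  have hxn : ∀ w, G.Adj x w → w = y ∨ w = z ∨ w = x' := fun w hw =>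
    eq_of_deg_le_three (hG.1 x) hxy hxz hx' hyz.ne hx'y.symm hx'z.symm hw
  have hax : a ≠ x := by
    rintro rfl
    rcases hxn b hadj with rfl | rfl | rfl
    · exact hy hb
    · exact hz hb
    · exact hb.ne rfl
  have hbx : b ≠ x := by
    rintro rfl
    rcases hxn a hadj.symm with rfl | rfl | rfl
    · exact hy ha
    · exact hz ha
    · exact ha.ne rfl
  have hcx : c = x := by
    rcases hall x hx'.symm with h | h | h
    · exact absurd h.symm hax
    · exact absurd h.symm hbx
    · exact h.symm
  exact ⟨hy, hz, a, b, hadj, ha, hb, hax, hbx, fun w hw => by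
    rcases hall w hw with h | h | h
    · exact Or.inr (Or.inl h)
    · exact Or.inr (Or.inr h)
    · exact Or.inl (h.trans hcx)⟩

/-- At `x'` the new neighbour `y'` takes the place of `x`, and the other two neighbours are
adjacent; so the degree does not grow and no claw arises there, and likewise at `y'`. A `K₄`
containing both `x'` and `y'` would have two further vertices that form a diamond of `G` with them,
and any other `K₄` lies already in `G`. -/
lemma reduced_bypass {G : SimpleGraph V} (hG : Reduced G)
    (hreg : ∀ v w, G.Adj v w → deg G v = 3)
    (hdia : ∀ a b u v, G.Adj a b → G.Adj a u → G.Adj a v → G.Adj b u → G.Adj b v → u = v)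
    {x y z x' y' : V} (hxy : G.Adj x y) (hxz : G.Adj x z) (hyz : G.Adj y z) (hx' : G.Adj x x')
    (hx'y : x' ≠ y) (hx'z : x' ≠ z) (hy' : G.Adj y y') (hy'x : y' ≠ x) (hy'z : y' ≠ z)
    (hne : x' ≠ y') : Reduced (bypass G {x, y, z} x' y' hne) := by
  obtain ⟨-, -, s, t, hst, hxs, hxt, hsx, htx, hxall⟩ :=
    outer_nbrs hG hreg hdia hxy hxz hyz hx' hx'y hx'z
  obtain ⟨-, -, p, q, hpq, hyp, hyq, hpy, hqy, hyall⟩ :=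
    outer_nbrs hG hreg hdia hxy.symm hyz hxz hy' hy'x hy'z
  have hiso := reduced_isolate hG {x, y, z}
  have hX : ∀ w, (bypass G {x, y, z} x' y' hne).Adj x' w → w = s ∨ w = t ∨ w = y' := by
    rintro w (h | h | h)
    · rcases hxall w h.1 with h' | h' | h'
      · exact absurd (by simp [h']) h.2.2
      · exact Or.inl h'
      · exact Or.inr (Or.inl h')
    · exact Or.inr (Or.inr h.2)
    · exact absurd h.1 hne
  have hY : ∀ w, (bypass G {x, y, z} x' y' hne).Adj y' w → w = p ∨ w = q ∨ w = x' := by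
    rintro w (h | h | h)
    · rcases hyall w h.1 with h' | h' | h'
      · exact absurd (by simp [h']) h.2.2
      · exact Or.inl h'
      · exact Or.inr (Or.inl h')
    · exact absurd h.1 hne.symm
    · exact Or.inr (Or.inr h.2)
  have hO : ∀ u w, u ≠ x' → u ≠ y' → (bypass G {x, y, z} x' y' hne).Adj u w →
      (isolate G {x, y, z}).Adj u w := by
    rintro u w h1 h2 (h | h | h)
    · exact h
    · exact absurd h.1 h1
    · exact absurd h.1 h2
  have hcard : ∀ a b c : V, ({a, b, c} : Set V).ncard ≤ 3 := fun a b c => by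
    refine (Set.ncard_insert_le _ _).trans ?_
    have := Set.ncard_insert_le b {c}
    rw [Set.ncard_singleton] at this
    omega
  refine ⟨fun v => ?_, ?_, ?_⟩
  · by_cases h1 : v = x'
    · subst h1
      exact (deg_le_of_subset (S := {s, t, y'}) (fun w hw => by simpa using hX w hw)).trans
        (hcard _ _ _)
    · by_cases h2 : v = y'
      · subst h2
        exact (deg_le_of_subset (S := {p, q, x'}) (fun w hw => by simpa using hY w hw)).trans
          (hcard _ _ _)
      · exact (deg_le_of_subset (fun w hw => hO v w h1 h2 hw)).trans (hiso.1 v)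
  · have hadj : ∀ {u w a b : V}, (bypass G {x, y, z} x' y' hne).Adj u a →
        (bypass G {x, y, z} x' y' hne).Adj u b → G.Adj a b →
        (bypass G {x, y, z} x' y' hne).Adj a b := by
      have hD : ∀ u a : V, (bypass G {x, y, z} x' y' hne).Adj u a → a ∉ ({x, y, z} : Set V) := by
        rintro u a (h | h | h)
        · exact h.2.2
        · rw [h.2]; simp [hy'x, hy'z, hy'.ne.symm]
        · rw [h.2]; simp [hx'y, hx'z, hx'.ne.symm]
      intro u w a b h1 h2 h3
      exact Or.inl ⟨h3, hD _ _ h1, hD _ _ h2⟩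
    intro v a b c ha hb hc hab hbc hac
    have key : G.Adj a b ∨ G.Adj b c ∨ G.Adj a c := by
      by_cases h1 : v = x'
      · subst h1
        have := hst.symm
        grind
      · by_cases h2 : v = y'
        · subst h2
          have := hpq.symm
          grind
        · exact hG.2.1 v a b c (hO v a h1 h2 ha).1 (hO v b h1 h2 hb).1 (hO v c h1 h2 hc).1
            hab hbc hac
    rcases key with h | h | h
    · exact Or.inl (hadj (w := v) ha hb h)
    · exact Or.inr (Or.inl (hadj (w := v) hb hc h))
    · exact Or.inr (Or.inr (hadj (w := v) ha hc h))
  · have main : ∀ c d, (bypass G {x, y, z} x' y' hne).Adj x' c →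
        (bypass G {x, y, z} x' y' hne).Adj x' d →
        (bypass G {x, y, z} x' y' hne).Adj y' c →
        (bypass G {x, y, z} x' y' hne).Adj y' d →
        (bypass G {x, y, z} x' y' hne).Adj c d → False := by
      intro c d h1 h2 h3 h4 h5
      have e1 := hO c x' h1.ne.symm h3.ne.symm h1.symm
      have e2 := hO d x' h2.ne.symm h4.ne.symm h2.symm
      have e3 := hO c y' h1.ne.symm h3.ne.symm h3.symm
      have e4 := hO d y' h2.ne.symm h4.ne.symm h4.symm
      have e5 := hO c d h1.ne.symm h3.ne.symm h5
      exact hne (hdia c d x' y' e5.1 e1.1 e3.1 e2.1 e4.1)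
    intro a b c d hab hac had hbc hbd hcd
    by_cases hx : (a = x' ∨ b = x' ∨ c = x' ∨ d = x') ∧ (a = y' ∨ b = y' ∨ c = y' ∨ d = y')
    · have := hab.symm
      have := hac.symm
      have := had.symm
      have := hbc.symm
      have := hbd.symm
      have := hcd.symm
      obtain ⟨h1 | h1 | h1 | h1, h2 | h2 | h2 | h2⟩ := hx <;>
        first
        | (exact absurd (h1.symm.trans h2) hne)
        | (subst h1 h2
           first
           | exact main c d ‹_› ‹_› ‹_› ‹_› ‹_›
           | exact main b d ‹_› ‹_› ‹_› ‹_› ‹_›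
           | exact main b c ‹_› ‹_› ‹_› ‹_› ‹_›
           | exact main a d ‹_› ‹_› ‹_› ‹_› ‹_›
           | exact main a c ‹_› ‹_› ‹_› ‹_› ‹_›
           | exact main a b ‹_› ‹_› ‹_› ‹_› ‹_›)
    · have hA : ∀ u w, (bypass G {x, y, z} x' y' hne).Adj u w →
          ¬ (u = x' ∧ w = y') → ¬ (u = y' ∧ w = x') → (isolate G {x, y, z}).Adj u w := by
        rintro u w (h | h | h) h1 h2
        · exact h
        · exact absurd h h1
        · exact absurd h h2
      exact hiso.2.2 a b c d (hA _ _ hab (by tauto) (by tauto)) (hA _ _ hac (by tauto) (by tauto))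
        (hA _ _ had (by tauto) (by tauto)) (hA _ _ hbc (by tauto) (by tauto))
        (hA _ _ hbd (by tauto) (by tauto)) (hA _ _ hcd (by tauto) (by tauto))

/-- A form of Brooks' theorem for claw-free graphs of maximum degree at most 3. -/
theorem exists_coloring_of_reduced (G : SimpleGraph V) (hG : Reduced G) :
    ∃ c : V → Fin 3, ∀ u v, G.Adj u v → c u ≠ c v := by
  classical
  induction hm : {v | ∃ w, G.Adj v w}.ncard using Nat.strong_induction_on generalizing G with
  | _ m ih =>
  by_cases hE : ∃ x y, G.Adj x y
  swap
  · push Not at hE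
    exact ⟨fun _ => 0, fun u v h => absurd h (hE u v)⟩
  -- A non-isolated vertex of degree at most 2 is colored last, greedily.
  by_cases hlow : ∃ x y, G.Adj x y ∧ deg G x ≠ 3
  · obtain ⟨x, y, hxy, hd⟩ := hlow
    have hd2 : deg G x ≤ 2 := by have := hG.1 x; omega
    obtain ⟨c, hc⟩ := ih _ (hm ▸ support_ncard_lt hxy (fun w h => h.2.1 rfl)
      (fun u w h => ⟨w, h.1⟩)) (isolate G {x}) (reduced_isolate hG _) rfl
    obtain ⟨z, hz⟩ : ∃ z, ∀ w, G.Adj x w → w = y ∨ w = z := by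
      by_cases h : ∃ z, G.Adj x z ∧ z ≠ y
      · obtain ⟨z, hz, hzy⟩ := h
        exact ⟨z, fun w hw => eq_or_eq_of_deg_le_two hd2 hxy hz hzy.symm hw⟩
      · push Not at h
        exact ⟨y, fun w hw => Or.inl (h w hw)⟩
    obtain ⟨a, hay, haz⟩ := exists_color_ne_two (c y) (c z)
    refine ⟨Function.update c x a, fun u v huv => ?_⟩
    have hx : ∀ w, G.Adj x w → a ≠ c w := fun w hw => by
      rcases hz w hw with rfl | rfl <;> assumption
    by_cases hu : u = x
    · subst hu
      rw [Function.update_self, Function.update_of_ne huv.ne.symm]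
      exact hx v huv
    · by_cases hv : v = x
      · subst hv
        rw [Function.update_self, Function.update_of_ne huv.ne]
        exact (hx u huv.symm).symm
      · rw [Function.update_of_ne hu, Function.update_of_ne hv]
        exact hc u v ⟨huv, hu, hv⟩
  push Not at hlow
  -- In a diamond, each of the ends `u`, `v` has a single neighbour besides `a` and `b`, so one
  -- color is free for both ends; the remaining two colors go to `a` and `b`.
  by_cases hdia : ∃ a b u v, G.Adj a b ∧ G.Adj a u ∧ G.Adj a v ∧ G.Adj b u ∧ G.Adj b v ∧ u ≠ v
  · obtain ⟨a, b, u, v, hab, hau, hav, hbu, hbv, huv⟩ := hdia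
    have hnuv : ¬ G.Adj u v := fun h => hG.2.2 a b u v hab hau hav hbu hbv h
    obtain ⟨c, hc⟩ := ih _ (hm ▸ support_ncard_lt hab (fun w h => h.2.1 (by simp))
      (fun u w h => ⟨w, h.1⟩)) (isolate G {a, b, u, v}) (reduced_isolate hG _) rfl
    obtain ⟨u', -, -, -, hu'⟩ :=
      exists_third_of_deg_three (hlow u a hau.symm) hau.symm hbu.symm hab.ne
    obtain ⟨v', -, -, -, hv'⟩ :=
      exists_third_of_deg_three (hlow v a hav.symm) hav.symm hbv.symm hab.ne
    have ha : ∀ w, G.Adj a w → w = b ∨ w = u ∨ w = v := fun w hw =>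
      eq_of_deg_le_three (hG.1 a) hab hau hav hbu.ne hbv.ne huv hw
    have hb : ∀ w, G.Adj b w → w = a ∨ w = u ∨ w = v := fun w hw =>
      eq_of_deg_le_three (hG.1 b) hab.symm hbu hbv hau.ne hav.ne huv hw
    obtain ⟨p, q, r, hpq, hpr, hqr, hp1, hp2⟩ := exists_diamond_colors (c u') (c v')
    let f : V → Fin 3 := fun w => if w = u ∨ w = v then p else if w = a then q else
      if w = b then r else c w
    have hne := And.intro hab.ne (And.intro hau.ne (And.intro hav.ne
      (And.intro hbu.ne hbv.ne)))
    have hf : ∀ w₁ w₂, G.Adj w₁ w₂ → (w₁ = a ∨ w₁ = b ∨ w₁ = u ∨ w₁ = v) → f w₁ ≠ f w₂ := by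
      intro w₁ w₂ hw h
      have := hw.ne
      have hnvu : ¬ G.Adj v u := fun h => hnuv h.symm
      simp only [f]
      rcases h with rfl | rfl | rfl | rfl
      · have := ha w₂ hw; grind
      · have := hb w₂ hw; grind
      · have := hu' w₂ hw; grind
      · have := hv' w₂ hw; grind
    refine ⟨f, fun w₁ w₂ hw => ?_⟩
    by_cases h1 : w₁ = a ∨ w₁ = b ∨ w₁ = u ∨ w₁ = v
    · exact hf _ _ hw h1
    · by_cases h2 : w₂ = a ∨ w₂ = b ∨ w₂ = u ∨ w₂ = v
      · exact (hf _ _ hw.symm h2).symm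
      · have h3 := hc w₁ w₂ ⟨hw, by simpa using h1, by simpa using h2⟩
        have h1' : f w₁ = c w₁ := by simp only [f]; grind
        have h2' : f w₂ = c w₂ := by simp only [f]; grind
        rwa [h1', h2']
  -- Now non-isolated vertices have degree 3 and no edge lies in two triangles. A triangle is
  -- bypassed: the added edge gives its outer neighbours `x'` and `y'` different colors, so the
  -- colors forbidden on the triangle are not all equal and it can be completed.
  push Not at hdia
  obtain ⟨x, w, hxw⟩ := hE
  obtain ⟨y, z, x', hyz, hx'y, hx'z, hxy, hxz, hyz', hx', hxall⟩ :=
    exists_triangle_of_deg_three hG.2.1 (hlow x w hxw)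
  obtain ⟨y', hy'x, hy'z, hy', hyall⟩ :=
    exists_third_of_deg_three (hlow y x hxy.symm) hxy.symm hyz' hxz.ne
  obtain ⟨z', hz'x, hz'y, hz', hzall⟩ :=
    exists_third_of_deg_three (hlow z x hxz.symm) hxz.symm hyz'.symm hxy.ne
  have hne : x' ≠ y' := fun h =>
    hx'z (hdia x y x' z hxy hx' hxz (h ▸ hy') hyz')
  have hred := reduced_bypass hG hlow hdia hxy hxz hyz' hx' hx'y hx'z hy' hy'x hy'z hne
  have hsupp : ∀ u w, (bypass G {x, y, z} x' y' hne).Adj u w → ∃ w', G.Adj u w' := by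
    rintro u w (h | h | h)
    · exact ⟨w, h.1⟩
    · exact ⟨x, h.1 ▸ hx'.symm⟩
    · exact ⟨y, h.1 ▸ hy'.symm⟩
  have hxiso : ∀ w, ¬ (bypass G {x, y, z} x' y' hne).Adj x w := by
    rintro w (h | h | h)
    · exact h.2.1 (by simp)
    · exact hx'.ne h.1
    · exact hy'x h.1.symm
  obtain ⟨c, hc⟩ := ih _ (hm ▸ support_ncard_lt hxy hxiso hsupp) _ hred rfl
  obtain ⟨p, q, r, hpq, hpr, hqr, hp, hq, hr⟩ :=
    exists_triangle_colors (c x') (c y') (c z') (hc _ _ (Or.inr (Or.inl ⟨rfl, rfl⟩)))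
  let f : V → Fin 3 := fun w => if w = x then p else if w = y then q else if w = z then r else c w
  have hfc : ∀ w, ¬ (w = x ∨ w = y ∨ w = z) → f w = c w := fun w hw => by
    simp only [f]; grind
  have hf : ∀ w₁ w₂, G.Adj w₁ w₂ → (w₁ = x ∨ w₁ = y ∨ w₁ = z) → f w₁ ≠ f w₂ := by
    intro w₁ w₂ hw h
    have := hx'.ne
    have := hy'.ne
    have := hz'.ne
    have := hxy.ne
    have := hxz.ne
    have := hw.ne
    simp only [f]
    rcases h with rfl | rfl | rfl
    · have := hxall w₂ hw; grind
    · have := hyall w₂ hw; grind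
    · have := hzall w₂ hw; grind
  refine ⟨f, fun w₁ w₂ hw => ?_⟩
  by_cases h1 : w₁ = x ∨ w₁ = y ∨ w₁ = z
  · exact hf _ _ hw h1
  · by_cases h2 : w₂ = x ∨ w₂ = y ∨ w₂ = z
    · exact (hf _ _ hw.symm h2).symm
    · rw [hfc _ h1, hfc _ h2]
      exact hc w₁ w₂ (Or.inl ⟨hw, by simpa using h1, by simpa using h2⟩)

end Coloring

/-! ### Threads -/

section Threads

variable {V : Type*} {G : SimpleGraph V}

/-- A walk `x 0, …, x k` that does not turn back and whose internal vertices have degree 2. -/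
def IsThread (G : SimpleGraph V) (x : ℕ → V) (k : ℕ) : Prop :=
  (∀ m < k, G.Adj (x m) (x (m + 1))) ∧
  ∀ m, m + 1 < k → deg G (x (m + 1)) = 2 ∧ x m ≠ x (m + 2)

lemma IsThread.reverse {x : ℕ → V} {k : ℕ} (hx : IsThread G x k) :
    IsThread G (fun m => x (k - m)) k := by
  refine ⟨fun m hm => ?_, fun m hm => ?_⟩
  · have := hx.1 (k - (m + 1)) (by omega)
    rw [show k - (m + 1) + 1 = k - m by omega] at this
    exact this.symm
  · have := hx.2 (k - (m + 2)) (by omega)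
    rw [show k - (m + 2) + 1 = k - (m + 1) by omega,
      show k - (m + 2) + 2 = k - m by omega] at this
    exact ⟨this.1, this.2.symm⟩

lemma isThread_zero (x : ℕ → V) : IsThread G x 0 :=
  ⟨fun _ h => absurd h (by omega), fun _ h => absurd h (by omega)⟩

/-- The pair of vertices that follows the pair `d` when moving along a thread. -/
noncomputable def advance (G : SimpleGraph V) (d : V × V) : V × V :=
  open Classical in
  -- The default `d.1` is irrelevant: it occurs only when there is no way on, and tracks are used
  -- only up to their first later vertex of degree other than 2.
  (d.2, if h : ∃ w, w ≠ d.1 ∧ G.Adj d.2 w then h.choose else d.1)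

/-- The thread that starts with `u`, `w`. -/
noncomputable def track (G : SimpleGraph V) (u w : V) (m : ℕ) : V := ((advance G)^[m] (u, w)).1

lemma track_zero (u w : V) : track G u w 0 = u := rfl

lemma track_succ (u w : V) (m : ℕ) : track G u w (m + 1) = ((advance G)^[m] (u, w)).2 := by
  rw [track, Function.iterate_succ_apply']
  rfl

lemma track_one (u w : V) : track G u w 1 = w := track_succ u w 0

lemma iterate_advance (u w : V) (m : ℕ) :
    (advance G)^[m] (u, w) = (track G u w m, track G u w (m + 1)) := by
  rw [track_succ, track]

lemma track_spec (u w : V) (m : ℕ) (h : deg G (track G u w (m + 1)) = 2) :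
    track G u w (m + 2) ≠ track G u w m ∧
      G.Adj (track G u w (m + 1)) (track G u w (m + 2)) := by
  have hex : ∃ b, b ≠ track G u w m ∧ G.Adj (track G u w (m + 1)) b := by
    by_contra! h'
    obtain ⟨p, q, hpq, hs⟩ := Set.ncard_eq_two.1 h
    have hp : G.Adj (track G u w (m + 1)) p := by
      rw [← SimpleGraph.mem_neighborSet, hs]; simp
    have hq : G.Adj (track G u w (m + 1)) q := by
      rw [← SimpleGraph.mem_neighborSet, hs]; simp
    by_cases hpm : p = track G u w m
    · exact h' q (fun hq' => hpq (hpm.trans hq'.symm)) hq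
    · exact h' p hpm hp
  have e : track G u w (m + 2) = (advance G (track G u w m, track G u w (m + 1))).2 := by
    rw [track_succ, Function.iterate_succ_apply', iterate_advance]
  rw [e, advance]
  simp only
  rw [dif_pos hex]
  exact hex.choose_spec

lemma isThread_track {u w : V} (huw : G.Adj u w) {k : ℕ}
    (h : ∀ m, m + 1 < k → deg G (track G u w (m + 1)) = 2) : IsThread G (track G u w) k := by
  refine ⟨fun m hm => ?_, fun m hm => ⟨h m hm, (track_spec u w m (h m hm)).1.symm⟩⟩
  rcases m with _ | m
  · rw [track_one, track_zero]; exact huw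
  · exact (track_spec u w m (h m (by omega))).2

variable [Finite V]

lemma IsThread.eq_or_eq {x : ℕ → V} {k m : ℕ} (hx : IsThread G x k) (hm : m + 1 < k) {w : V}
    (hw : G.Adj (x (m + 1)) w) : w = x m ∨ w = x (m + 2) :=
  eq_or_eq_of_deg_le_two (hx.2 m hm).1.le (hx.1 m (by omega)).symm (hx.1 (m + 1) hm)
    (hx.2 m hm).2 hw

/-- A coincidence moves towards the start: the predecessor of `x i` is a neighbour of the internal
vertex `x j`, hence is `x (j - 1)` or `x (j + 1)`. The sum of the two indices does not grow, so the
range of the thread is never left. -/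
lemma IsThread.exists_eq_start {x : ℕ → V} {k : ℕ} (hx : IsThread G x k) :
    ∀ i j, i < j → i + j ≤ k → x i = x j → ∃ l, 0 < l ∧ l ≤ i + j ∧ x 0 = x l := by
  intro i
  induction i with
  | zero => exact fun j hj _ h => ⟨j, hj, by omega, h⟩
  | succ i ih =>
    intro j hj hk h
    obtain ⟨j, rfl⟩ : ∃ j', j = j' + 1 := ⟨j - 1, by omega⟩
    rcases hx.eq_or_eq (m := j) (by omega) (h ▸ (hx.1 i (by omega)).symm) with h' | h'
    · obtain ⟨l, h1, h2, h3⟩ := ih j (by omega) (by omega) h'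
      exact ⟨l, h1, by omega, h3⟩
    · obtain ⟨l, h1, h2, h3⟩ := ih (j + 2) (by omega) (by omega) h'
      exact ⟨l, h1, by omega, h3⟩

/-- Coincidences are again traced back to the start. There they fail, since a vertex of degree other
than 2 is not internal and the two ends are distinct. -/
lemma IsThread.ne_of_lt {x : ℕ → V} {k : ℕ} (hx : IsThread G x k) (h0 : deg G (x 0) ≠ 2)
    (hk : deg G (x k) ≠ 2) (hne : x 0 ≠ x k) : ∀ i j, i < j → j ≤ k → x i ≠ x j := by
  intro i
  induction i with
  | zero =>
    intro j hj hjk h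
    rcases hjk.lt_or_eq with h' | rfl
    · obtain ⟨j, rfl⟩ : ∃ j', j = j' + 1 := ⟨j - 1, by omega⟩
      exact h0 (h ▸ (hx.2 j h').1)
    · exact hne h
  | succ i ih =>
    intro j hj hjk h
    rcases hjk.lt_or_eq with h' | rfl
    · obtain ⟨j, rfl⟩ : ∃ j', j = j' + 1 := ⟨j - 1, by omega⟩
      rcases hx.eq_or_eq h' (h ▸ (hx.1 i (by omega)).symm) with h'' | h''
      · exact ih j (by omega) (by omega) h''
      · exact ih (j + 2) (by omega) (by omega) h''
    · exact hk (h ▸ (hx.2 i hj).1)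

/-- If all later vertices had degree 2, finiteness would give a repetition, and tracing it back the
track would return to `u`, whose degree is not 2. -/
lemma exists_track_end {u w : V} (huw : G.Adj u w) (hu : deg G u ≠ 2) :
    ∃ k, 0 < k ∧ IsThread G (track G u w) k ∧ deg G (track G u w k) ≠ 2 := by
  classical
  have hex : ∃ k, deg G (track G u w (k + 1)) ≠ 2 := by
    by_contra! h
    have ht : ∀ k, IsThread G (track G u w) k := fun k => isThread_track huw fun m _ => h m
    obtain ⟨i, j, hij, he⟩ := Finite.exists_ne_map_eq_of_infinite (track G u w)
    wlog hlt : i < j generalizing i j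
    · exact this j i hij.symm he.symm (by omega)
    obtain ⟨l, hl, -, hl'⟩ := (ht (i + j)).exists_eq_start i j hlt le_rfl he
    obtain ⟨l, rfl⟩ : ∃ l', l = l' + 1 := ⟨l - 1, by omega⟩
    exact hu (by rw [← track_zero (G := G) u w, hl']; exact h l)
  refine ⟨Nat.find hex + 1, by omega, isThread_track huw fun m hm => ?_, Nat.find_spec hex⟩
  exact not_not.1 (Nat.find_min hex (by omega))

/-- At a vertex of degree 2 a walk that does not turn back has only one continuation. -/
lemma IsThread.eq_of_start_eq {x y : ℕ → V} {k l : ℕ} (hx : IsThread G x k) (hy : IsThread G y l)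
    (h0 : x 0 = y 0) (h1 : x 1 = y 1) : ∀ m, m ≤ k → m ≤ l → x m = y m := by
  intro m
  induction m using Nat.strong_induction_on with
  | _ m ih =>
    intro hk hl
    match m with
    | 0 => exact h0
    | 1 => exact h1
    | m + 2 =>
      have e0 := ih m (by omega) (by omega) (by omega)
      have e1 := ih (m + 1) (by omega) (by omega) (by omega)
      have := hy.1 (m + 1) (by omega)
      rw [← e1] at this
      rcases hx.eq_or_eq (by omega) this with h | h
      · exact absurd (e0.symm.trans h.symm) (hy.2 m (by omega)).2
      · exact h.symm

lemma IsThread.length_eq {x y : ℕ → V} {k l : ℕ} (hx : IsThread G x k) (hy : IsThread G y l)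
    (hxk : deg G (x k) ≠ 2) (hyl : deg G (y l) ≠ 2) (hk : 0 < k) (hl : 0 < l)
    (h0 : x 0 = y 0) (h1 : x 1 = y 1) : k = l := by
  have := hx.eq_of_start_eq hy h0 h1
  obtain ⟨k, rfl⟩ : ∃ k', k = k' + 1 := ⟨k - 1, by omega⟩
  obtain ⟨l, rfl⟩ : ∃ l', l = l' + 1 := ⟨l - 1, by omega⟩
  rcases lt_trichotomy k l with h | h | h
  · exact absurd (hy.2 k (by omega)).1 (by rwa [← this (k + 1) le_rfl (by omega)])
  · rw [h]
  · exact absurd (hx.2 l (by omega)).1 (by rwa [this (l + 1) (by omega) le_rfl])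

/-- A closed thread does not return by the edge by which it left. -/
lemma IsThread.second_ne_penultimate {x : ℕ → V} {k : ℕ} (hx : IsThread G x k) (hk : 0 < k)
    (h0 : x 0 = x k) : x 1 ≠ x (k - 1) := by
  intro h1
  -- The thread would be its own reversal, so in its middle it would turn back (even length) or
  -- traverse a loop (odd length).
  have key := hx.eq_of_start_eq hx.reverse (by simpa using h0) h1
  obtain ⟨m, rfl | rfl⟩ := Nat.even_or_odd' k
  · obtain ⟨m, rfl⟩ : ∃ m', m = m' + 1 := ⟨m - 1, by omega⟩
    have := key m (by omega) (by omega)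
    rw [show 2 * (m + 1) - m = m + 2 by omega] at this
    exact (hx.2 m (by omega)).2 this
  · have := key m (by omega) (by omega)
    rw [show 2 * m + 1 - m = m + 1 by omega] at this
    exact (hx.1 m (by omega)).ne this

/-- Two neighbours of `x 0` are adjacent, and one of `x 1`, `x (k - 1)` is among them, as these two
are distinct. Up to reversal it is `x 1`, which then shares a neighbour with `x 0`. That neighbour
can only be `x 2`, and `x 3` must be `x 0`, whose degree 3 makes it the end. -/
lemma IsThread.length_eq_three {x : ℕ → V} {k : ℕ} (hcf : ClawFree G) (hx : IsThread G x k)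
    (hk : 0 < k) (h0 : x 0 = x k) (hd : deg G (x 0) = 3) : k = 3 := by
  have aux : ∀ y : ℕ → V, IsThread G y k → y 0 = y k → deg G (y 0) = 3 →
      (∃ q, G.Adj (y 1) q ∧ G.Adj (y 0) q) → k = 3 := by
    rintro y hy h0 hd ⟨q, hq1, hq0⟩
    have h1 : k ≠ 1 := by
      rintro rfl
      exact (hy.1 0 (by omega)).ne h0
    have h2 : k ≠ 2 := by
      rintro rfl
      exact (hy.2 0 (by omega)).2 h0
    have hq : q = y 2 := by
      rcases hy.eq_or_eq (m := 0) (by omega) hq1 with h | h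
      · exact absurd h.symm hq0.ne
      · exact h
    subst hq
    rcases hy.eq_or_eq (m := 1) (by omega) hq0.symm with h | h
    · exact absurd h (hy.1 0 (by omega)).ne
    · by_contra h3
      have := (hy.2 2 (by omega)).1
      rw [← h] at this
      omega
  have hne := hx.second_ne_penultimate hk h0
  obtain ⟨p, q, r, hpq, hrp, hrq, hp, hq, hadj, hr, hall⟩ := exists_triangle_of_deg_three hcf hd
  have a1 := hx.1 0 hk
  have a2 := (hx.1 (k - 1) (by omega)).symm
  rw [show k - 1 + 1 = k by omega, ← h0] at a2
  have hrev : (∃ q, G.Adj (x (k - 1)) q ∧ G.Adj (x 0) q) → k = 3 := fun h =>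
    aux _ hx.reverse (by simpa using h0.symm) (by simpa [← h0] using hd)
      (by simpa [← h0] using h)
  rcases hall _ a1 with h | h | h
  · exact aux x hx h0 hd ⟨q, by simpa [h] using hadj, hq⟩
  · exact aux x hx h0 hd ⟨p, by simpa [h] using hadj.symm, hp⟩
  · rcases hall _ a2 with h' | h' | h'
    · exact hrev ⟨q, by simpa [h'] using hadj, hq⟩
    · exact hrev ⟨p, by simpa [h'] using hadj.symm, hp⟩
    · exact absurd (h.trans h'.symm) hne

/-- A thread with distinct ends has no repetition, and a closed one of positive length is a
triangle, where only the positions 0 and 3 coincide. So the position modulo 3 depends on the vertex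
alone, and colors along a thread are well defined. -/
lemma IsThread.mod_three_eq {x : ℕ → V} {k : ℕ} (hmax : ∀ v, deg G v ≤ 3) (hcf : ClawFree G)
    (hx : IsThread G x k) (h0 : deg G (x 0) ≠ 2) (hk : deg G (x k) ≠ 2) {i j : ℕ} (hi : i ≤ k)
    (hj : j ≤ k) (h : x i = x j) : i % 3 = j % 3 := by
  by_cases hne : x 0 = x k
  swap
  · rcases lt_trichotomy i j with h' | h' | h'
    · exact absurd h (hx.ne_of_lt h0 hk hne i j h' hj)
    · rw [h']
    · exact absurd h.symm (hx.ne_of_lt h0 hk hne j i h' hi)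
  rcases Nat.eq_zero_or_pos k with rfl | hpos
  · rw [show i = j by omega]
  have a1 := hx.1 0 hpos
  have a2 := (hx.1 (k - 1) (by omega)).symm
  rw [show k - 1 + 1 = k by omega, ← hne] at a2
  have hd : deg G (x 0) = 3 := by
    have h3 := hmax (x 0)
    by_contra h'
    exact hx.second_ne_penultimate hpos hne (eq_of_deg_le_one (by omega) a2 a1)
  obtain rfl := hx.length_eq_three hcf hpos hne hd
  have b1 := (hx.1 0 (by omega)).ne
  have b2 := (hx.1 1 (by omega)).ne
  have b3 := (hx.1 2 (by omega)).ne
  simp only [Nat.reduceAdd, zero_add] at b1 b2 b3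
  interval_cases i <;> interval_cases j <;> first | rfl | (exfalso; grind)

/-- In a connected graph with a vertex of degree other than 2, every vertex lies on a
thread whose ends have degree other than 2. -/
lemma exists_thread_through (hconn : G.Connected) {v₀ : V} (h₀ : deg G v₀ ≠ 2) (y : V) :
    ∃ x k m, IsThread G x k ∧ deg G (x 0) ≠ 2 ∧ deg G (x k) ≠ 2 ∧ m ≤ k ∧ x m = y := by
  obtain ⟨p⟩ := hconn.preconnected v₀ y
  have key : ∀ (a b : V) (p : G.Walk a b), (∃ x k m, IsThread G x k ∧ deg G (x 0) ≠ 2 ∧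
      deg G (x k) ≠ 2 ∧ m ≤ k ∧ x m = a) → ∃ x k m, IsThread G x k ∧ deg G (x 0) ≠ 2 ∧
      deg G (x k) ≠ 2 ∧ m ≤ k ∧ x m = b := by
    intro a b p
    induction p with
    | nil => exact id
    | @cons a w b hadj p ih =>
      rintro ⟨x, k, m, hx, h0, hk, hm, rfl⟩
      apply ih
      -- A vertex of degree 2 is internal to its thread, which thus contains its neighbours; from
      -- any other vertex a new thread starts along the edge.
      by_cases hd : deg G (x m) = 2
      · have hm0 : m ≠ 0 := by rintro rfl; exact h0 hd
        have hmk : m ≠ k := by rintro rfl; exact hk hd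
        obtain ⟨m, rfl⟩ : ∃ m', m = m' + 1 := ⟨m - 1, by omega⟩
        rcases hx.eq_or_eq (by omega) hadj with h | h
        · exact ⟨x, k, m, hx, h0, hk, by omega, h.symm⟩
        · exact ⟨x, k, m + 2, hx, h0, hk, by omega, h.symm⟩
      · obtain ⟨l, hl, ht, he⟩ := exists_track_end hadj hd
        exact ⟨_, l, 1, ht, by rwa [track_zero], he, hl, track_one _ _⟩
  exact key v₀ y p ⟨fun _ => v₀, 0, 0, isThread_zero _, h₀, h₀, le_rfl, rfl⟩

end Threads

/-! ### Threads and the paths `A_i` -/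

section Core

variable {V : Type*} {G : SimpleGraph V}

lemma exists_walk_of_adj {x : ℕ → V} {k : ℕ} (hx : ∀ m < k, G.Adj (x m) (x (m + 1))) :
    ∃ p : G.Walk (x 0) (x k), p.length = k ∧ p.support = (List.range (k + 1)).map x := by
  induction k with
  | zero => exact ⟨.nil, rfl, by simp⟩
  | succ k ih =>
    obtain ⟨p, hl, hs⟩ := ih fun m hm => hx m (by omega)
    refine ⟨p.concat (hx k (by omega)), by simp [hl], ?_⟩
    rw [SimpleGraph.Walk.support_concat, hs, List.range_succ (n := k + 1)]
    simp

/-- The sequence with the given first terms. -/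
def firstTerms (a b c d : V) : ℕ → V
  | 0 => a
  | 1 => b
  | 2 => c
  | _ => d

lemma isThread_one {u v : V} (h : G.Adj u v) : IsThread G (firstTerms u v v v) 1 :=
  ⟨fun m hm => by obtain rfl : m = 0 := by omega
                  exact h, fun m hm => absurd hm (by omega)⟩

lemma isThread_two {u v w : V} (h : G.Adj u v) (h' : G.Adj v w) (hd : deg G v = 2) (hne : u ≠ w) :
    IsThread G (firstTerms u v w w) 2 := by
  refine ⟨fun m hm => ?_, fun m hm => ?_⟩
  · interval_cases m
    exacts [h, h']
  · obtain rfl : m = 0 := by omega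
    exact ⟨hd, hne⟩

lemma isThread_three {u v w : V} (h : G.Adj u v) (h' : G.Adj v w) (h'' : G.Adj w u)
    (hv : deg G v = 2) (hw : deg G w = 2) :
    IsThread G (firstTerms u v w u) 3 := by
  refine ⟨fun m hm => ?_, fun m hm => ?_⟩
  · interval_cases m
    exacts [h, h', h'']
  · have : m < 2 := by omega
    interval_cases m
    exacts [⟨hv, h''.ne.symm⟩, ⟨hw, h.ne.symm⟩]

/-- The image of `f` is closed under taking neighbours in `G`, so by connectedness it is everything;
the same closure property and injectivity show that `f` reflects adjacency. -/
lemma nonempty_iso_of_closed {W : Type*} {K : SimpleGraph W} [Nonempty W] (hconn : G.Connected)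
    (f : W → V) (hinj : Function.Injective f) (hadj : ∀ s t, K.Adj s t → G.Adj (f s) (f t))
    (hcl : ∀ s w, G.Adj (f s) w → ∃ t, K.Adj s t ∧ f t = w) : Nonempty (G ≃g K) := by
  have hsurj : Function.Surjective f := by
    intro y
    obtain ⟨s⟩ := ‹Nonempty W›
    obtain ⟨p⟩ := hconn.preconnected (f s) y
    have key : ∀ (a b : V) (p : G.Walk a b), (∃ s, f s = a) → ∃ s, f s = b := by
      intro a b p
      induction p with
      | nil => exact id
      | cons h p ih =>
        rintro ⟨s, rfl⟩
        obtain ⟨t, -, ht⟩ := hcl s _ h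
        exact ih ⟨t, ht⟩
    exact key _ _ p ⟨s, rfl⟩
  refine ⟨SimpleGraph.Iso.symm ⟨Equiv.ofBijective f ⟨hinj, hsurj⟩, ?_⟩⟩
  intro s t
  refine ⟨fun h => ?_, hadj s t⟩
  obtain ⟨t', ht', he⟩ := hcl s _ h
  rwa [← hinj he]

/-- The vertices of degree 3, adjacent when they are joined by a thread. -/
def core (G : SimpleGraph V) : SimpleGraph V where
  Adj u v := u ≠ v ∧ deg G u = 3 ∧ deg G v = 3 ∧ ∃ x k, IsThread G x k ∧ x 0 = u ∧ x k = v
  symm := ⟨fun _ _ h => by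
    obtain ⟨h1, h2, h3, x, k, hx, h4, h5⟩ := h
    exact ⟨h1.symm, h3, h2, _, k, hx.reverse, by simpa using h5, by simpa using h4⟩⟩
  loopless := ⟨fun _ h => h.1 rfl⟩

lemma core_adj_of_adj {u v : V} (h : G.Adj u v) (hu : deg G u = 3) (hv : deg G v = 3) :
    (core G).Adj u v := ⟨h.ne, hu, hv, _, 1, isThread_one h, rfl, rfl⟩

variable [Finite V]

/-- A path on `k + 1` vertices has `k` edges. On the right no injectivity is demanded: a thread
whose ends are distinct and not of degree 2 is automatically a path. -/
lemma hasA_succ_iff {k : ℕ} (hk : 0 < k) :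
    HasA G (k + 1) ↔ ∃ x, IsThread G x k ∧ deg G (x 0) = 3 ∧ deg G (x k) = 3 ∧ x 0 ≠ x k := by
  constructor
  · rintro ⟨u, v, p, hp, hl, hu, hv, hin⟩
    have hl' : p.length = k := by omega
    have hne : ∀ i j, i ≤ k → j ≤ k → i ≠ j → p.getVert i ≠ p.getVert j := fun i j hi hj hij h =>
      hij (hp.getVert_injOn (by simpa [hl'] using hi) (by simpa [hl'] using hj) h)
    have h0 : p.getVert 0 = u := p.getVert_zero
    have h1 : p.getVert k = v := by rw [← hl']; exact p.getVert_length
    refine ⟨p.getVert, ⟨fun m hm => p.adj_getVert_succ (by omega), fun m hm => ⟨?_, ?_⟩⟩, ?_, ?_, ?_⟩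
    · refine hin _ (p.getVert_mem_support _) ?_ ?_
      · exact fun h => hne (m + 1) 0 (by omega) (by omega) (by omega) (h.trans h0.symm)
      · exact fun h => hne (m + 1) k (by omega) (by omega) (by omega) (h.trans h1.symm)
    · exact hne _ _ (by omega) (by omega) (by omega)
    · rw [h0]; exact hu
    · rw [h1]; exact hv
    · exact hne _ _ (by omega) (by omega) (by omega)
  · rintro ⟨x, hx, h0, hk', hne⟩
    have hinj := hx.ne_of_lt (by omega) (by omega) hne
    obtain ⟨p, hl, hs⟩ := exists_walk_of_adj hx.1
    refine ⟨x 0, x k, p, ?_, by omega, h0, hk', ?_⟩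
    · rw [SimpleGraph.Walk.isPath_def, hs]
      refine List.Nodup.map_on ?_ List.nodup_range
      intro i hi j hj h
      rw [List.mem_range] at hi hj
      rcases lt_trichotomy i j with h' | h' | h'
      · exact absurd h (hinj i j h' (by omega))
      · exact h'
      · exact absurd h.symm (hinj j i h' (by omega))
    · intro w hw hw0 hwk
      rw [hs, List.mem_map] at hw
      obtain ⟨m, hm, rfl⟩ := hw
      rw [List.mem_range] at hm
      have : m ≠ 0 := by rintro rfl; exact hw0 rfl
      have : m ≠ k := by rintro rfl; exact hwk rfl
      obtain ⟨m, rfl⟩ : ∃ m', m = m' + 1 := ⟨m - 1, by omega⟩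
      exact (hx.2 m (by omega)).1

/-- The form in which the exclusion of the `A_{3j+1}` enters the coloring argument. -/
lemma IsThread.mod_three_ne_zero {x : ℕ → V} {k : ℕ}
    (hA : ∀ j : ℕ, 1 ≤ j → ¬ HasA G (3 * j + 1)) (hx : IsThread G x k) (h0 : deg G (x 0) = 3)
    (hk : deg G (x k) = 3) (hne : x 0 ≠ x k) : k % 3 ≠ 0 := by
  intro h
  have : k ≠ 0 := by rintro rfl; exact hne rfl
  refine hA (k / 3) (by omega) ?_
  rw [show 3 * (k / 3) = k by omega]
  exact (hasA_succ_iff (by omega)).2 ⟨x, hx, h0, hk, hne⟩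

/-! ### The graph of threads between vertices of degree 3 -/

/-- The number of edges of the thread that starts with `u`, `w`. -/
noncomputable def threadLength (G : SimpleGraph V) (u w : V) : ℕ :=
  open Classical in
  if h : ∃ k, 0 < k ∧ IsThread G (track G u w) k ∧ deg G (track G u w k) ≠ 2 then h.choose else 0

/-- The last vertex of the thread that starts with `u`, `w`. -/
noncomputable def tip (G : SimpleGraph V) (u w : V) : V := track G u w (threadLength G u w)

lemma threadLength_spec {u w : V} (huw : G.Adj u w) (hu : deg G u ≠ 2) :
    0 < threadLength G u w ∧ IsThread G (track G u w) (threadLength G u w) ∧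
      deg G (tip G u w) ≠ 2 := by
  have h := exists_track_end huw hu
  rw [tip, threadLength, dif_pos h]
  exact h.choose_spec

/-- Evaluates the chosen length and tip from any explicit thread, as two complete threads with the
same first edge coincide. -/
lemma threadLength_eq {u w : V} {x : ℕ → V} {k : ℕ} (hu : deg G u ≠ 2) (hx : IsThread G x k)
    (hk : 0 < k) (hd : deg G (x k) ≠ 2) (h0 : x 0 = u) (h1 : x 1 = w) :
    threadLength G u w = k ∧ tip G u w = x k := by
  have huw : G.Adj u w := by
    have := hx.1 0 hk
    rwa [h0, h1] at this
  obtain ⟨a, b, c⟩ := threadLength_spec huw hu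
  have e := b.length_eq hx c hd a hk (by rw [h0, track_zero]) (by rw [h1, track_one])
  refine ⟨e, ?_⟩
  rw [tip, ← b.eq_of_start_eq hx (by rw [h0, track_zero]) (by rw [h1, track_one]) k e.ge le_rfl, e]

lemma core_neighborSet_subset (u : V) :
    (core G).neighborSet u ⊆ tip G u '' G.neighborSet u := by
  rintro v ⟨hne, hu, hv, x, k, hx, rfl, rfl⟩
  have hk : 0 < k := Nat.pos_of_ne_zero (by rintro rfl; exact hne rfl)
  exact ⟨x 1, hx.1 0 hk, (threadLength_eq (by omega) hx hk (by omega) rfl rfl).2⟩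

lemma deg_core_le (hmax : ∀ v, deg G v ≤ 3) (u : V) : deg (core G) u ≤ 3 :=
  ((Set.ncard_le_ncard (core_neighborSet_subset u) (Set.toFinite _)).trans
    (Set.ncard_image_le (Set.toFinite _))).trans (hmax u)

/-- Each of the at most three neighbours of `u` contributes at most one core neighbour. With three
core neighbours nothing is wasted: no thread from `u` ends in a leaf, returns to `u`, or shares its
tip with another one. -/
lemma tip_of_deg_core_eq_three (hmax : ∀ v, deg G v ≤ 3) {u : V} (h : deg (core G) u = 3) :
    Set.InjOn (tip G u) (G.neighborSet u) ∧ ∀ w, G.Adj u w → (core G).Adj u (tip G u w) := by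
  have hsub := core_neighborSet_subset (G := G) u
  have h1 : (tip G u '' G.neighborSet u).ncard ≤ (G.neighborSet u).ncard :=
    Set.ncard_image_le (Set.toFinite _)
  have h2 : (G.neighborSet u).ncard ≤ 3 := hmax u
  have h3 : ((core G).neighborSet u).ncard = 3 := h
  have heq := Set.eq_of_subset_of_ncard_le hsub (by omega)
  refine ⟨Set.injOn_of_ncard_image_eq ?_ (Set.toFinite _), fun w hw => ?_⟩
  · rw [← heq] at h1 ⊢
    omega
  · have : tip G u w ∈ (core G).neighborSet u := by rw [heq]; exact ⟨w, hw, rfl⟩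
    exact this

/-- Triangles at a vertex with three neighbours in the core consist of vertices of degree 3. -/
lemma deg_eq_three_of_triangle (hmax : ∀ v, deg G v ≤ 3) {u a b : V} (h : deg (core G) u = 3)
    (ha : G.Adj u a) (hb : G.Adj u b) (hab : G.Adj a b) : deg G a = 3 := by
  obtain ⟨hinj, htip⟩ := tip_of_deg_core_eq_three hmax h
  have hu : deg G u = 3 := (htip a ha).2.1
  have two_le : ∀ {v p q : V}, G.Adj v p → G.Adj v q → p ≠ q → 2 ≤ deg G v := by
    intro v p q hp hq hpq
    by_contra hlt
    exact hpq (eq_of_deg_le_one (by omega) hq hp)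
  have ha2 := two_le ha.symm hab hb.ne
  have hb2 := two_le hb.symm hab.symm ha.ne
  have := hmax a
  have := hmax b
  by_contra hne
  have ha2' : deg G a = 2 := by omega
  -- If `b` has degree 3, the threads `u b` and `u a b` share their tip; otherwise `u a b u` is a
  -- closed thread.
  by_cases hb3 : deg G b = 3
  · have e1 := (threadLength_eq (u := u) (by omega) (isThread_one hb) (by omega)
      (by change deg G b ≠ 2; omega) rfl rfl).2
    have e2 := (threadLength_eq (u := u) (by omega) (isThread_two ha hab ha2' hb.ne) (by omega)
      (by change deg G b ≠ 2; omega) rfl rfl).2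
    exact hab.ne (hinj ha hb (e2.trans e1.symm))
  · have e := (threadLength_eq (u := u) (by omega) (isThread_three ha hab hb.symm ha2' (by omega)) (by omega)
      (by change deg G u ≠ 2; omega) rfl rfl).2
    exact (htip a ha).ne e.symm

/-- A vertex with three core neighbours lies in a triangle of `G` whose vertices all have degree 3,
and this triangle persists in the core. -/
lemma clawFree_core (hmax : ∀ v, deg G v ≤ 3) (hcf : ClawFree G) : ClawFree (core G) := by
  intro v x y z hx hy hz hxy hyz hxz
  have hall := fun w hw => eq_of_deg_le_three (w := w) (deg_core_le hmax v) hx hy hz hxy hxz hyz hw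
  have hd : deg (core G) v = 3 := by
    refine le_antisymm (deg_core_le hmax v) ?_
    have : ({x, y, z} : Set V).ncard ≤ deg (core G) v :=
      Set.ncard_le_ncard (by rintro w (rfl | rfl | rfl) <;> assumption) (Set.toFinite _)
    rwa [Set.ncard_eq_three.2 ⟨x, y, z, hxy, hxz, hyz, rfl⟩] at this
  obtain ⟨a, b, c, hab, -, -, ha, hb, hadj, -, -⟩ := exists_triangle_of_deg_three hcf hx.2.1
  have ha3 := deg_eq_three_of_triangle hmax hd ha hb hadj
  have hb3 := deg_eq_three_of_triangle hmax hd hb ha hadj.symm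
  have h1 := core_adj_of_adj hadj ha3 hb3
  have h2 := h1.symm
  have h3 := hall a (core_adj_of_adj ha hx.2.1 ha3)
  have h4 := hall b (core_adj_of_adj hb hx.2.1 hb3)
  grind

/-! ### Recognizing `K₄` with a subdivided edge -/

lemma k4Path_adj_inl {i : ℕ} {a b : Fin i} :
    (k4Path i).Adj (.inl a) (.inl b) ↔ a.val + 1 = b.val ∨ b.val + 1 = a.val := by
  simp only [k4Path, SimpleGraph.fromRel_adj, ne_eq, Sum.inl.injEq, Fin.ext_iff]
  omega

lemma k4Path_adj_inl_inr {i : ℕ} {a : Fin i} {b : Fin 2} :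
    (k4Path i).Adj (.inl a) (.inr b) ↔ a.val = 0 ∨ a.val + 1 = i := by
  simp [k4Path, SimpleGraph.fromRel_adj]

lemma k4Path_adj_inr_inl {i : ℕ} {a : Fin i} {b : Fin 2} :
    (k4Path i).Adj (.inr b) (.inl a) ↔ a.val = 0 ∨ a.val + 1 = i := by
  rw [SimpleGraph.adj_comm, k4Path_adj_inl_inr]

lemma k4Path_adj_inr {i : ℕ} {a b : Fin 2} :
    (k4Path i).Adj (.inr a) (.inr b) ↔ a ≠ b := by
  simp [k4Path, SimpleGraph.fromRel_adj]

/-- A connected graph that consists of a diamond and of a thread joining its ends. -/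
lemma inE_of_diamond (hconn : G.Connected) (hG : InC G) {a b u v : V} (ha : deg G a = 3)
    (hb : deg G b = 3) (hab : G.Adj a b) (hau : G.Adj a u) (hav : G.Adj a v) (hbu : G.Adj b u)
    (hbv : G.Adj b v) (huv : (core G).Adj u v) : InE G := by
  obtain ⟨hne, hu, hv, x, k, hx, rfl, rfl⟩ := huv
  have hk : 0 < k := Nat.pos_of_ne_zero (by rintro rfl; exact hne rfl)
  have hk3 := hx.mod_three_ne_zero hG.2.2 hu hv hne
  have hinj := hx.ne_of_lt (by omega) (by omega) hne
  have hxa : ∀ m ≤ k, x m ≠ a ∧ x m ≠ b := by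
    intro m hm
    by_cases h0 : m = 0
    · subst h0; exact ⟨hau.ne.symm, hbu.ne.symm⟩
    · by_cases h1 : m = k
      · subst h1; exact ⟨hav.ne.symm, hbv.ne.symm⟩
      · obtain ⟨m, rfl⟩ : ∃ m', m = m' + 1 := ⟨m - 1, by omega⟩
        have := (hx.2 m (by omega)).1
        constructor <;> rintro h <;> rw [h] at this <;> omega
  have hna := fun w hw => eq_of_deg_le_three (w := w) ha.le hab hau hav hbu.ne hbv.ne hne hw
  have hnb := fun w hw => eq_of_deg_le_three (w := w) hb.le hab.symm hbu hbv hau.ne hav.ne hne hw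
  have hnu := fun w hw => eq_of_deg_le_three (w := w) hu.le hau.symm hbu.symm (hx.1 0 hk) hab.ne
    (hxa _ (by omega)).1.symm (hxa _ (by omega)).2.symm hw
  have hlast := (hx.1 (k - 1) (by omega)).symm
  rw [show k - 1 + 1 = k by omega] at hlast
  have hnv := fun w hw => eq_of_deg_le_three (w := w) hv.le hav.symm hbv.symm hlast hab.ne
    (hxa _ (by omega)).1.symm (hxa _ (by omega)).2.symm hw
  -- The path has `k + 1` vertices. As 3 does not divide `k`, this number is `3 j` or `3 j - 1` for
  -- `j = ⌈(k + 1) / 3⌉ = (k + 3) / 3`, which equals `(k + 2) / 3`.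
  refine ⟨k + 1, (k + 2) / 3, by omega, by omega, ?_⟩
  refine nonempty_iso_of_closed hconn (Sum.elim (fun m => x m) ![a, b]) ?_ ?_ ?_
  · rintro (m | s) (m' | s') h
    · simp only [Sum.elim_inl] at h
      have := m.2
      have := m'.2
      rcases lt_trichotomy m.val m'.val with h' | h' | h'
      · exact absurd h (hinj _ _ h' (by omega))
      · rw [Fin.ext h']
      · exact absurd h.symm (hinj _ _ h' (by omega))
    · have := hxa m (by omega)
      fin_cases s' <;> simp_all
    · have := hxa m' (by omega)
      fin_cases s <;> simp_all
    · have := hab.ne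
      have := hab.ne.symm
      fin_cases s <;> fin_cases s' <;> simp_all
  · have mixed : ∀ (m : Fin (k + 1)) (s : Fin 2), (k4Path (k + 1)).Adj (.inl m) (.inr s) →
        G.Adj (x m) (![a, b] s) := by
      intro m s h
      rw [k4Path_adj_inl_inr] at h
      rcases h with h | h
      · rw [h]
        fin_cases s
        exacts [hau.symm, hbu.symm]
      · rw [show m.val = k by omega]
        fin_cases s
        exacts [hav.symm, hbv.symm]
    rintro (m | s) (m' | s') h
    · rw [k4Path_adj_inl] at h
      have := m.2
      have := m'.2
      rcases h with h | h
      · simpa [← h] using hx.1 m (by omega)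
      · simpa [← h] using (hx.1 m' (by omega)).symm
    · exact mixed m s' h
    · exact (mixed m' s h.symm).symm
    · rw [k4Path_adj_inr] at h
      have := hab.symm
      fin_cases s <;> fin_cases s' <;> simp_all
  · rintro (m | s) w h
    · have hm := m.2
      simp only [Sum.elim_inl] at h
      by_cases h0 : m.val = 0
      · rw [h0] at h
        rcases hnu w h with rfl | rfl | rfl
        · exact ⟨.inr 0, by simp [k4Path_adj_inl_inr, h0], rfl⟩
        · exact ⟨.inr 1, by simp [k4Path_adj_inl_inr, h0], rfl⟩
        · exact ⟨.inl ⟨1, by omega⟩, by simp [k4Path_adj_inl, h0], rfl⟩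
      · by_cases h1 : m.val = k
        · rw [h1] at h
          rcases hnv w h with rfl | rfl | rfl
          · exact ⟨.inr 0, by simp [k4Path_adj_inl_inr, h1], rfl⟩
          · exact ⟨.inr 1, by simp [k4Path_adj_inl_inr, h1], rfl⟩
          · exact ⟨.inl ⟨k - 1, by omega⟩, by simp [k4Path_adj_inl, h1]; omega, rfl⟩
        · obtain ⟨l, hl⟩ : ∃ l, m.val = l + 1 := ⟨m.val - 1, by omega⟩
          rw [hl] at h
          rcases hx.eq_or_eq (by omega) h with rfl | rfl
          · exact ⟨.inl ⟨l, by omega⟩, by simp [k4Path_adj_inl, hl], rfl⟩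
          · exact ⟨.inl ⟨l + 2, by omega⟩, by simp [k4Path_adj_inl, hl], rfl⟩
    · have h0 : ∀ s, (k4Path (k + 1)).Adj (.inr s) (.inl ⟨0, by omega⟩) := fun s => by
        simp [k4Path_adj_inr_inl]
      have h1 : ∀ s, (k4Path (k + 1)).Adj (.inr s) (.inl ⟨k, by omega⟩) := fun s => by
        simp [k4Path_adj_inr_inl]
      fin_cases s
      · rcases hna w h with rfl | rfl | rfl
        exacts [⟨.inr 1, by simp [k4Path_adj_inr], rfl⟩, ⟨_, h0 _, rfl⟩, ⟨_, h1 _, rfl⟩]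
      · rcases hnb w h with rfl | rfl | rfl
        exacts [⟨.inr 0, by simp [k4Path_adj_inr], rfl⟩, ⟨_, h0 _, rfl⟩, ⟨_, h1 _, rfl⟩]

/-- At each vertex of a `K₄` in the core, two of the other three vertices form with it a triangle of
`G`. Take such a triangle: the one at the fourth vertex shares an edge with it, so the four vertices
span a diamond, and the core edge between the ends of the diamond is the thread needed by
`inE_of_diamond`. -/
lemma reduced_core (hconn : G.Connected) (hG : InC G) (hE : ¬ InE G) : Reduced (core G) := by
  refine ⟨deg_core_le hG.1, clawFree_core hG.1 hG.2.1, ?_⟩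
  intro a b c d hab hac had hbc hbd hcd
  apply hE
  have tri : ∀ {s p q r : V}, (core G).Adj s p → (core G).Adj s q → (core G).Adj s r →
      p ≠ q → p ≠ r → q ≠ r → (G.Adj s p ∧ G.Adj s q ∧ G.Adj p q) ∨
        (G.Adj s p ∧ G.Adj s r ∧ G.Adj p r) ∨ (G.Adj s q ∧ G.Adj s r ∧ G.Adj q r) := by
    intro s p q r hp hq hr hpq hpr hqr
    have hall := fun w hw =>
      eq_of_deg_le_three (w := w) (deg_core_le hG.1 s) hp hq hr hpq hpr hqr hw
    have hd : deg (core G) s = 3 := by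
      refine le_antisymm (deg_core_le hG.1 s) ?_
      have : ({p, q, r} : Set V).ncard ≤ deg (core G) s :=
        Set.ncard_le_ncard (by rintro w (rfl | rfl | rfl) <;> assumption) (Set.toFinite _)
      rwa [Set.ncard_eq_three.2 ⟨p, q, r, hpq, hpr, hqr, rfl⟩] at this
    obtain ⟨y, z, -, hyz, -, -, hy, hz, hadj, -, -⟩ := exists_triangle_of_deg_three hG.2.1 hp.2.1
    have hy3 := deg_eq_three_of_triangle hG.1 hd hy hz hadj
    have hz3 := deg_eq_three_of_triangle hG.1 hd hz hy hadj.symm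
    have h2 := hadj.symm
    have h3 := hall y (core_adj_of_adj hy hp.2.1 hy3)
    have h4 := hall z (core_adj_of_adj hz hp.2.1 hz3)
    grind
  have main : ∀ {s p q r : V}, (core G).Adj s p → (core G).Adj s q → (core G).Adj s r →
      (core G).Adj p q → (core G).Adj p r → (core G).Adj q r →
      G.Adj s p → G.Adj s q → G.Adj p q → InE G := by
    intro s p q r hsp hsq hsr hpq hpr hqr h1 h2 h3
    rcases tri hsr.symm hpr.symm hqr.symm hsp.ne hsq.ne hpq.ne with h | h | h
    · exact inE_of_diamond hconn hG hsp.2.1 hsp.2.2.1 h1 h2 h.1.symm h3 h.2.1.symm hqr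
    · exact inE_of_diamond hconn hG hsq.2.1 hsq.2.2.1 h2 h1 h.1.symm h3.symm h.2.1.symm hpr
    · exact inE_of_diamond hconn hG hpq.2.1 hpq.2.2.1 h3 h1.symm h.1.symm h2.symm h.2.1.symm hsr
  rcases tri hab hac had hbc.ne hbd.ne hcd.ne with h | h | h
  · exact main hab hac had hbc hbd hcd h.1 h.2.1 h.2.2
  · exact main hab had hac hbd hbc hcd.symm h.1 h.2.1 h.2.2
  · exact main hac had hab hcd hbc.symm hbd.symm h.1 h.2.1 h.2.2

end Core

/-! ### Dynamic colorings -/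

section Dynamic

variable {V : Type*} [Finite V] {G : SimpleGraph V}

/-- Surjectivity can be achieved by leaving out unused colors. -/
lemma dynThreeColorable_of_coloring [Nonempty V] (c : V → Fin 3)
    (hc : ∀ u v, G.Adj u v → c u ≠ c v)
    (hdyn : ∀ v, 2 ≤ deg G v → ∃ a b, G.Adj v a ∧ G.Adj v b ∧ c a ≠ c b) :
    DynThreeColorable G := by
  classical
  let e := Fintype.equivFin (Set.range c)
  have hcard : Fintype.card (Set.range c) ≤ 3 :=
    (Fintype.card_subtype_le (fun x => x ∈ Set.range c)).trans (Fintype.card_fin 3).le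
  have hpos : 0 < Fintype.card (Set.range c) := Fintype.card_pos_iff.2 (Set.range_nonempty c).to_subtype
  let c' : V → Fin (Fintype.card (Set.range c)) := fun v => e ⟨c v, v, rfl⟩
  have hne : ∀ u v, c u ≠ c v → c' u ≠ c' v := fun u v h h' =>
    h (congrArg Subtype.val (e.injective h'))
  refine ⟨_, hpos, hcard, c', ?_, fun u v h => hne u v (hc u v h), fun v => ?_⟩
  · intro k
    obtain ⟨⟨_, v, rfl⟩, rfl⟩ := e.surjective k
    exact ⟨v, rfl⟩
  · by_cases hd : 2 ≤ deg G v
    · obtain ⟨a, b, ha, hb, hab⟩ := hdyn v hd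
      refine (min_le_right _ _).trans ?_
      rw [← Set.ncard_pair (hne a b hab)]
      refine Set.ncard_le_ncard ?_ (Set.toFinite _)
      rintro x (rfl | rfl)
      exacts [⟨a, ha, rfl⟩, ⟨b, hb, rfl⟩]
    · refine (min_le_left _ _).trans ?_
      rcases Nat.eq_zero_or_pos (deg G v) with h | h
      · omega
      · obtain ⟨w, hw⟩ := deg_pos_iff.1 h
        have : 0 < (c' '' G.neighborSet v).ncard :=
          (Set.ncard_pos (Set.toFinite _)).2 ⟨c' w, w, hw, rfl⟩
        omega

/-- The neighbours of a vertex of degree other than 3 that lies on a thread. -/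
lemma IsThread.exists_nbr {x : ℕ → V} {k m : ℕ} (hmax : ∀ v, deg G v ≤ 3) (hx : IsThread G x k)
    (hk : 0 < k) (h0 : deg G (x 0) ≠ 2) (hk' : deg G (x k) ≠ 2) (hm : m ≤ k)
    (h3 : deg G (x m) ≠ 3) {w : V} (hw : G.Adj (x m) w) :
    ∃ l, l ≤ k ∧ x l = w ∧ (l = m + 1 ∨ m = l + 1) := by
  have h := hmax (x m)
  by_cases hm0 : m = 0
  · subst hm0
    exact ⟨1, hk, (eq_of_deg_le_one (by omega) (hx.1 0 hk) hw).symm, Or.inl rfl⟩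
  obtain ⟨m, rfl⟩ : ∃ m', m = m' + 1 := ⟨m - 1, by omega⟩
  by_cases hmk : m + 1 = k
  · subst hmk
    exact ⟨m, by omega, (eq_of_deg_le_one (by omega) (hx.1 m (by omega)).symm hw).symm, Or.inr rfl⟩
  · rcases hx.eq_or_eq (by omega) hw with h | h
    · exact ⟨m, by omega, h.symm, Or.inr rfl⟩
    · exact ⟨m + 2, by omega, h.symm, Or.inl rfl⟩

/-- In the field ℤ/3 the slope is `(q - p) / r`, nonzero because `p ≠ q`. -/
lemma exists_slope_zmod : ∀ p q r : ZMod 3, p ≠ q → r ≠ 0 → ∃ d : ZMod 3, d ≠ 0 ∧ q = p + d * r := by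
  decide

/-- A coloring of the ends of a thread extends to an arithmetic progression along it. -/
lemma IsThread.exists_slope {x : ℕ → V} {k : ℕ} (hG : InC G) (hx : IsThread G x k) {c : V → ZMod 3}
    (hc : ∀ u v, (core G).Adj u v → c u ≠ c v) :
    ∃ a d : ZMod 3, d ≠ 0 ∧ (deg G (x 0) = 3 → c (x 0) = a) ∧
      (deg G (x k) = 3 → c (x k) = a + d * (k : ZMod 3)) := by
  by_cases h0 : deg G (x 0) = 3
  swap
  · exact ⟨c (x k) - (k : ZMod 3), 1, by decide, fun h => absurd h h0, fun _ => by simp⟩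
  by_cases hk : deg G (x k) = 3
  swap
  · exact ⟨c (x 0), 1, by decide, fun _ => rfl, fun h => absurd h hk⟩
  by_cases hne : x 0 = x k
  -- The length of a closed thread is 0 or 3, so a progression of any slope returns to its first
  -- value.
  · refine ⟨c (x 0), 1, by decide, fun _ => rfl, fun _ => ?_⟩
    have : (k : ZMod 3) = 0 := by
      rcases Nat.eq_zero_or_pos k with rfl | hpos
      · rfl
      · rw [hx.length_eq_three hG.2.1 hpos hne h0]; rfl
    rw [this, ← hne]
    simp
  · have h1 := hx.mod_three_ne_zero hG.2.2 h0 hk hne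
    have h2 : (k : ZMod 3) ≠ 0 := fun h =>
      h1 (Nat.mod_eq_zero_of_dvd ((ZMod.natCast_eq_zero_iff k 3).1 h))
    obtain ⟨d, hd, he⟩ := exists_slope_zmod (c (x 0)) (c (x k)) k
      (hc _ _ ⟨hne, h0, hk, x, k, hx, rfl, rfl⟩) h2
    exact ⟨c (x 0), d, hd, fun _ => rfl, fun _ => he⟩

lemma natCast_zmod_three_eq {i j : ℕ} (h : i % 3 = j % 3) : (i : ZMod 3) = (j : ZMod 3) :=
  (ZMod.natCast_eq_natCast_iff' i j 3).2 h

/-- Colorings of the core extend to the vertices on threads. -/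
lemma exists_coloring_of_core (hconn : G.Connected) (hG : InC G) {v₀ : V} (h₀ : deg G v₀ ≠ 2)
    {c : V → ZMod 3} (hc : ∀ u v, (core G).Adj u v → c u ≠ c v) :
    ∃ f : V → ZMod 3, (∀ u v, G.Adj u v → f u ≠ f v) ∧
      ∀ v, deg G v = 2 → ∀ a b, G.Adj v a → G.Adj v b → a ≠ b → f a ≠ f b := by
  classical
  -- Length 0 is kept only at isolated vertices: elsewhere the thread has to cover the neighbours of
  -- its vertices of degree other than 3.
  have hthread : ∀ y : V, ∃ x k m, IsThread G x k ∧ deg G (x 0) ≠ 2 ∧ deg G (x k) ≠ 2 ∧ m ≤ k ∧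
      x m = y ∧ (0 < k ∨ ∀ w, ¬ G.Adj y w) := by
    intro y
    obtain ⟨x, k, m, hx, hx0, hxk, hm, rfl⟩ := exists_thread_through hconn h₀ y
    rcases Nat.eq_zero_or_pos k with rfl | hk
    · obtain rfl : m = 0 := by omega
      by_cases hw : ∃ w, G.Adj (x 0) w
      · obtain ⟨w, hw⟩ := hw
        obtain ⟨l, hl, ht, he⟩ := exists_track_end hw hx0
        exact ⟨_, l, 0, ht, hx0, he, by omega, rfl, Or.inl hl⟩
      · exact ⟨x, 0, 0, hx, hx0, hxk, le_rfl, rfl, Or.inr (not_exists.1 hw)⟩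
    · exact ⟨x, k, m, hx, hx0, hxk, hm, rfl, Or.inl hk⟩
  choose X K M hX hX0 hXK hM hXM hK using hthread
  choose A D hD hA0 hAK using fun y => (hX y).exists_slope hG hc
  -- Threads chosen separately for neighbouring vertices could carry different progressions.
  -- Therefore one thread is fixed for each component left after isolating the vertices of degree 3;
  -- it runs through the whole component (`hmem`).
  let L := isolate G {v | deg G v = 3}
  let rep : V → V := fun y => (L.connectedComponentMk y).out
  have hrep : ∀ y, L.Reachable (rep y) y := fun y =>
    SimpleGraph.ConnectedComponent.exact (Quot.out_eq (L.connectedComponentMk y))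
  have hrep_eq : ∀ y z, L.Adj y z → rep y = rep z := fun y z h => by
    simp only [rep]
    rw [SimpleGraph.ConnectedComponent.sound h.reachable]
  have hmem : ∀ y, ∃ m, m ≤ K (rep y) ∧ X (rep y) m = y := by
    intro y
    obtain ⟨p⟩ := hrep y
    have key : ∀ (r a b : V) (p : L.Walk a b), (∃ m, m ≤ K r ∧ X r m = a) →
        ∃ m, m ≤ K r ∧ X r m = b := by
      intro r a b p
      induction p with
      | nil => exact id
      | cons h p ih =>
        rintro ⟨m, hm, rfl⟩
        apply ih
        rcases Nat.eq_zero_or_pos (K r) with h' | h'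
        · rcases hK r with h'' | h''
          · omega
          · have e1 := hXM r
            have e2 := hM r
            rw [show M r = m by omega] at e1
            rw [e1] at h
            exact absurd h.1 (h'' _)
        · obtain ⟨l, hl, he, -⟩ := (hX r).exists_nbr hG.1 h' (hX0 r) (hXK r) hm h.2.1 h.1
          exact ⟨l, hl, he⟩
    exact key _ _ _ p ⟨M _, hM _, hXM _⟩
  have hstep : ∀ (a b : V) (_ : L.Walk a b), a = b ∨ ∃ z, L.Adj a z := fun a b p => by
    cases p with
    | nil => exact Or.inl rfl
    | cons h _ => exact Or.inr ⟨_, h⟩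
  choose I hI hXI using hmem
  let f : V → ZMod 3 := fun y => if deg G y = 3 then c y else A (rep y) + D (rep y) * (I y : ZMod 3)
  have hflow : ∀ y, deg G y ≠ 3 → ∀ m, m ≤ K (rep y) → X (rep y) m = y →
      f y = A (rep y) + D (rep y) * (m : ZMod 3) := by
    intro y hy m hm hXm
    simp only [f, if_neg hy]
    rw [natCast_zmod_three_eq ((hX (rep y)).mod_three_eq hG.1 hG.2.1 (hX0 _) (hXK _) (hI y) hm
      ((hXI y).trans hXm.symm))]
  -- On a thread, degree 3 occurs only at the ends, where the progression was fitted to `c`.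
  have hfend : ∀ r m, m ≤ K r → deg G (X r m) = 3 → f (X r m) = A r + D r * (m : ZMod 3) := by
    intro r m hm h3
    simp only [f, if_pos h3]
    by_cases hm0 : m = 0
    · subst hm0
      rw [hA0 r h3]
      simp
    · by_cases hmk : m = K r
      · subst hmk
        exact hAK r h3
      · obtain ⟨m, rfl⟩ : ∃ m', m = m' + 1 := ⟨m - 1, by omega⟩
        have := ((hX r).2 m (by omega)).1
        omega
  have hnbr : ∀ y, deg G y ≠ 3 → ∀ w, G.Adj y w → ∃ m l, X (rep y) l = w ∧ m = I y ∧
      (l = m + 1 ∨ m = l + 1) ∧ f y = A (rep y) + D (rep y) * (m : ZMod 3) ∧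
      f w = A (rep y) + D (rep y) * (l : ZMod 3) := by
    intro y hy w hw
    have hKpos : 0 < K (rep y) := by
      refine (hK (rep y)).resolve_right fun h => ?_
      obtain ⟨p⟩ := hrep y
      rcases hstep _ _ p with h' | ⟨z, h'⟩
      · exact h w (by rwa [h'])
      · exact h z h'.1
    obtain ⟨l, hl, he, hlm⟩ := (hX (rep y)).exists_nbr hG.1 hKpos (hX0 _) (hXK _) (hI y)
      (by rwa [hXI]) (w := w) (by rwa [hXI])
    refine ⟨I y, l, he, rfl, hlm, hflow y hy _ (hI y) (hXI y), ?_⟩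
    by_cases hw3 : deg G w = 3
    · rw [← he]
      exact hfend _ _ hl (by rwa [he])
    · have := hrep_eq y w ⟨hw, hy, hw3⟩
      rw [this] at hl he ⊢
      exact hflow w hw3 l hl he
  -- Terms at distance 1 differ, which gives properness; terms at distance 2 differ, which separates
  -- the two neighbours of a vertex of degree 2.
  have fin1 : ∀ a d m : ZMod 3, d ≠ 0 → a + d * m ≠ a + d * (m + 1) := by decide
  have fin2 : ∀ a d m : ZMod 3, d ≠ 0 → a + d * m ≠ a + d * (m + 2) := by decide
  have hlow : ∀ y, deg G y ≠ 3 → ∀ w, G.Adj y w → f y ≠ f w := by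
    intro y hy w hw
    obtain ⟨m, l, -, -, h | h, e1, e2⟩ := hnbr y hy w hw
    · rw [e1, e2, h]
      push_cast
      exact fin1 _ _ _ (hD _)
    · rw [e1, e2, h]
      push_cast
      exact (fin1 _ _ _ (hD _)).symm
  refine ⟨f, fun u v huv => ?_, fun v hv a b ha hb hab => ?_⟩
  · by_cases hu : deg G u = 3
    · by_cases hv : deg G v = 3
      · simp only [f, if_pos hu, if_pos hv]
        exact hc u v (core_adj_of_adj huv hu hv)
      · exact (hlow v hv u huv.symm).symm
    · exact hlow u hu v huv
  · obtain ⟨m, l, h1, h2, h3, e1, e2⟩ := hnbr v (by omega) a ha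
    obtain ⟨m', l', h1', h2', h3', e1', e2'⟩ := hnbr v (by omega) b hb
    have hmm : m' = m := h2'.trans h2.symm
    subst hmm
    have hll : l ≠ l' := by
      rintro rfl
      exact hab (h1.symm.trans h1')
    rw [e2, e2']
    rcases h3 with h | h <;> rcases h3' with h' | h'
    · omega
    · rw [show l = l' + 2 by omega]
      push_cast
      exact (fin2 _ _ _ (hD _)).symm
    · rw [show l' = l + 2 by omega]
      push_cast
      exact fin2 _ _ _ (hD _)
    · omega

theorem dynThreeColorable_of_not_inE (hconn : G.Connected) (hG : InC G)
    (h2 : ¬ ∀ v, deg G v = 2) (hE : ¬ InE G) : DynThreeColorable G := by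
  push Not at h2
  obtain ⟨v₀, h₀⟩ := h2
  obtain ⟨c, hc⟩ := exists_coloring_of_reduced _ (reduced_core hconn hG hE)
  obtain ⟨f, hf, hf2⟩ := exists_coloring_of_core hconn hG h₀ hc
  have := hconn.nonempty
  refine dynThreeColorable_of_coloring f hf fun v hv => ?_
  by_cases hd : deg G v = 2
  · obtain ⟨a, ha⟩ := deg_pos_iff.1 (show 0 < deg G v by omega)
    obtain ⟨b, hba, hb⟩ := exists_ne_of_deg_two hd a
    exact ⟨b, a, hb, ha, hf2 v hd b a hb ha hba⟩
  · have h3 := hG.1 v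
    obtain ⟨a, b, -, -, -, -, ha, hb, hab, -, -⟩ :=
      exists_triangle_of_deg_three hG.2.1 (show deg G v = 3 by omega)
    exact ⟨a, b, ha, hb, hf a b hab⟩

end Dynamic

/-! ### The exceptional graphs -/

section Exceptional

variable {V : Type*} {G : SimpleGraph V}

lemma DynThreeColorable.exists_coloring [Finite V] (h : DynThreeColorable G) :
    ∃ c : V → Fin 3, (∀ u v, G.Adj u v → c u ≠ c v) ∧
      ∀ v, 2 ≤ deg G v → ∃ a b, G.Adj v a ∧ G.Adj v b ∧ c a ≠ c b := by
  obtain ⟨k, -, hk, c, -, hc, hd⟩ := h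
  refine ⟨fun v => Fin.castLE hk (c v), fun u v huv h => hc u v huv (Fin.castLE_injective hk h),
    fun v hv => ?_⟩
  have h2 := hd v
  rw [min_eq_right hv] at h2
  obtain ⟨_, ⟨a, ha, rfl⟩, _, ⟨b, hb, rfl⟩, hab⟩ := (Set.one_lt_ncard (Set.toFinite _)).1 h2
  exact ⟨a, b, ha, hb, fun h => hab (Fin.castLE_injective hk h)⟩

lemma deg_iso {W : Type*} {K : SimpleGraph W} (e : G ≃g K) (v : V) : deg G v = deg K (e v) := by
  have : K.neighborSet (e v) = e '' G.neighborSet v := by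
    ext w
    constructor
    · intro hw
      refine ⟨e.symm w, ?_, e.apply_symm_apply w⟩
      rw [SimpleGraph.mem_neighborSet, ← e.map_adj_iff, e.apply_symm_apply]
      exact hw
    · rintro ⟨u, hu, rfl⟩
      exact e.map_adj_iff.2 hu
  rw [deg, deg, this, Set.ncard_image_of_injective _ e.injective]

lemma deg_eq_three_of_nbrs {v a b c : V} (hab : a ≠ b) (hac : a ≠ c) (hbc : b ≠ c)
    (h : ∀ w, G.Adj v w ↔ w = a ∨ w = b ∨ w = c) : deg G v = 3 :=
  Set.ncard_eq_three.2 ⟨a, b, c, hab, hac, hbc, by ext w; simpa using h w⟩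

lemma deg_k4Path_inr {i : ℕ} (hi : 2 ≤ i) (s : Fin 2) : deg (k4Path i) (.inr s) = 3 := by
  refine deg_eq_three_of_nbrs (a := .inr (1 - s)) (b := .inl ⟨0, by omega⟩)
    (c := .inl ⟨i - 1, by omega⟩) (by simp) (by simp) (by simp; omega) ?_
  rintro (m | t)
  · have := m.2
    simp only [k4Path_adj_inr_inl, reduceCtorEq, Sum.inl.injEq, Fin.ext_iff, false_or]
    omega
  · simp only [k4Path_adj_inr, Sum.inr.injEq, reduceCtorEq, or_false]
    revert s t
    decide

lemma deg_k4Path_zero {i : ℕ} (hi : 2 ≤ i) : deg (k4Path i) (.inl ⟨0, by omega⟩) = 3 := by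
  refine deg_eq_three_of_nbrs (a := .inr 0) (b := .inr 1)
    (c := .inl ⟨1, by omega⟩) (by simp) (by simp) (by simp) ?_
  rintro (m | t)
  · simp [k4Path_adj_inl, Fin.ext_iff, eq_comm]
  · simp only [k4Path_adj_inl_inr, Sum.inr.injEq, reduceCtorEq, or_false, true_or, true_iff]
    revert t
    decide

lemma deg_k4Path_last {i : ℕ} (hi : 2 ≤ i) : deg (k4Path i) (.inl ⟨i - 1, by omega⟩) = 3 := by
  refine deg_eq_three_of_nbrs (a := .inr 0) (b := .inr 1)
    (c := .inl ⟨i - 2, by omega⟩) (by simp) (by simp) (by simp) ?_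
  rintro (m | t)
  · have := m.2
    simp only [k4Path_adj_inl, reduceCtorEq, Sum.inl.injEq, Fin.ext_iff, false_or]
    omega
  · simp only [k4Path_adj_inl_inr, Sum.inr.injEq, reduceCtorEq, or_false]
    rw [iff_true_left (Or.inr (by omega))]
    revert t
    decide

lemma deg_k4Path_internal {i : ℕ} {m : Fin i} (h0 : m.val ≠ 0) (h1 : m.val + 1 ≠ i) :
    deg (k4Path i) (.inl m) = 2 := by
  have hm := m.2
  refine Set.ncard_eq_two.2 ⟨.inl ⟨m - 1, by omega⟩, .inl ⟨m + 1, by omega⟩, by simp, ?_⟩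
  ext (l | t)
  · simp only [SimpleGraph.mem_neighborSet, k4Path_adj_inl, Set.mem_insert_iff, Sum.inl.injEq,
      Fin.ext_iff, Set.mem_singleton_iff]
    omega
  · simp [k4Path_adj_inl_inr, h0, h1]

/-- The internal vertices of the path have degree 2, so the colors along it have period 3 and any
three consecutive ones differ. Both ends are adjacent to the same two adjacent vertices, which
forces equal colors on them, yet their distance `i - 1` along the path is not divisible by 3. -/
lemma not_dynThreeColorable_of_inE [Finite V] (hE : InE G) : ¬ DynThreeColorable G := by
  intro hdyn
  obtain ⟨i, j, hj, hij, ⟨e⟩⟩ := hE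
  have hi : 2 ≤ i := by omega
  obtain ⟨c, hc, hd⟩ := hdyn.exists_coloring
  let g : Fin i ⊕ Fin 2 → Fin 3 := fun s => c (e.symm s)
  have hg : ∀ s t, (k4Path i).Adj s t → g s ≠ g t := fun s t h =>
    hc _ _ (e.symm.map_adj_iff.2 h)
  let f : ℕ → Fin 3 := fun m => if h : m < i then g (.inl ⟨m, h⟩) else 0
  have hf : ∀ m (h : m < i), f m = g (.inl ⟨m, h⟩) := fun m h => dif_pos h
  have hf1 : ∀ m, m + 1 < i → f m ≠ f (m + 1) := fun m h => by
    rw [hf m (by omega), hf (m + 1) h]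
    exact hg _ _ (by simp [k4Path_adj_inl])
  have hf2 : ∀ m, m + 2 < i → f m ≠ f (m + 2) := fun m h => by
    rw [hf m (by omega), hf (m + 2) h]
    have h2 : deg G (e.symm (.inl ⟨m + 1, by omega⟩)) = 2 := by
      rw [deg_iso e, e.apply_symm_apply]
      exact deg_k4Path_internal (by simp) (by simp; omega)
    obtain ⟨a, b, ha, hb, hab⟩ := hd _ h2.ge
    have key : ∀ a, G.Adj (e.symm (.inl ⟨m + 1, by omega⟩)) a →
        c a = g (.inl ⟨m, by omega⟩) ∨ c a = g (.inl ⟨m + 2, h⟩) := by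
      intro a ha
      rw [← e.map_adj_iff, e.apply_symm_apply] at ha
      have hga : c a = g (e a) := by simp [g]
      rw [hga]
      rcases h' : e a with l | t
      · rw [h', k4Path_adj_inl] at ha
        simp only at ha
        rcases ha with ha | ha
        · exact Or.inr (by rw [show l = ⟨m + 2, h⟩ from Fin.ext (by simp only; omega)])
        · exact Or.inl (by rw [show l = ⟨m, by omega⟩ from Fin.ext (by simp only; omega)])
      · rw [h', k4Path_adj_inl_inr] at ha
        simp only at ha
        omega
    have h1 := key a ha
    have h2 := key b hb
    grind
  have fin3 : ∀ p q r s : Fin 3, p ≠ q → p ≠ r → q ≠ r → s ≠ q → s ≠ r → s = p := by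
    intros; omega
  have hper : ∀ m, m < i → f m = f (m % 3) := by
    intro m
    induction m using Nat.strong_induction_on with
    | _ m ih =>
      intro hm
      by_cases h3 : m < 3
      · rw [Nat.mod_eq_of_lt h3]
      · obtain ⟨l, rfl⟩ : ∃ l, m = l + 3 := ⟨m - 3, by omega⟩
        rw [fin3 (f l) (f (l + 1)) (f (l + 2)) (f (l + 3)) (hf1 _ (by omega)) (hf2 _ (by omega))
          (hf1 _ (by omega)) (hf2 _ (by omega)).symm (hf1 _ (by omega)).symm,
          ih l (by omega) (by omega), Nat.add_mod_right]
  have hends : f 0 = f (i - 1) := by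
    rw [hf 0 (by omega), hf (i - 1) (by omega)]
    exact fin3 _ (g (.inr 0)) (g (.inr 1)) _
      (hg _ _ (by rw [k4Path_adj_inl_inr]; simp; omega))
      (hg _ _ (by rw [k4Path_adj_inl_inr]; simp; omega))
      (hg _ _ (by simp [k4Path_adj_inr]))
      (hg _ _ (by simp [k4Path_adj_inl_inr])) (hg _ _ (by simp [k4Path_adj_inl_inr]))
  rw [hper (i - 1) (by omega)] at hends
  have : (i - 1) % 3 = 1 ∨ (i - 1) % 3 = 2 := by omega
  rcases this with h | h
  · rw [h] at hends
    exact hf1 0 (by omega) hends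
  · rw [h] at hends
    exact hf2 0 (by omega) hends

lemma InE.deg_ne_one (hE : InE G) (v : V) : deg G v ≠ 1 := by
  obtain ⟨i, j, hj, hij, ⟨e⟩⟩ := hE
  have hi : 2 ≤ i := by omega
  rw [deg_iso e]
  rcases e v with m | s
  · by_cases h0 : m.val = 0
    · rw [show m = ⟨0, by omega⟩ from Fin.ext h0, deg_k4Path_zero hi]; decide
    · by_cases h1 : m.val + 1 = i
      · rw [show m = ⟨i - 1, by omega⟩ from Fin.ext (by simp only; omega), deg_k4Path_last hi]
        decide
      · rw [deg_k4Path_internal h0 h1]; decide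
  · rw [deg_k4Path_inr hi]; decide

lemma InE.ncard_deg_three (hE : InE G) : {v | deg G v = 3}.ncard = 4 := by
  obtain ⟨i, j, hj, hij, ⟨e⟩⟩ := hE
  have hi : 2 ≤ i := by omega
  have h1 : {v | deg G v = 3} = e.symm '' {s | deg (k4Path i) s = 3} := by
    ext v
    constructor
    · intro hv
      exact ⟨e v, by rw [Set.mem_ofPred_eq, ← deg_iso e]; exact hv, e.symm_apply_apply v⟩
    · rintro ⟨s, hs, rfl⟩
      rw [Set.mem_ofPred_eq, deg_iso e, e.apply_symm_apply]
      exact hs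
  have h2 : {s | deg (k4Path i) s = 3} =
      insert (.inr 0) {.inr 1, .inl ⟨0, by omega⟩, .inl ⟨i - 1, by omega⟩} := by
    ext s
    constructor
    · intro hs
      rcases s with m | s
      · have hm := m.2
        by_contra h
        simp only [Set.mem_insert_iff, reduceCtorEq, Sum.inl.injEq, Fin.ext_iff,
          Set.mem_singleton_iff, false_or, not_or] at h
        rw [Set.mem_ofPred_eq, deg_k4Path_internal h.1 (by omega)] at hs
        omega
      · fin_cases s <;> simp
    · rintro (rfl | rfl | rfl | rfl)
      exacts [deg_k4Path_inr hi 0, deg_k4Path_inr hi 1, deg_k4Path_zero hi, deg_k4Path_last hi]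
  rw [h1, Set.ncard_image_of_injective _ e.symm.injective, h2,
    Set.ncard_insert_of_notMem (by simp) (Set.toFinite _),
    Set.ncard_eq_three.2 ⟨_, _, _, by simp, by simp, by simp; omega, rfl⟩]

/-- Graphs in `ℰ` have no leaf and exactly four vertices of degree 3, so the first two tests never
answer wrongly and the procedure says "no" precisely on `ℰ`. -/
theorem dynThreeColorable_iff_determinationAnswer [Finite V] (hconn : G.Connected) (hG : InC G)
    (h2 : ¬ ∀ v, deg G v = 2) : DynThreeColorable G ↔ DeterminationAnswer G := by
  constructor
  · exact fun h => Or.inr (Or.inr fun hE => not_dynThreeColorable_of_inE hE h)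
  · intro h
    apply dynThreeColorable_of_not_inE hconn hG h2
    intro hE
    rcases h with ⟨v, hv⟩ | h | h
    · exact hE.deg_ne_one v hv
    · exact h hE.ncard_deg_three
    · exact h hE

/-- A vertex of degree 3 all of whose neighbours have degree 3. -/
def IsFull (G : SimpleGraph V) (v : V) : Prop := deg G v = 3 ∧ ∀ w, G.Adj v w → deg G w = 3

/-- The two vertices off the path are full. For `i = 2` the graph is `K₄` and all four are, so only
a lower bound holds. -/
lemma InE.two_le_ncard_isFull [Finite V] (hE : InE G) : 2 ≤ {v | IsFull G v}.ncard := by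
  obtain ⟨i, j, hj, hij, ⟨e⟩⟩ := hE
  have hi : 2 ≤ i := by omega
  have hfull : ∀ s : Fin 2, IsFull G (e.symm (.inr s)) := by
    intro s
    refine ⟨by rw [deg_iso e, e.apply_symm_apply, deg_k4Path_inr hi], fun w hw => ?_⟩
    rw [← e.map_adj_iff, e.apply_symm_apply] at hw
    rw [deg_iso e]
    rcases h : e w with m | t
    · rw [h, k4Path_adj_inr_inl] at hw
      rcases hw with hw | hw
      · rw [show m = ⟨0, by omega⟩ from Fin.ext hw, deg_k4Path_zero hi]
      · rw [show m = ⟨i - 1, by omega⟩ from Fin.ext (by simp only; omega), deg_k4Path_last hi]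
    · exact deg_k4Path_inr hi t
  rw [← Set.ncard_pair (show e.symm (.inr 0) ≠ e.symm (.inr 1) from
    fun h => by simpa using e.symm.injective h)]
  refine Set.ncard_le_ncard ?_ (Set.toFinite _)
  rintro v (rfl | rfl)
  exacts [hfull 0, hfull 1]

/-- With only four vertices of degree 3, a full vertex is adjacent to the other three. Two full
vertices `a`, `b` thus form a diamond with the remaining `u`, `v`, and the thread along the third
edge at `u` has nowhere to end but at `v`. -/
lemma inE_of_two_le_ncard_isFull [Finite V] (hconn : G.Connected) (hG : InC G)
    (hleaf : ∀ v, deg G v ≠ 1) (h4 : {v | deg G v = 3}.ncard = 4)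
    (hfull : 2 ≤ {v | IsFull G v}.ncard) : InE G := by
  obtain ⟨a, ha, b, hb, hab⟩ := (Set.one_lt_ncard (Set.toFinite _)).1 hfull
  have hnb : ∀ {s}, IsFull G s → ∀ w, w ≠ s → deg G w = 3 → G.Adj s w := by
    intro s hs w hws hw
    have hsub : G.neighborSet s ⊆ {v | deg G v = 3} \ {s} := fun w hw =>
      ⟨hs.2 w hw, fun h => G.ne_of_adj hw h.symm⟩
    have hcard : ({v | deg G v = 3} \ {s}).ncard = 3 := by
      rw [Set.ncard_sdiff_singleton_of_mem (show s ∈ {v | deg G v = 3} from hs.1), h4]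
    have heq := Set.eq_of_subset_of_ncard_le hsub (hcard.le.trans hs.1.ge)
    have : w ∈ G.neighborSet s := by rw [heq]; exact ⟨hw, hws⟩
    exact this
  obtain ⟨u, v, huv, hD⟩ : ∃ u v, u ≠ v ∧ ({v | deg G v = 3} \ {a}) \ {b} = {u, v} := by
    rw [← Set.ncard_eq_two, Set.ncard_sdiff_singleton_of_mem
      (show b ∈ {v | deg G v = 3} \ {a} from ⟨hb.1, hab.symm⟩),
      Set.ncard_sdiff_singleton_of_mem (show a ∈ {v | deg G v = 3} from ha.1), h4]
  have hmem : ∀ w, deg G w = 3 ↔ w = a ∨ w = b ∨ w = u ∨ w = v := by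
    intro w
    constructor
    · intro hw
      by_contra! h
      have : w ∈ ({v | deg G v = 3} \ {a}) \ {b} := ⟨⟨hw, h.1⟩, h.2.1⟩
      rw [hD] at this
      rcases this with h' | h'
      exacts [h.2.2.1 h', h.2.2.2 h']
    · have hu : u ∈ ({v | deg G v = 3} \ {a}) \ {b} := by rw [hD]; simp
      have hv : v ∈ ({v | deg G v = 3} \ {a}) \ {b} := by rw [hD]; simp
      rintro (rfl | rfl | rfl | rfl)
      exacts [ha.1, hb.1, hu.1.1, hv.1.1]
  have hua : u ≠ a ∧ u ≠ b := by
    have hu : u ∈ ({v | deg G v = 3} \ {a}) \ {b} := by rw [hD]; simp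
    exact ⟨hu.1.2, hu.2⟩
  have hva : v ≠ a ∧ v ≠ b := by
    have hv : v ∈ ({v | deg G v = 3} \ {a}) \ {b} := by rw [hD]; simp
    exact ⟨hv.1.2, hv.2⟩
  have hu3 : deg G u = 3 := (hmem u).2 (by simp)
  have hv3 : deg G v = 3 := (hmem v).2 (by simp)
  have hau := hnb ha u hua.1 hu3
  have hav := hnb ha v hva.1 hv3
  have hbu := hnb hb u hua.2 hu3
  have hbv := hnb hb v hva.2 hv3
  refine inE_of_diamond hconn hG ha.1 hb.1 (hnb ha b hab.symm hb.1) hau hav hbu hbv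
    ⟨huv, hu3, hv3, ?_⟩
  obtain ⟨c, hca, hcb, huc, hall⟩ := exists_third_of_deg_three hu3 hau.symm hbu.symm hab
  obtain ⟨k, hk, ht, hend⟩ := exists_track_end huc (by omega)
  have h0 : track G u c 0 = u := track_zero u c
  have h1 : track G u c 1 = c := track_one u c
  have hlast := (ht.1 (k - 1) (by omega)).symm
  rw [show k - 1 + 1 = k by omega] at hlast
  refine ⟨_, k, ht, h0, ?_⟩
  have hk3 : deg G (track G u c k) = 3 := by
    have := hG.1 (track G u c k)
    have := hleaf (track G u c k)
    have := deg_pos_iff.2 ⟨_, hlast⟩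
    omega
  -- The last vertex before a full end has degree 3, so it is not internal and the thread is a
  -- single edge, which would make `c` that end.
  have hnot : ∀ s, IsFull G s → c ≠ s → track G u c k ≠ s := by
    intro s hs hcs h
    rw [h] at hlast
    have h3 := hs.2 _ hlast
    by_cases h' : k = 1
    · subst h'; exact hcs (h1.symm.trans h)
    · have := (ht.2 (k - 2) (by omega)).1
      rw [show k - 2 + 1 = k - 1 by omega] at this
      omega
  rcases (hmem _).1 hk3 with h | h | h | h
  · exact absurd h (hnot a ha hca)
  · exact absurd h (hnot b hb hcb)
  -- A thread back to `u` would be a triangle, whose third vertex has degree 2 and is a neighbour of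
  -- `u` other than `c`; but `a` and `b` have degree 3.
  · obtain rfl := ht.length_eq_three hG.2.1 hk (h0.trans h.symm) (by rwa [h0])
    exfalso
    rw [h] at hlast
    have h2 := (ht.2 1 (by omega)).1
    simp only [Nat.reduceAdd, Nat.reduceSub] at h2 hlast
    rcases hall _ hlast with h' | h' | h'
    · rw [h', ha.1] at h2; omega
    · rw [h', hb.1] at h2; omega
    · exact (ht.1 1 (by omega)).ne (h1.trans h'.symm)
  · exact h

/-- Replaces the isomorphism test by numbers that are found by looking at each vertex and its
neighbours. -/
lemma determinationAnswer_iff [Finite V] (hconn : G.Connected) (hG : InC G) :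
    DeterminationAnswer G ↔ (∃ v, deg G v = 1) ∨ {v | deg G v = 3}.ncard ≠ 4 ∨
      {v | IsFull G v}.ncard < 2 := by
  rw [DeterminationAnswer]
  by_cases hleaf : ∃ v, deg G v = 1
  · simp [hleaf]
  by_cases h4 : {v | deg G v = 3}.ncard = 4
  · simp only [hleaf, h4, ne_eq, not_true, false_or, ← not_le]
    exact not_congr ⟨fun h => h.two_le_ncard_isFull,
      inE_of_two_le_ncard_isFull hconn hG (not_exists.1 hleaf) h4⟩
  · simp [h4]

end Exceptional

/-! ### Cycles -/

section Cycles

variable {V : Type*} [Finite V] {G : SimpleGraph V}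

/-- Double counting: each closed neighbourhood has three vertices of three different colors, hence
exactly one of color 0, and each vertex of color 0 lies in three closed neighbourhoods. -/
lemma three_dvd_card_of_dynThreeColorable (h2 : ∀ v, deg G v = 2) (h : DynThreeColorable G) :
    3 ∣ Nat.card V := by
  classical
  have := Fintype.ofFinite V
  obtain ⟨c, hc, hd⟩ := h.exists_coloring
  have nbrs : ∀ v, ∃ a b, a ≠ b ∧ c a ≠ c b ∧ c a ≠ c v ∧ c b ≠ c v ∧ a ≠ v ∧ b ≠ v ∧
      ∀ w, G.Adj v w ↔ w = a ∨ w = b := by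
    intro v
    obtain ⟨a, b, ha, hb, hab⟩ := hd v (h2 v).ge
    have hne : a ≠ b := fun h => hab (congrArg c h)
    refine ⟨a, b, hne, hab, hc _ _ ha.symm, hc _ _ hb.symm, ha.ne.symm, hb.ne.symm,
      fun w => ⟨eq_or_eq_of_deg_le_two (h2 v).le ha hb hne, ?_⟩⟩
    rintro (rfl | rfl) <;> assumption
  have key := Finset.card_mul_eq_card_mul (fun v w => v = w ∨ G.Adj v w)
    (s := (Finset.univ : Finset V)) (t := Finset.univ.filter fun w => c w = 0) (m := 1) (n := 3)
    ?_ ?_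
  · rw [Nat.card_eq_fintype_card, ← Finset.card_univ]
    exact ⟨_, by rw [← mul_one (Finset.card _), key, mul_comm]⟩
  · intro v _
    obtain ⟨a, b, hab, h1, h2, h3, -, -, hall⟩ := nbrs v
    have fin3 : ∀ p q r : Fin 3, p ≠ q → p ≠ r → q ≠ r → p = 0 ∨ q = 0 ∨ r = 0 := by decide
    rw [Finset.card_eq_one]
    rcases fin3 _ _ _ h1 h2 h3 with h | h | h
    · refine ⟨a, ?_⟩
      ext w
      simp only [Finset.bipartiteAbove, Finset.mem_filter, Finset.mem_univ, true_and, hall,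
        Finset.mem_singleton]
      grind
    · refine ⟨b, ?_⟩
      ext w
      simp only [Finset.bipartiteAbove, Finset.mem_filter, Finset.mem_univ, true_and, hall,
        Finset.mem_singleton]
      grind
    · refine ⟨v, ?_⟩
      ext w
      simp only [Finset.bipartiteAbove, Finset.mem_filter, Finset.mem_univ, true_and, hall,
        Finset.mem_singleton]
      grind
  · intro w _
    obtain ⟨a, b, hab, -, -, -, ha, hb, hall⟩ := nbrs w
    rw [Finset.card_eq_three]
    refine ⟨w, a, b, ha.symm, hb.symm, hab, ?_⟩
    ext v
    simp only [Finset.bipartiteBelow, Finset.mem_filter, Finset.mem_univ, true_and,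
      Finset.mem_insert, Finset.mem_singleton, G.adj_comm v w, hall]

/-- A track from any vertex, followed up to its first repetition, enumerates the whole cycle; the
color is the index modulo 3. -/
lemma dynThreeColorable_of_three_dvd_card (hconn : G.Connected) (h2 : ∀ v, deg G v = 2)
    (h3 : 3 ∣ Nat.card V) : DynThreeColorable G := by
  classical
  have := hconn.nonempty
  obtain ⟨v₀⟩ := hconn.nonempty
  obtain ⟨w₀, hw₀⟩ := deg_pos_iff.1 (show 0 < deg G v₀ by rw [h2]; omega)
  let x := track G v₀ w₀
  have hx : ∀ k, IsThread G x k := fun k => isThread_track hw₀ fun m _ => h2 _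
  have hadj : ∀ m, G.Adj (x m) (x (m + 1)) := fun m => (hx (m + 1)).1 m (by omega)
  have hne2 : ∀ m, x m ≠ x (m + 2) := fun m => ((hx (m + 2)).2 m (by omega)).2
  have hnb : ∀ m w, G.Adj (x (m + 1)) w → w = x m ∨ w = x (m + 2) := fun m w hw =>
    (hx (m + 2)).eq_or_eq (by omega) hw
  have hex : ∃ j, ∃ i < j, x i = x j := by
    obtain ⟨i, j, hij, he⟩ := Finite.exists_ne_map_eq_of_infinite x
    rcases lt_or_gt_of_ne hij with h | h
    exacts [⟨j, i, h, he⟩, ⟨i, j, h, he.symm⟩]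
  obtain ⟨N, ⟨i, hiN, hi⟩, hmin⟩ : ∃ N, (∃ i < N, x i = x N) ∧ ∀ j < N, ¬ ∃ i < j, x i = x j :=
    ⟨Nat.find hex, Nat.find_spec hex, fun j hj => Nat.find_min hex hj⟩
  have hinj : ∀ i j, i < N → j < N → x i = x j → i = j := by
    intro i j hi hj he
    rcases lt_trichotomy i j with h | h | h
    · exact absurd ⟨i, h, he⟩ (hmin j hj)
    · exact h
    · exact absurd ⟨j, h, he.symm⟩ (hmin i hi)
  -- The first repetition closes up at `x 0`: otherwise one step backwards gives an earlier
  -- repetition, a turn back or a loop.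
  obtain rfl : i = 0 := by
    by_contra h0
    obtain ⟨i, rfl⟩ : ∃ i', i = i' + 1 := ⟨i - 1, by omega⟩
    obtain ⟨N, rfl⟩ : ∃ N', N = N' + 1 := ⟨N - 1, by omega⟩
    rcases hnb i (x N) (by rw [hi]; exact (hadj N).symm) with h | h
    · have := hinj _ _ (by omega) (by omega) h
      omega
    · by_cases hlt : i + 2 < N + 1
      · have := hinj _ _ (by omega) hlt h
        subst this
        exact hne2 (i + 1) hi
      · have : N = i + 1 := by omega
        subst this
        exact (hadj (i + 1)).ne hi
  have hN1 : N ≠ 1 := by rintro rfl; exact (hadj 0).ne hi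
  have hN2 : N ≠ 2 := by rintro rfl; exact hne2 0 hi
  have hlast : G.Adj (x 0) (x (N - 1)) := by
    have := (hadj (N - 1)).symm
    rwa [show N - 1 + 1 = N by omega, ← hi] at this
  have hnb0 : ∀ w, G.Adj (x 0) w → w = x 1 ∨ w = x (N - 1) := fun w hw =>
    eq_or_eq_of_deg_le_two (h2 _).le (hadj 0) hlast
      (fun h => by have := hinj _ _ (by omega) (by omega) h; omega) hw
  -- Successor and predecessor indices modulo `N`, stated in ℤ to avoid truncated subtraction. As 3
  -- divides `N`, wrapping around does not disturb residues modulo 3.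
  have hclosed : ∀ m < N, ∃ p q, p < N ∧ q < N ∧ ((p : ℤ) = m + 1 ∨ (p : ℤ) = m + 1 - N) ∧
      ((q : ℤ) = m - 1 ∨ (q : ℤ) = m - 1 + N) ∧ G.Adj (x m) (x p) ∧ G.Adj (x m) (x q) ∧
      ∀ w, G.Adj (x m) w → w = x p ∨ w = x q := by
    intro m hm
    rcases m with _ | m
    · exact ⟨1, N - 1, by omega, by omega, by simp, by omega, hadj 0, hlast, hnb0⟩
    · by_cases h : m + 2 < N
      · exact ⟨m + 2, m, h, by omega, by omega, by omega, hadj _, (hadj m).symm,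
          fun w hw => (hnb m w hw).symm⟩
      · have hN : m + 2 = N := by omega
        refine ⟨0, m, by omega, by omega, by omega, by omega, ?_, (hadj m).symm, fun w hw => ?_⟩
        · rw [hi, ← hN]; exact hadj _
        · rw [hi, ← hN]; exact (hnb m w hw).symm
  have hsurj : ∀ y, ∃ m, m < N ∧ x m = y := by
    intro y
    obtain ⟨p⟩ := hconn.preconnected (x 0) y
    have key : ∀ (a b : V) (p : G.Walk a b), (∃ m, m < N ∧ x m = a) → ∃ m, m < N ∧ x m = b := by
      intro a b p
      induction p with
      | nil => exact id
      | cons h p ih =>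
        rintro ⟨m, hm, rfl⟩
        obtain ⟨p, q, hp, hq, -, -, -, -, hall⟩ := hclosed m hm
        rcases hall _ h with h | h
        exacts [ih ⟨p, hp, h.symm⟩, ih ⟨q, hq, h.symm⟩]
    exact key _ _ p ⟨0, by omega, rfl⟩
  have hcard : Nat.card V = N := by
    rw [← Nat.card_fin N]
    refine (Nat.card_eq_of_bijective (fun m : Fin N => x m) ⟨?_, ?_⟩).symm
    · exact fun i j h => Fin.ext (hinj _ _ i.2 j.2 h)
    · exact fun y => by
        obtain ⟨m, hm, h⟩ := hsurj y
        exact ⟨⟨m, hm⟩, h⟩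
  rw [hcard] at h3
  choose I hI hxI using hsurj
  have hIx : ∀ m < N, I (x m) = m := fun m hm => hinj _ _ (hI _) hm (hxI _)
  let c : V → Fin 3 := fun y => ⟨I y % 3, Nat.mod_lt _ (by omega)⟩
  have hcx : ∀ m < N, (c (x m)).val = m % 3 := fun m hm => by simp only [c, hIx m hm]
  refine dynThreeColorable_of_coloring c ?_ ?_
  · intro u v huv h
    rw [← hxI u] at huv h
    have hIu := hI u
    obtain ⟨p, q, hp, hq, hp', hq', -, -, hall⟩ := hclosed (I u) hIu
    have e1 := hcx _ hIu
    have e2 := hcx _ hp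
    have e3 := hcx _ hq
    rcases hall v huv with rfl | rfl <;> rw [h] at e1 <;> omega
  · intro v _
    have hIv := hI v
    obtain ⟨p, q, hp, hq, hp', hq', h1, h2, -⟩ := hclosed (I v) hIv
    rw [hxI] at h1 h2
    refine ⟨_, _, h1, h2, fun h => ?_⟩
    have e2 := hcx _ hp
    have e3 := hcx _ hq
    rw [h] at e2
    omega

end Cycles

/-! ### Reasoning about programs -/

section Programs

/-- Started in memory `s`, the program `P` halts after at most `T` steps in a memory
that satisfies `Q`. -/
def Halts (P : Prog) (s : Mem) (T : ℕ) (Q : Mem → Prop) : Prop :=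
  ∃ t s', Runs P s t s' ∧ t ≤ T ∧ Q s'

notation:60 P:61 ";;" Q:60 => Prog.seq P Q

/-- The program that does nothing. -/
def skip : Prog := .copy 0 0

variable {P P' : Prog} {s : Mem} {T T' : ℕ} {Q R : Mem → Prop}

lemma Halts.mono (h : Halts P s T Q) (hT : T ≤ T') (hQ : ∀ s', Q s' → R s') : Halts P s T' R := by
  obtain ⟨t, s', hr, ht, hq⟩ := h
  exact ⟨t, s', hr, ht.trans hT, hQ s' hq⟩

/-- The postcondition of `P` is the claim about `P'`, so proofs follow the program forwards while
time bounds add up. -/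
lemma Halts.seq (h : Halts P s T fun s' => Halts P' s' T' Q) : Halts (P ;; P') s (T + T') Q := by
  obtain ⟨t, s', hr, ht, t', s'', hr', ht', hq⟩ := h
  exact ⟨_, s'', hr.seq hr', by omega, hq⟩

lemma Halts.const {x k : ℕ} (h : Q (s.setReg x k)) : Halts (.const x k) s (T + 1) Q :=
  ⟨1, _, .const s x k, by omega, h⟩

lemma Halts.copy {x y : ℕ} (h : Q (s.setReg x (s.reg y))) : Halts (.copy x y) s (T + 1) Q :=
  ⟨1, _, .copy s x y, by omega, h⟩

lemma Halts.succ {x y : ℕ} (h : Q (s.setReg x (s.reg y + 1))) : Halts (.succ x y) s (T + 1) Q :=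
  ⟨1, _, .succ s x y, by omega, h⟩

lemma Halts.pred {x y : ℕ} (h : Q (s.setReg x (s.reg y - 1))) : Halts (.pred x y) s (T + 1) Q :=
  ⟨1, _, .pred s x y, by omega, h⟩

lemma Halts.load {x a y : ℕ} (h : Q (s.setReg x (s.arr a (s.reg y)))) :
    Halts (.load x a y) s (T + 1) Q :=
  ⟨1, _, .load s x a y, by omega, h⟩

lemma Halts.skip (h : Q s) : Halts skip s (T + 1) Q := by
  refine Halts.copy ?_
  rwa [Mem.setReg, Function.update_eq_self]

lemma Halts.seq_const {x k : ℕ} (h : Halts P (s.setReg x k) T Q) :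
    Halts (.const x k ;; P) s (T + 1) Q :=
  (Halts.seq (T := 0 + 1) (Halts.const h)).mono (by omega) fun _ => id

lemma Halts.seq_copy {x y : ℕ} (h : Halts P (s.setReg x (s.reg y)) T Q) :
    Halts (.copy x y ;; P) s (T + 1) Q :=
  (Halts.seq (T := 0 + 1) (Halts.copy h)).mono (by omega) fun _ => id

lemma Halts.seq_succ {x y : ℕ} (h : Halts P (s.setReg x (s.reg y + 1)) T Q) :
    Halts (.succ x y ;; P) s (T + 1) Q :=
  (Halts.seq (T := 0 + 1) (Halts.succ h)).mono (by omega) fun _ => id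

lemma Halts.seq_pred {x y : ℕ} (h : Halts P (s.setReg x (s.reg y - 1)) T Q) :
    Halts (.pred x y ;; P) s (T + 1) Q :=
  (Halts.seq (T := 0 + 1) (Halts.pred h)).mono (by omega) fun _ => id

lemma Halts.seq_load {x a y : ℕ} (h : Halts P (s.setReg x (s.arr a (s.reg y))) T Q) :
    Halts (.load x a y ;; P) s (T + 1) Q :=
  (Halts.seq (T := 0 + 1) (Halts.load h)).mono (by omega) fun _ => id

lemma Halts.ite {b : Test} (h1 : b.Holds s → Halts P s T Q) (h2 : ¬ b.Holds s → Halts P' s T Q) :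
    Halts (.ite b P P') s (T + 1) Q := by
  by_cases hb : b.Holds s
  · obtain ⟨t, s', hr, ht, hq⟩ := h1 hb
    exact ⟨_, s', .ite_true hb hr, by omega, hq⟩
  · obtain ⟨t, s', hr, ht, hq⟩ := h2 hb
    exact ⟨_, s', .ite_false hb hr, by omega, hq⟩

/-- A loop that is executed `k` times, with the invariant `I m` after `m` executions. -/
lemma Halts.loop {b : Test} {k : ℕ} {I : ℕ → Mem → Prop} {B : ℕ → ℕ}
    (hstep : ∀ m < k, ∀ s, I m s → b.Holds s ∧ Halts P s (B m) (I (m + 1)))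
    (hend : ∀ s, I k s → ¬ b.Holds s) (h0 : I 0 s) :
    Halts (.loop b P) s (∑ m ∈ Finset.range k, (B m + 1) + 1) (I k) := by
  induction k generalizing s I B with
  | zero => exact ⟨1, s, .loop_false (hend s h0), by simp, h0⟩
  | succ k ih =>
    obtain ⟨hb, t, s', hr, ht, h1⟩ := hstep 0 (by omega) s h0
    obtain ⟨t', s'', hr', ht', hq⟩ := ih (I := fun m => I (m + 1)) (B := fun m => B (m + 1))
      (fun m hm s hs => hstep (m + 1) (by omega) s hs) hend h1
    refine ⟨_, s'', .loop_true hb hr hr', ?_, hq⟩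
    rw [Finset.sum_range_succ']
    omega

lemma Halts.loop_const {b : Test} {k B : ℕ} {I : ℕ → Mem → Prop}
    (hstep : ∀ m < k, ∀ s, I m s → b.Holds s ∧ Halts P s B (I (m + 1)))
    (hend : ∀ s, I k s → ¬ b.Holds s) (h0 : I 0 s) :
    Halts (.loop b P) s (k * (B + 1) + 1) (I k) :=
  (Halts.loop (B := fun _ => B) hstep hend h0).mono (by simp) fun _ => id

@[simp] lemma reg_setReg (s : Mem) (x k y : ℕ) :
    (s.setReg x k).reg y = if y = x then k else s.reg y := by
  simp [Mem.setReg, Function.update_apply]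

@[simp] lemma arr_setReg (s : Mem) (x k : ℕ) : (s.setReg x k).arr = s.arr := rfl

@[simp] lemma holds_eq (s : Mem) (x y : ℕ) : (Test.eq x y).Holds s ↔ s.reg x = s.reg y := Iff.rfl

@[simp] lemma holds_lt (s : Mem) (x y : ℕ) : (Test.lt x y).Holds s ↔ s.reg x < s.reg y := Iff.rfl

/-- The memory `s'` has the arrays of `s`, and its registers outside `X` are those of `s`. -/
def Agree (X : List ℕ) (s s' : Mem) : Prop := s'.arr = s.arr ∧ ∀ r ∉ X, s'.reg r = s.reg r

end Programs

/-! ### The input -/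

section Input

variable {n : ℕ} {G : SimpleGraph (Fin n)} {adj : Fin n → List (Fin n)}

/-- The position at which the adjacency list of `i` starts. -/
def start (adj : Fin n → List (Fin n)) (i : ℕ) : ℕ := ((List.ofFn adj).take i).flatten.length

/-- The memory contains the input graph. -/
def HasInput (adj : Fin n → List (Fin n)) (s : Mem) : Prop :=
  s.arr = (initialMem adj).arr ∧ s.reg 0 = n

lemma deg_eq_length (h : IsAdjLists G adj) (v : Fin n) : deg G v = (adj v).length := by
  classical
  have : G.neighborSet v = ((adj v).toFinset : Set (Fin n)) := by
    ext u
    simp [(h v).2 u]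
  rw [deg, this, Set.ncard_coe_finset, List.toFinset_card_of_nodup (h v).1]

lemma start_succ (v : Fin n) : start adj (v + 1) = start adj v + (adj v).length := by
  rw [start, start, List.take_add_one]
  simp

lemma getElem_flatten_aux (l : List (List (Fin n))) (i k : ℕ) (hi : i < l.length)
    (hk : k < (l[i]).length) :
    (l.flatten.map Fin.val).getD ((l.take i).flatten.length + k) 0 = ((l[i])[k]).val := by
  induction l generalizing i with
  | nil => simp at hi
  | cons a l ih =>
    rcases i with _ | i
    · simp only [List.getElem_cons_zero] at hk
      simp [List.getD_eq_getElem?_getD, List.getElem?_append_left, hk]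
    · have := ih i (by simpa using hi) (by simpa using hk)
      simp only [List.take_succ_cons, List.flatten_cons, List.length_append, List.map_append,
        List.getElem_cons_succ]
      rw [List.getD_append_right _ _ _ _ (by simp; omega), ← this]
      congr 1
      simp
      omega

lemma HasInput.arr_zero {s : Mem} (h : HasInput adj s) {i : ℕ} (hi : i ≤ n) :
    s.arr 0 i = start adj i := by
  rw [h.1]
  simp [initialMem, hi, start]

lemma HasInput.arr_one {s : Mem} (h : HasInput adj s) (v : Fin n) {k : ℕ}
    (hk : k < (adj v).length) : s.arr 1 (start adj v + k) = ((adj v)[k]).val := by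
  rw [h.1]
  have := getElem_flatten_aux (List.ofFn adj) v k (by simp) (by simpa using hk)
  simpa [initialMem, start] using this

lemma HasInput.of_agree {s s' : Mem} {X : List ℕ} (h : HasInput adj s) (h' : Agree X s s')
    (hX : 0 ∉ X) : HasInput adj s' :=
  ⟨h'.1.trans h.1, (h'.2 0 hX).trans h.2⟩

/-- Load the start, the end, and the first places of the adjacency list of the vertex in
register `1`. -/
def loadDeg : Prog :=
  .load 3 0 1 ;; .succ 8 1 ;; .load 4 0 8 ;; .succ 5 3 ;; .succ 6 5 ;; .succ 7 6

/-- No degree is ever computed: the end of the list is compared with the positions 1, 2, 3 after its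
start, which successors can reach. -/
lemma loadDeg_spec {s : Mem} (h : HasInput adj s) (v : Fin n) (hv : s.reg 1 = v) :
    Halts loadDeg s 6 fun s' => Agree [3, 4, 5, 6, 7, 8] s s' ∧ s'.reg 3 = start adj v ∧
      s'.reg 4 = start adj v + (adj v).length ∧ s'.reg 5 = start adj v + 1 ∧
      s'.reg 6 = start adj v + 2 ∧ s'.reg 7 = start adj v + 3 := by
  have e1 := h.arr_zero (i := v) (by omega)
  have e2 := h.arr_zero (i := v + 1) (by omega)
  rw [start_succ] at e2
  refine .seq_load (.seq_succ (.seq_load (.seq_succ (.seq_succ (.succ ⟨⟨rfl, ?_⟩, ?_⟩)))))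
  · intro r hr
    simp at hr
    simp [hr]
  · simp [hv, e1, e2]

end Input

/-! ### The determination algorithm -/

section Determination

variable {n : ℕ} {G : SimpleGraph (Fin n)} {adj : Fin n → List (Fin n)}

lemma ncard_lt_succ (p : Fin n → Prop) (v : Fin n) [Decidable (p v)] :
    {w : Fin n | w.val < v.val + 1 ∧ p w}.ncard =
      {w : Fin n | w.val < v.val ∧ p w}.ncard + if p v then 1 else 0 := by
  have hsub : {w : Fin n | w.val < v.val + 1 ∧ p w} =
      if p v then insert v {w : Fin n | w.val < v.val ∧ p w}
      else {w : Fin n | w.val < v.val ∧ p w} := by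
    ext w
    by_cases hwv : w = v
    · subst hwv
      split_ifs with h <;> simp [h]
    · have hwv' : w.val ≠ v.val := fun h => hwv (Fin.ext h)
      have hlt : w.val < v.val + 1 ↔ w.val < v.val := by omega
      split_ifs with h <;> simp only [Set.mem_ofPred_eq, Set.mem_insert_iff, hwv, hlt, false_or]
  rw [hsub]
  split_ifs with h
  · rw [Set.ncard_insert_of_notMem (by simp) (Set.toFinite _)]
  · rfl

lemma exists_lt_succ_iff (p : Fin n → Prop) (v : Fin n) :
    (∃ w : Fin n, w.val < v.val + 1 ∧ p w) ↔ (∃ w : Fin n, w.val < v.val ∧ p w) ∨ p v := by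
  constructor
  · rintro ⟨w, hw, hp⟩
    rcases (Nat.lt_succ_iff.1 hw).lt_or_eq with h | h
    · exact Or.inl ⟨w, h, hp⟩
    · exact Or.inr (Fin.ext h ▸ hp)
  · rintro (⟨w, hw, hp⟩ | hp)
    exacts [⟨w, by omega, hp⟩, ⟨v, by omega, hp⟩]

/-- Set register `13` to `0` unless the vertex that stands at the place in register `p` has
degree 3. -/
def checkCubic (p : ℕ) : Prog :=
  .load 14 1 p ;; .load 15 0 14 ;; .succ 17 14 ;; .load 18 0 17 ;; .succ 15 15 ;; .succ 15 15 ;;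
  .succ 15 15 ;; .ite (.eq 15 18) skip (.const 13 0)

lemma checkCubic_spec {s : Mem} (h : HasInput adj s) {p : ℕ} (w : Fin n)
    (hw : s.arr 1 (s.reg p) = w) :
    Halts (checkCubic p) s 9 fun s' => Agree [13, 14, 15, 17, 18] s s' ∧
      s'.reg 13 = if (adj w).length = 3 then s.reg 13 else 0 := by
  have e1 := h.arr_zero (i := w) (by omega)
  have e2 := h.arr_zero (i := w + 1) (by omega)
  rw [start_succ] at e2
  refine .seq_load (.seq_load (.seq_succ (.seq_load (.seq_succ (.seq_succ (.seq_succ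
    (.ite (fun hb => .skip ⟨⟨rfl, ?_⟩, ?_⟩) (fun hb => .const ⟨⟨rfl, ?_⟩, ?_⟩))))))))
  · intro r hr
    simp at hr
    simp [hr]
  · simp [hw, e1, e2] at hb
    simp
    omega
  · intro r hr
    simp at hr
    simp [hr]
  · simp [hw, e1, e2] at hb
    simp
    omega

/-- Count the vertex in register `1`: register `10` is set if it has degree 1 and register `11`
if its degree is not 2; registers `12` and `16` count the vertices of degree 3 and the full ones. -/
def countVertex : Prog :=
  loadDeg ;; .ite (.eq 4 5) (.const 10 1) skip ;; .ite (.eq 4 6) skip (.const 11 1) ;;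
  .ite (.eq 4 7) (.succ 12 12 ;; .const 13 1 ;; checkCubic 3 ;; checkCubic 5 ;; checkCubic 6 ;;
    .ite (.lt 19 13) (.succ 16 16) skip) skip ;; .succ 1 1

/-- The invariant of the counting loop. -/
def CountInv (G : SimpleGraph (Fin n)) (adj : Fin n → List (Fin n)) (i : ℕ) (s : Mem) : Prop :=
  HasInput adj s ∧ s.reg 1 = i ∧ s.reg 19 = 0 ∧
  (0 < s.reg 10 ↔ ∃ v : Fin n, v.val < i ∧ deg G v = 1) ∧
  (0 < s.reg 11 ↔ ∃ v : Fin n, v.val < i ∧ deg G v ≠ 2) ∧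
  s.reg 12 = {v : Fin n | v.val < i ∧ deg G v = 3}.ncard ∧
  s.reg 16 = {v : Fin n | v.val < i ∧ IsFull G v}.ncard

/-- Register `13` starts at 1 and survives the checks of the three listed neighbours exactly when
all have degree 3, so it ends as the indicator of fullness. The bound is 1 + 1 + 3 · 9 + 2. -/
lemma countFull_spec (hadj : IsAdjLists G adj) {s : Mem} (h : HasInput adj s) (v : Fin n)
    (hd : deg G v = 3) (h3 : s.reg 3 = start adj v) (h5 : s.reg 5 = start adj v + 1)
    (h6 : s.reg 6 = start adj v + 2) (h19 : s.reg 19 = 0) [Decidable (IsFull G v)] :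
    Halts (.succ 12 12 ;; .const 13 1 ;; checkCubic 3 ;; checkCubic 5 ;; checkCubic 6 ;;
      .ite (.lt 19 13) (.succ 16 16) skip) s 31 fun s' =>
      Agree [12, 13, 14, 15, 16, 17, 18] s s' ∧ s'.reg 12 = s.reg 12 + 1 ∧
      s'.reg 16 = s.reg 16 + if IsFull G v then 1 else 0 := by
  have hlen : (adj v).length = 3 := by rw [← deg_eq_length hadj, hd]
  have hfull : IsFull G v ↔ (adj (adj v)[0]).length = 3 ∧ (adj (adj v)[1]).length = 3 ∧
      (adj (adj v)[2]).length = 3 := by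
    simp only [← deg_eq_length hadj]
    constructor
    · rintro ⟨-, hf⟩
      exact ⟨hf _ (((hadj v).2 _).1 (List.getElem_mem _)),
        hf _ (((hadj v).2 _).1 (List.getElem_mem _)), hf _ (((hadj v).2 _).1 (List.getElem_mem _))⟩
    · rintro ⟨h0, h1, h2⟩
      refine ⟨hd, fun w hw => ?_⟩
      obtain ⟨k, hk, rfl⟩ := List.getElem_of_mem (((hadj v).2 w).2 hw)
      have : k < 3 := by omega
      interval_cases k
      exacts [h0, h1, h2]
  have g0 := h.arr_one v (k := 0) (by omega)
  have g1 := h.arr_one v (k := 1) (by omega)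
  have g2 := h.arr_one v (k := 2) (by omega)
  refine .seq_succ (.seq_const (Halts.seq (T := 9) (T' := 20) ?_))
  have i1 : HasInput adj ((s.setReg 12 (s.reg 12 + 1)).setReg 13 1) := ⟨h.1, by simpa using h.2⟩
  refine (checkCubic_spec i1 (adj v)[0] (by simpa [h3] using g0)).mono le_rfl ?_
  rintro s1 ⟨a1, b1⟩
  have i2 := i1.of_agree a1 (by simp)
  refine Halts.seq (T := 9) (T' := 11) ((checkCubic_spec i2 (adj v)[1] ?_).mono le_rfl ?_)
  · rw [a1.1, a1.2 5 (by simp)]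
    simpa [h5] using g1
  rintro s2 ⟨a2, b2⟩
  have i3 := i2.of_agree a2 (by simp)
  refine Halts.seq (T := 9) (T' := 2) ((checkCubic_spec i3 (adj v)[2] ?_).mono le_rfl ?_)
  · rw [a2.1, a1.1, a2.2 6 (by simp), a1.2 6 (by simp)]
    simpa [h6] using g2
  rintro s3 ⟨a3, b3⟩
  have hr : ∀ r, r ∉ [13, 14, 15, 17, 18] → s3.reg r =
      ((s.setReg 12 (s.reg 12 + 1)).setReg 13 1).reg r := fun r hr => by
    rw [a3.2 r hr, a2.2 r hr, a1.2 r hr]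
  have harr : s3.arr = s.arr := by rw [a3.1, a2.1, a1.1]; rfl
  have h13 : s3.reg 13 = if IsFull G v then 1 else 0 := by
    rw [b3, b2, b1]
    simp only [hfull, reg_setReg, if_true]
    split_ifs <;> tauto
  have h19' : s3.reg 19 = 0 := by rw [hr 19 (by simp)]; simpa using h19
  have h12 : s3.reg 12 = s.reg 12 + 1 := by rw [hr 12 (by simp)]; simp
  have h16 : s3.reg 16 = s.reg 16 := by rw [hr 16 (by simp)]; simp
  have hr' : ∀ r, r ∉ [12, 13, 14, 15, 16, 17, 18] → s3.reg r = s.reg r := fun r hr' => by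
    simp at hr'
    rw [hr r (by simp [hr'])]
    simp [hr']
  refine .ite (fun hb => .succ ⟨⟨harr, ?_⟩, ?_, ?_⟩) (fun hb => .skip ⟨⟨harr, hr'⟩, h12, ?_⟩)
  · intro r hrr
    rw [reg_setReg, if_neg (by rintro rfl; simp at hrr), hr' r hrr]
  · simp [h12]
  · rw [holds_lt, h19', h13] at hb
    split_ifs at hb ⊢ <;> simp_all
  · rw [holds_lt, h19', h13] at hb
    split_ifs at hb ⊢ <;> simp_all

lemma countVertex_spec (hadj : IsAdjLists G adj) {s : Mem} (v : Fin n)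
    (h : CountInv G adj v s) : Halts countVertex s 43 (CountInv G adj (v + 1)) := by
  classical
  obtain ⟨hin, h1, h19, h10, h11, h12, h16⟩ := h
  refine Halts.seq (T := 6) (T' := 37) ((loadDeg_spec hin v h1).mono le_rfl ?_)
  rintro s1 ⟨a1, b3, b4, b5, b6, b7⟩
  rw [← deg_eq_length hadj] at b4
  have leafStep : Halts (.ite (.eq 4 5) (.const 10 1) skip) s1 2 fun s' => Agree [10] s1 s' ∧
      (0 < s'.reg 10 ↔ ∃ w : Fin n, w.val < v.val + 1 ∧ deg G w = 1) := by
    have := a1.2 10 (by simp)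
    rw [exists_lt_succ_iff, ← h10]
    refine .ite (fun hb => .const ⟨⟨rfl, fun r hr => ?_⟩, ?_⟩)
      (fun hb => .skip ⟨⟨rfl, fun _ _ => rfl⟩, ?_⟩)
    · simp at hr; simp [hr]
    · rw [holds_eq, b4, b5] at hb
      have : deg G v = 1 := by omega
      simp [this]
    · rw [holds_eq, b4, b5] at hb
      have : deg G v ≠ 1 := by omega
      rw [a1.2 10 (by simp)]
      simp [this]
  refine Halts.seq (T := 2) (T' := 35) (leafStep.mono le_rfl ?_)
  rintro s2 ⟨a2, c10⟩
  have notTwoStep : Halts (.ite (.eq 4 6) skip (.const 11 1)) s2 2 fun s' => Agree [11] s2 s' ∧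
      (0 < s'.reg 11 ↔ ∃ w : Fin n, w.val < v.val + 1 ∧ deg G w ≠ 2) := by
    rw [exists_lt_succ_iff, ← h11]
    refine .ite (fun hb => .skip ⟨⟨rfl, fun _ _ => rfl⟩, ?_⟩)
      (fun hb => .const ⟨⟨rfl, fun r hr => ?_⟩, ?_⟩)
    · rw [holds_eq, a2.2 4 (by simp), a2.2 6 (by simp), b4, b6] at hb
      have : deg G v = 2 := by omega
      rw [a2.2 11 (by simp), a1.2 11 (by simp)]
      simp [this]
    · simp at hr; simp [hr]
    · rw [holds_eq, a2.2 4 (by simp), a2.2 6 (by simp), b4, b6] at hb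
      have : deg G v ≠ 2 := by omega
      simp [this]
  refine Halts.seq (T := 2) (T' := 33) (notTwoStep.mono le_rfl ?_)
  rintro s3 ⟨a3, c11⟩
  have keep : ∀ r, r ∉ [3, 4, 5, 6, 7, 8, 10, 11] → s3.reg r = s.reg r := fun r hr => by
    simp at hr
    rw [a3.2 r (by simp [hr]), a2.2 r (by simp [hr]), a1.2 r (by simp [hr])]
  have keep1 : ∀ r, r ∉ [10, 11] → s3.reg r = s1.reg r := fun r hr => by
    simp at hr
    rw [a3.2 r (by simp [hr]), a2.2 r (by simp [hr])]
  have hin3 : HasInput adj s3 :=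
    ((hin.of_agree a1 (by simp)).of_agree a2 (by simp)).of_agree a3 (by simp)
  have countStep : Halts (.ite (.eq 4 7) (.succ 12 12 ;; .const 13 1 ;; checkCubic 3 ;;
      checkCubic 5 ;; checkCubic 6 ;; .ite (.lt 19 13) (.succ 16 16) skip) skip) s3 32 fun s' =>
      Agree [12, 13, 14, 15, 16, 17, 18] s3 s' ∧
      s'.reg 12 = {w : Fin n | w.val < v.val + 1 ∧ deg G w = 3}.ncard ∧
      s'.reg 16 = {w : Fin n | w.val < v.val + 1 ∧ IsFull G w}.ncard := by
    rw [ncard_lt_succ (fun w => deg G w = 3), ncard_lt_succ (IsFull G), ← h12, ← h16]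
    refine .ite (fun hb => ?_) (fun hb => .skip ⟨⟨rfl, fun _ _ => rfl⟩, ?_⟩)
    · rw [holds_eq, keep1 4 (by simp), keep1 7 (by simp), b4, b7] at hb
      have hd : deg G v = 3 := by omega
      refine (countFull_spec hadj hin3 v hd (by rw [keep1 3 (by simp), b3])
        (by rw [keep1 5 (by simp), b5]) (by rw [keep1 6 (by simp), b6])
        (by rw [keep 19 (by simp), h19])).mono le_rfl ?_
      rintro s4 ⟨a4, d12, d16⟩
      refine ⟨a4, ?_, ?_⟩
      · rw [d12, keep 12 (by simp), if_pos hd]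
      · rw [d16, keep 16 (by simp)]
    · rw [holds_eq, keep1 4 (by simp), keep1 7 (by simp), b4, b7] at hb
      have hd : deg G v ≠ 3 := by omega
      rw [keep 12 (by simp), keep 16 (by simp), if_neg hd, if_neg (fun h => hd h.1)]
      simp
  refine Halts.seq (T := 32) (T' := 1) (countStep.mono le_rfl ?_)
  rintro s4 ⟨a4, c12, c16⟩
  have hin4 := hin3.of_agree a4 (by simp)
  refine .succ ⟨⟨hin4.1, by simpa using hin4.2⟩, ?_, ?_, ?_, ?_, ?_, ?_⟩
  · simp [a4.2 1 (by simp), keep 1 (by simp), h1]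
  · simp [a4.2 19 (by simp), keep 19 (by simp), h19]
  · rw [← c10]
    simp [a4.2 10 (by simp), a3.2 10 (by simp)]
  · rw [← c11]
    simp [a4.2 11 (by simp)]
  · rw [← c12]
    simp
  · rw [← c16]
    simp

/-- Count the vertices of the various kinds. -/
def countAll : Prog := .loop (.lt 1 0) countVertex

lemma countAll_spec (hadj : IsAdjLists G adj) :
    Halts countAll (initialMem adj) (n * 44 + 1) (CountInv G adj n) := by
  refine Halts.loop_const (I := CountInv G adj) (B := 43) ?_ ?_ ?_
  · intro m hm s hs
    exact ⟨by rw [holds_lt, hs.2.1, hs.1.2]; exact hm, countVertex_spec hadj ⟨m, hm⟩ hs⟩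
  · intro s hs
    rw [holds_lt, hs.2.1, hs.1.2]
    exact lt_irrefl n
  · refine ⟨⟨rfl, rfl⟩, rfl, rfl, ?_, ?_, ?_, ?_⟩ <;> simp [initialMem]

/-- Answer from the counts: register `0` is set unless there are no leaves, exactly four vertices
of degree 3 and at least two full ones. -/
def answerFromCounts : Prog :=
  .const 20 4 ;; .const 21 2 ;; .ite (.lt 19 10) (.const 0 1)
    (.ite (.eq 12 20) (.ite (.lt 16 21) (.const 0 1) (.const 0 0)) (.const 0 1))

lemma answerFromCounts_spec {s : Mem} (h : CountInv G adj n s) :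
    Halts answerFromCounts s 6 fun s' =>
      ((∃ v, deg G v = 1) ∨ {v | deg G v = 3}.ncard ≠ 4 ∨ {v | IsFull G v}.ncard < 2 →
        s'.reg 0 = 1) ∧
      (¬ ((∃ v, deg G v = 1) ∨ {v | deg G v = 3}.ncard ≠ 4 ∨ {v | IsFull G v}.ncard < 2) →
        s'.reg 0 = 0) := by
  obtain ⟨hin, h1, h19, h10, h11, h12, h16⟩ := h
  simp only [Fin.is_lt, true_and] at h10 h12 h16
  rw [← h10, ← h12, ← h16]
  refine .seq_const (.seq_const (.ite (fun hb => .const ?_) (fun hb => .ite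
    (fun hb' => .ite (fun hb'' => .const ?_) (fun hb'' => .const ?_)) (fun hb' => .const ?_))))
  all_goals simp [h19] at *
  all_goals omega

/-- The determination algorithm. -/
def determine : Prog := countAll ;; answerFromCounts

theorem determine_decides : DecidesInLinearTime determine (fun _ G => G.Connected ∧ InC G)
    (fun _ G => DeterminationAnswer G) := by
  -- As `n ≥ 1`, the additive constants are absorbed: 44 n + 7 ≤ 51 n.
  refine ⟨51, fun n hn G adj hadj ⟨hconn, hG⟩ => ?_⟩
  beta_reduce
  rw [determinationAnswer_iff hconn hG]
  obtain ⟨t, s, hr, ht, hs⟩ := Halts.seq ((countAll_spec hadj).mono le_rfl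
    fun s hs => answerFromCounts_spec hs)
  exact ⟨t, s, hr, by omega, hs⟩

/-- Decide whether the number in register `0` is divisible by 3. -/
def divisibleByThree : Prog :=
  .const 20 2 ;; .copy 22 0 ;; .loop (.lt 20 22) (.pred 22 22 ;; .pred 22 22 ;; .pred 22 22) ;;
  .ite (.eq 22 19) (.const 0 1) (.const 0 0)

/-- Subtracting 3 while more than 2 is left takes `n / 3` rounds and leaves `n % 3` in register
`22`. -/
lemma divisibleByThree_spec {s : Mem} (h0 : s.reg 0 = n) (h19 : s.reg 19 = 0) :
    Halts divisibleByThree s (4 * n + 6) fun s' =>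
      (3 ∣ n → s'.reg 0 = 1) ∧ (¬ 3 ∣ n → s'.reg 0 = 0) := by
  refine Halts.mono (T := (n / 3) * (3 + 1) + 1 + 2 + 1 + 1) (.seq_const (.seq_copy (Halts.seq
    (Halts.mono (T := (n / 3) * (3 + 1) + 1)
    (Halts.loop_const (I := fun m s => s.reg 20 = 2 ∧ s.reg 19 = 0 ∧ s.reg 22 = n - 3 * m)
      ?_ ?_ ?_) le_rfl ?_)))) (by omega) (fun _ => id)
  · rintro m hm s ⟨h20, h19, h22⟩
    refine ⟨by rw [holds_lt, h20, h22]; omega, .seq_pred (.seq_pred (.pred ?_))⟩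
    simp [h20, h19, h22]
    omega
  · rintro s ⟨h20, h19, h22⟩
    rw [holds_lt, h20, h22]
    omega
  · simp [h0, h19]
  · rintro s ⟨h20, h19, h22⟩
    refine .ite (fun hb => .const ?_) (fun hb => .const ?_)
    · rw [holds_eq, h22, h19] at hb
      simp
      omega
    · rw [holds_eq, h22, h19] at hb
      simp
      omega

/-- Decide dynamic 3-colorability. -/
def decideColorable : Prog :=
  countAll ;; .ite (.lt 19 11) answerFromCounts divisibleByThree

/-- Register `11` separates the cycles, decided by `3 ∣ n`, from the graphs on which the
determination procedure is correct. -/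
theorem decideColorable_decides :
    DecidesInLinearTime decideColorable (fun _ G => G.Connected ∧ InC G)
      (fun _ G => DynThreeColorable G) := by
  refine ⟨56, fun n hn G adj hadj ⟨hconn, hG⟩ => ?_⟩
  have key : Halts decideColorable (initialMem adj) ((n * 44 + 1) + (4 * n + 6 + 1)) fun s' =>
      (DynThreeColorable G → s'.reg 0 = 1) ∧ (¬ DynThreeColorable G → s'.reg 0 = 0) := by
    refine Halts.seq ((countAll_spec hadj).mono le_rfl fun s hs => .ite (fun hb => ?_)
      (fun hb => ?_))
    · rw [holds_lt, hs.2.2.1, hs.2.2.2.2.1] at hb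
      obtain ⟨v, -, hv⟩ := hb
      rw [dynThreeColorable_iff_determinationAnswer hconn hG (fun h => hv (h v)),
        determinationAnswer_iff hconn hG]
      exact (answerFromCounts_spec hs).mono (by omega) fun _ => id
    · rw [holds_lt, hs.2.2.1, hs.2.2.2.2.1] at hb
      have h2 : ∀ v, deg G v = 2 := fun v => by_contra fun h => hb ⟨v, v.2, h⟩
      have : DynThreeColorable G ↔ 3 ∣ n := by
        have := Nat.card_fin n
        constructor
        · exact fun h => this ▸ three_dvd_card_of_dynThreeColorable h2 h
        · exact fun h => dynThreeColorable_of_three_dvd_card hconn h2 (this.symm ▸ h)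
      rw [this]
      exact divisibleByThree_spec hs.1.2 hs.2.2.1
  obtain ⟨t, s, hr, ht, hs⟩ := key
  exact ⟨t, s, hr, by omega, hs⟩

end Determination

/-! ### Total length of the threads -/

section Recognition

/-- The thread that starts with `u`, `w` is an `A_i` with `i` of the form `3 j + 1`. -/
def BadThread {V : Type*} [Finite V] (G : SimpleGraph V) (u w : V) : Prop :=
  deg G (tip G u w) = 3 ∧ threadLength G u w % 3 = 0 ∧ tip G u w ≠ u

/-- A forbidden path is a complete thread, hence determined by its first edge, so one inspection per
edge leaving a vertex of degree 3 suffices. -/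
lemma inC_iff {V : Type*} [Finite V] {G : SimpleGraph V} : InC G ↔ (∀ v, deg G v ≤ 3) ∧
    ClawFree G ∧ ∀ u w, deg G u = 3 → G.Adj u w → ¬ BadThread G u w := by
  refine and_congr_right fun _ => and_congr_right fun _ => ?_
  constructor
  · rintro hA u w hu huw ⟨h1, h2, h3⟩
    obtain ⟨-, ht, -⟩ := threadLength_spec huw (by omega)
    exact ht.mod_three_ne_zero hA (by rwa [track_zero]) h1 (by rw [track_zero]; exact h3.symm) h2
  · intro h j hj hA
    obtain ⟨x, hx, h0, hk, hne⟩ := (hasA_succ_iff (by omega)).1 hA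
    obtain ⟨e1, e2⟩ := threadLength_eq (by omega) hx (by omega) (by omega) rfl rfl
    refine h (x 0) (x 1) h0 (hx.1 0 (by omega)) ⟨by rwa [e2], by rw [e1]; omega, ?_⟩
    rw [e2]
    exact hne.symm

/-- Threads with different starts have no pair of successive vertices in common. -/
lemma track_pair_injective {V : Type*} [Finite V] {G : SimpleGraph V} {u w u' w' : V}
    (hu : deg G u ≠ 2) (hu' : deg G u' ≠ 2) (hw : G.Adj u w) (hw' : G.Adj u' w') :
    ∀ m m', m < threadLength G u w → m' < threadLength G u' w' →
      track G u w m = track G u' w' m' → track G u w (m + 1) = track G u' w' (m' + 1) →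
      u = u' ∧ w = w' ∧ m = m' := by
  obtain ⟨-, ht, -⟩ := threadLength_spec hw hu
  obtain ⟨-, ht', -⟩ := threadLength_spec hw' hu'
  intro m
  induction m with
  | zero =>
    intro m' hm hm' h0 h1
    rcases m' with _ | m'
    · rw [track_zero, track_zero] at h0
      rw [track_one, track_one] at h1
      exact ⟨h0, h1, rfl⟩
    · rw [track_zero] at h0
      exact absurd (ht'.2 m' hm').1 (h0 ▸ hu)
  | succ m ih =>
    intro m' hm hm' h0 h1
    rcases m' with _ | m'
    · rw [track_zero] at h0
      exact absurd (ht.2 m hm).1 (h0 ▸ hu')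
    -- The preceding vertex of the second thread is a neighbour of an internal vertex of the first.
    -- If it is the preceding vertex there, induction applies; if it is the next one, the second
    -- thread would turn back.
    · have hadj := (ht'.1 m' (by omega)).symm
      rw [← h0] at hadj
      rcases ht.eq_or_eq hm hadj with h | h
      · obtain ⟨e1, e2, e3⟩ := ih m' (by omega) (by omega) h.symm h0
        exact ⟨e1, e2, by omega⟩
      · exact absurd (h.trans h1) (ht'.2 m' hm').2

variable {n : ℕ} {G : SimpleGraph (Fin n)} {adj : Fin n → List (Fin n)}

open Classical in
/-- The total length of the threads that start at `v`, if `v` has degree 3. -/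
noncomputable def threadWork (G : SimpleGraph (Fin n)) (adj : Fin n → List (Fin n)) (i : ℕ) : ℕ :=
  if h : i < n then
    if deg G ⟨i, h⟩ = 3 then ((adj ⟨i, h⟩).map (threadLength G ⟨i, h⟩)).sum else 0
  else 0

/-- The sum counts triples of a start, a first neighbour and a position. They map injectively to
oriented edges, of which there are at most `3 n`. -/
lemma sum_threadWork_le (hadj : IsAdjLists G adj) (hmax : ∀ v, deg G v ≤ 3) :
    ∑ i ∈ Finset.range n, threadWork G adj i ≤ n * 3 := by
  classical
  have hdarts : (Finset.univ.sigma fun v : Fin n => (adj v).toFinset).card ≤ n * 3 := by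
    rw [Finset.card_sigma]
    refine (Finset.sum_le_card_nsmul _ _ 3 fun v _ => ?_).trans (by simp)
    rw [List.toFinset_card_of_nodup (hadj v).1, ← deg_eq_length hadj]
    exact hmax v
  refine le_trans ?_ hdarts
  rw [Finset.sum_range]
  have hwork : ∀ v : Fin n, threadWork G adj v =
      if deg G v = 3 then ∑ w ∈ (adj v).toFinset, threadLength G v w else 0 := by
    intro v
    rw [threadWork, dif_pos v.2, List.sum_toFinset _ (hadj v).1]
  simp only [hwork]
  rw [← Finset.sum_filter]
  have hcard : ∑ v with deg G v = 3, ∑ w ∈ (adj v).toFinset, threadLength G v w =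
      ((Finset.univ.filter fun v : Fin n => deg G v = 3).sigma fun v =>
        (adj v).toFinset.sigma fun w => Finset.range (threadLength G v w)).card := by
    simp [Finset.card_sigma]
  rw [hcard]
  refine Finset.card_le_card_of_injOn
    (fun d => ⟨track G d.1 d.2.1 d.2.2, track G d.1 d.2.1 (d.2.2 + 1)⟩) ?_ ?_
  · rintro ⟨v, w, m⟩ hd
    simp only [Finset.coe_sigma, Set.mem_sigma_iff, Finset.coe_filter, Finset.mem_univ, true_and,
      Set.mem_ofPred_eq, Finset.mem_coe, List.mem_toFinset, Finset.mem_range, (hadj _).2] at hd ⊢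
    obtain ⟨-, ht, -⟩ := threadLength_spec hd.2.1 (by omega)
    exact ht.1 m hd.2.2
  · rintro ⟨v, w, m⟩ hd ⟨v', w', m'⟩ hd' he
    simp only [Finset.coe_sigma, Set.mem_sigma_iff, Finset.coe_filter, Finset.mem_univ, true_and,
      Set.mem_ofPred_eq, Finset.mem_coe, List.mem_toFinset, Finset.mem_range, (hadj _).2] at hd hd'
    simp only [Sigma.mk.injEq, heq_eq_eq] at he
    obtain ⟨rfl, rfl, rfl⟩ := track_pair_injective (by omega) (by omega) hd.2.1 hd'.2.1 m m'
      hd.2.2 hd'.2.2 he.1 he.2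
    rfl

/-! ### Recognition of the class -/

/-- Execute a program for every vertex. -/
def forVertices (P : Prog) : Prog := .const 1 0 ;; .loop (.lt 1 0) (P ;; .succ 1 1)

/-- The invariant of the loops over all vertices: register `2` is set if one of the vertices
treated so far has the property `p`, or if it was set before, as expressed by `q`. -/
def FlagInv (adj : Fin n → List (Fin n)) (q : Prop) (p : Fin n → Prop) (i : ℕ) (s : Mem) : Prop :=
  HasInput adj s ∧ s.reg 1 = i ∧ s.reg 19 = 0 ∧ s.reg 20 = 2 ∧
  (0 < s.reg 2 ↔ q ∨ ∃ v : Fin n, v.val < i ∧ p v)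

/-- A loop over all vertices. -/
lemma forVertices_spec {P : Prog} {q : Prop} {p : Fin n → Prop} {B : ℕ → ℕ}
    (hP : ∀ (v : Fin n) (s : Mem), FlagInv adj q p v s → Halts P s (B v) fun s' =>
      HasInput adj s' ∧ s'.reg 1 = v ∧ s'.reg 19 = 0 ∧ s'.reg 20 = 2 ∧
      (0 < s'.reg 2 ↔ 0 < s.reg 2 ∨ p v)) {s : Mem} (h : HasInput adj s) (h19 : s.reg 19 = 0)
    (h20 : s.reg 20 = 2) (h2 : 0 < s.reg 2 ↔ q) :
    Halts (forVertices P) s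
      (∑ i ∈ Finset.range n, (B i + 2) + 2) fun s' =>
      HasInput adj s' ∧ s'.reg 19 = 0 ∧ s'.reg 20 = 2 ∧ (0 < s'.reg 2 ↔ q ∨ ∃ v, p v) := by
  refine .seq_const ((Halts.loop (I := FlagInv adj q p) (B := fun i => B i + 1) (k := n)
    ?_ ?_ ?_).mono (by simp [add_assoc]) ?_)
  · intro m hm s hs
    refine ⟨by rw [holds_lt, hs.2.1, hs.1.2]; exact hm,
      Halts.seq ((hP ⟨m, hm⟩ s hs).mono le_rfl ?_)⟩
    rintro s' ⟨hin, h1, h19, h20, h2⟩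
    refine .succ (T := 0) ⟨⟨hin.1, by simpa using hin.2⟩, by simp [h1], by simpa using h19,
      by simpa using h20, ?_⟩
    have := exists_lt_succ_iff p ⟨m, hm⟩
    simp only at this
    rw [reg_setReg, if_neg (by decide), h2, hs.2.2.2.2, this, or_assoc]
  · intro s hs
    rw [holds_lt, hs.2.1, hs.1.2]
    exact lt_irrefl n
  · refine ⟨⟨h.1, by simpa using h.2⟩, by simp, by simpa using h19, by simpa using h20, ?_⟩
    simpa using h2
  · rintro s' ⟨hin, -, h19, h20, h2⟩
    refine ⟨hin, h19, h20, ?_⟩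
    simpa using h2

/-- Set register `2` if the vertex in register `1` has degree more than 3. -/
def flagMaxDegree : Prog := loadDeg ;; .ite (.lt 7 4) (.const 2 1) skip

lemma flagMaxDegree_spec (hadj : IsAdjLists G adj) (v : Fin n) {s : Mem} {q : Prop}
    {p : Fin n → Prop} (h : FlagInv adj q p v s) :
    Halts flagMaxDegree s 8 fun s' =>
      HasInput adj s' ∧ s'.reg 1 = v ∧ s'.reg 19 = 0 ∧ s'.reg 20 = 2 ∧
      (0 < s'.reg 2 ↔ 0 < s.reg 2 ∨ 3 < deg G v) := by
  obtain ⟨hin, h1, h19, h20, -⟩ := h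
  refine Halts.seq (T := 6) (T' := 2) ((loadDeg_spec hin v h1).mono le_rfl ?_)
  rintro s1 ⟨a1, b3, b4, b5, b6, b7⟩
  rw [← deg_eq_length hadj] at b4
  have hin1 := hin.of_agree a1 (by simp)
  rw [← a1.2 1 (by simp)] at h1
  rw [← a1.2 19 (by simp)] at h19
  rw [← a1.2 20 (by simp)] at h20
  rw [← a1.2 2 (by simp)]
  refine .ite (fun hb => .const ?_) (fun hb => .skip ?_)
  · rw [holds_lt, b4, b7] at hb
    refine ⟨⟨hin1.1, by simpa using hin1.2⟩, by simpa using h1, by simpa using h19,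
      by simpa using h20, ?_⟩
    have : 3 < deg G v := by omega
    simp [this]
  · rw [holds_lt, b4, b7] at hb
    refine ⟨hin1, h1, h19, h20, ?_⟩
    have : ¬ 3 < deg G v := by omega
    simp [this]

/-- Set register `12` if the vertices in the registers `x` and `y` are adjacent. -/
def flagAdjacent (x y : ℕ) : Prog :=
  .load 13 0 x ;; .succ 14 x ;; .load 14 0 14 ;;
  .loop (.lt 13 14) (.load 15 1 13 ;; .ite (.eq 15 y) (.const 12 1) skip ;; .succ 13 13)

/-- The degree bound makes the scan a constant-time operation: at most three rounds of 5 steps, the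
final test and 3 loading steps. -/
lemma flagAdjacent_spec (hadj : IsAdjLists G adj) {s : Mem} (h : HasInput adj s) {x y : ℕ}
    (hx : x ∉ [12, 13, 14, 15]) (hy : y ∉ [12, 13, 14, 15]) (u v : Fin n) (hu : s.reg x = u)
    (hv : s.reg y = v) (hd : deg G u ≤ 3) :
    Halts (flagAdjacent x y) s 19 fun s' => Agree [12, 13, 14, 15] s s' ∧
      (0 < s'.reg 12 ↔ 0 < s.reg 12 ∨ G.Adj u v) := by
  simp only [List.mem_cons, List.not_mem_nil, or_false, not_or] at hx hy
  have e1 := h.arr_zero (i := u) (by omega)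
  have e2 := h.arr_zero (i := u + 1) (by omega)
  rw [start_succ] at e2
  rw [deg_eq_length hadj] at hd
  refine Halts.mono (T := (adj u).length * (4 + 1) + 1 + 1 + 1 + 1)
    (.seq_load (.seq_succ (.seq_load ((Halts.loop_const (k := (adj u).length) (B := 4)
    (I := fun m s' => Agree [12, 13, 14, 15] s s' ∧ s'.reg 13 = start adj u + m ∧
      s'.reg 14 = start adj u + (adj u).length ∧
      (0 < s'.reg 12 ↔ 0 < s.reg 12 ∨ ∃ k, ∃ h : k < (adj u).length, k < m ∧ (adj u)[k] = v))
    ?_ ?_ ?_).mono le_rfl ?_)))) (by omega) (fun _ => id)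
  · rintro m hm s1 ⟨a, h13, h14, h12⟩
    refine ⟨by rw [holds_lt, h13, h14]; omega, .seq_load (Halts.seq (T := 2) (T' := 1) ?_)⟩
    have hval : s1.arr 1 (s1.reg 13) = ((adj u)[m]).val := by
      rw [h13]; exact (h.of_agree a (by simp)).arr_one u hm
    have hy' : s1.reg y = v := by rw [a.2 y (by simp [hy]), hv]
    have hex : (∃ k, ∃ h : k < (adj u).length, k < m + 1 ∧ (adj u)[k] = v) ↔
        (∃ k, ∃ h : k < (adj u).length, k < m ∧ (adj u)[k] = v) ∨ (adj u)[m] = v := by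
      constructor
      · rintro ⟨k, hk, hkm, he⟩
        rcases (Nat.lt_succ_iff.1 hkm).lt_or_eq with h | rfl
        exacts [Or.inl ⟨k, hk, h, he⟩, Or.inr he]
      · rintro (⟨k, hk, hkm, he⟩ | he)
        exacts [⟨k, hk, by omega, he⟩, ⟨m, hm, by omega, he⟩]
    rw [hex]
    refine .ite (fun hb => .const (.succ (T := 0) ⟨⟨a.1, fun r hr => ?_⟩, ?_, ?_, ?_⟩))
      (fun hb => .skip (.succ (T := 0) ⟨⟨a.1, fun r hr => ?_⟩, ?_, ?_, ?_⟩))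
    · have := a.2 r hr
      simp at hr
      simp [hr, this]
    · simp [h13]; omega
    · simp [h14]
    · simp [hy, hval, hy'] at hb
      simp [Fin.ext hb]
    · have := a.2 r hr
      simp at hr
      simp [hr, this]
    · simp [h13]; omega
    · simp [h14]
    · simp [hy, hval, hy'] at hb
      have : (adj u)[m] ≠ v := fun h => hb (by rw [h])
      simp [this, h12]
  · rintro s1 ⟨a, h13, h14, -⟩
    rw [holds_lt, h13, h14]
    omega
  · refine ⟨⟨rfl, fun r hr => ?_⟩, ?_, ?_, ?_⟩
    · simp at hr
      simp [hr]
    · simp [hu, e1]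
    · simp [hx, hu, e2]
    · simp
  · rintro s1 ⟨a, -, -, h12⟩
    refine ⟨a, h12.trans (or_congr_right ?_)⟩
    rw [← (hadj u).2 v, List.mem_iff_getElem]
    constructor
    · rintro ⟨k, hk, -, he⟩
      exact ⟨k, hk, he⟩
    · rintro ⟨k, hk, he⟩
      exact ⟨k, hk, hk, he⟩

/-- The vertex `v` is the center of a claw. -/
def IsClawCenter (G : SimpleGraph (Fin n)) (v : Fin n) : Prop :=
  ∃ x y z, G.Adj v x ∧ G.Adj v y ∧ G.Adj v z ∧ x ≠ y ∧ y ≠ z ∧ x ≠ z ∧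
    ¬ G.Adj x y ∧ ¬ G.Adj y z ∧ ¬ G.Adj x z

lemma clawFree_iff : ClawFree G ↔ ¬ ∃ v, IsClawCenter G v := by
  simp only [ClawFree, IsClawCenter]
  grind

/-- Set register `2` if the vertex in register `1` is the center of a claw. -/
def flagClaw : Prog :=
  loadDeg ;; .ite (.eq 4 7) (.load 9 1 3 ;; .load 10 1 5 ;; .load 11 1 6 ;; .const 12 0 ;;
    flagAdjacent 9 10 ;; flagAdjacent 10 11 ;; flagAdjacent 9 11 ;;
    .ite (.eq 12 19) (.const 2 1) skip) skip

/-- Since larger degrees are excluded, only vertices of degree 3 can be centers, with all their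
neighbours as leaves. Register `12` becomes positive when some pair of these is adjacent. -/
lemma flagClaw_spec (hadj : IsAdjLists G adj) (hmax : ∀ v, deg G v ≤ 3) (v : Fin n) {s : Mem}
    {q : Prop} {p : Fin n → Prop} (h : FlagInv adj q p v s) :
    Halts flagClaw s 70 fun s' =>
      HasInput adj s' ∧ s'.reg 1 = v ∧ s'.reg 19 = 0 ∧ s'.reg 20 = 2 ∧
      (0 < s'.reg 2 ↔ 0 < s.reg 2 ∨ IsClawCenter G v) := by
  obtain ⟨hin, h1, h19, h20, -⟩ := h
  refine Halts.seq (T := 6) (T' := 64) ((loadDeg_spec hin v h1).mono le_rfl ?_)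
  rintro s1 ⟨a1, b3, b4, b5, b6, b7⟩
  rw [← deg_eq_length hadj] at b4
  have hin1 := hin.of_agree a1 (by simp)
  rw [← a1.2 1 (by simp)] at h1
  rw [← a1.2 19 (by simp)] at h19
  rw [← a1.2 20 (by simp)] at h20
  rw [← a1.2 2 (by simp)]
  refine .ite (fun hb => ?_) (fun hb => .skip ⟨hin1, h1, h19, h20, ?_⟩)
  swap
  · rw [holds_eq, b4, b7] at hb
    have : ¬ IsClawCenter G v := by
      rintro ⟨x, y, z, hx, hy, hz, hxy, hyz, hxz, -⟩
      have : ({x, y, z} : Set (Fin n)).ncard ≤ deg G v :=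
        Set.ncard_le_ncard (by rintro w (rfl | rfl | rfl) <;> assumption) (Set.toFinite _)
      rw [Set.ncard_eq_three.2 ⟨x, y, z, hxy, hxz, hyz, rfl⟩] at this
      have := hmax v
      omega
    simp [this]
  rw [holds_eq, b4, b7] at hb
  have hd : deg G v = 3 := by omega
  have hlen : (adj v).length = 3 := by rw [← deg_eq_length hadj, hd]
  have hnb : ∀ k (hk : k < (adj v).length), G.Adj v (adj v)[k] := fun k hk =>
    ((hadj v).2 _).1 (List.getElem_mem _)
  have hne : ∀ i j (hi : i < (adj v).length) (hj : j < (adj v).length), i ≠ j →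
      (adj v)[i] ≠ (adj v)[j] := fun i j hi hj hij h => hij ((hadj v).1.getElem_inj_iff.1 h)
  have hclaw : IsClawCenter G v ↔ ¬ (G.Adj (adj v)[0] (adj v)[1] ∨ G.Adj (adj v)[1] (adj v)[2] ∨
      G.Adj (adj v)[0] (adj v)[2]) := by
    constructor
    · rintro ⟨x, y, z, hx, hy, hz, hxy, hyz, hxz, n1, n2, n3⟩ h
      have hall := fun w hw => eq_of_deg_le_three (w := w) hd.le (hnb 0 (by omega))
        (hnb 1 (by omega)) (hnb 2 (by omega)) (hne 0 1 _ _ (by omega)) (hne 0 2 _ _ (by omega))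
        (hne 1 2 _ _ (by omega)) hw
      have m1 : ¬ G.Adj y x := fun h => n1 h.symm
      have m2 : ¬ G.Adj z y := fun h => n2 h.symm
      have m3 : ¬ G.Adj z x := fun h => n3 h.symm
      have := hall x hx
      have := hall y hy
      have := hall z hz
      grind
    · intro h
      push Not at h
      exact ⟨_, _, _, hnb 0 (by omega), hnb 1 (by omega), hnb 2 (by omega),
        hne 0 1 _ _ (by omega), hne 1 2 _ _ (by omega), hne 0 2 _ _ (by omega), h⟩
  have g0 := hin1.arr_one v (k := 0) (by omega)
  have g1 := hin1.arr_one v (k := 1) (by omega)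
  have g2 := hin1.arr_one v (k := 2) (by omega)
  rw [add_zero, ← b3] at g0
  rw [← b5] at g1
  rw [← b6] at g2
  refine .seq_load (.seq_load (.seq_load (.seq_const ?_)))
  generalize hs2 : Mem.setReg _ 12 0 = s2
  have harr2 : s2.arr = s1.arr := by rw [← hs2]; rfl
  have hr2 : ∀ r, r ∉ [9, 10, 11, 12] → s2.reg r = s1.reg r := fun r hr => by
    simp at hr
    rw [← hs2]
    simp [hr]
  have hin2 : HasInput adj s2 := hin1.of_agree ⟨harr2, hr2⟩ (by simp)
  have r9 : s2.reg 9 = ((adj v)[0]).val := by rw [← hs2]; simp [g0]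
  have r10 : s2.reg 10 = ((adj v)[1]).val := by rw [← hs2]; simp [g1]
  have r11 : s2.reg 11 = ((adj v)[2]).val := by rw [← hs2]; simp [g2]
  have r12 : s2.reg 12 = 0 := by rw [← hs2]; simp
  refine Halts.seq (T := 19) (T' := 40) ((flagAdjacent_spec hadj hin2 (by simp) (by simp) _ _ r9 r10
    (hmax _)).mono le_rfl ?_)
  rintro s3 ⟨a3, c3⟩
  have hin3 := hin2.of_agree a3 (by simp)
  refine Halts.seq (T := 19) (T' := 21) ((flagAdjacent_spec hadj hin3 (by simp) (by simp)
    (adj v)[1] (adj v)[2] (by rw [a3.2 10 (by simp), r10]) (by rw [a3.2 11 (by simp), r11])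
    (hmax _)).mono le_rfl ?_)
  rintro s4 ⟨a4, c4⟩
  have hin4 := hin3.of_agree a4 (by simp)
  refine Halts.seq (T := 19) (T' := 2) ((flagAdjacent_spec hadj hin4 (by simp) (by simp)
    (adj v)[0] (adj v)[2] (by rw [a4.2 9 (by simp), a3.2 9 (by simp), r9])
    (by rw [a4.2 11 (by simp), a3.2 11 (by simp), r11]) (hmax _)).mono le_rfl ?_)
  rintro s5 ⟨a5, c5⟩
  have hin5 := hin4.of_agree a5 (by simp)
  have keep : ∀ r, r ∉ [9, 10, 11, 12, 13, 14, 15] → s5.reg r = s1.reg r := fun r hr => by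
    simp at hr
    rw [a5.2 r (by simp [hr]), a4.2 r (by simp [hr]), a3.2 r (by simp [hr]), hr2 r (by simp [hr])]
  rw [← keep 1 (by simp)] at h1
  rw [← keep 19 (by simp)] at h19
  rw [← keep 20 (by simp)] at h20
  rw [← keep 2 (by simp)]
  have hflag : 0 < s5.reg 12 ↔ ¬ IsClawCenter G v := by
    rw [c5, c4, c3, r12, hclaw]
    simp only [lt_irrefl, false_or, or_assoc, not_not]
  refine .ite (fun hb => .const ?_) (fun hb => .skip ⟨hin5, h1, h19, h20, ?_⟩)
  · rw [holds_eq, h19] at hb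
    refine ⟨⟨hin5.1, by simpa using hin5.2⟩, by simpa using h1, by simpa using h19,
      by simpa using h20, ?_⟩
    rw [hb] at hflag
    have : IsClawCenter G v := by_contra fun h => absurd (hflag.2 h) (by omega)
    simp [this]
  · rw [holds_eq, h19] at hb
    have : ¬ IsClawCenter G v := hflag.1 (by omega)
    simp [this]

/-- Load the start, the end and the third place of the adjacency list of the vertex in
register `11`. -/
def loadEnd : Prog :=
  .load 13 0 11 ;; .succ 14 11 ;; .load 14 0 14 ;; .succ 15 13 ;; .succ 15 15

lemma loadEnd_spec {s : Mem} (h : HasInput adj s) (v : Fin n) (hv : s.reg 11 = v) :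
    Halts loadEnd s 5 fun s' => Agree [13, 14, 15] s s' ∧ s'.reg 13 = start adj v ∧
      s'.reg 14 = start adj v + (adj v).length ∧ s'.reg 15 = start adj v + 2 := by
  have e1 := h.arr_zero (i := v) (by omega)
  have e2 := h.arr_zero (i := v + 1) (by omega)
  rw [start_succ] at e2
  refine .seq_load (.seq_succ (.seq_load (.seq_succ (.succ ⟨⟨rfl, ?_⟩, ?_⟩))))
  · intro r hr
    simp at hr
    simp [hr]
  · simp [hv, e1, e2]

/-- Move one step along a thread. Registers `10` and `11` hold the previous and the current
vertex, and register `12` the number of steps modulo 3. -/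
def stepThread : Prog :=
  .load 16 1 13 ;; .ite (.eq 16 10) (.succ 13 13 ;; .load 16 1 13) skip ;; .copy 10 11 ;;
  .copy 11 16 ;; .ite (.eq 12 20) (.const 12 0) (.succ 12 12) ;; loadEnd

/-- Set register `2` if the thread that starts with the vertex in register `1` and the one at the
place in register `p` is bad. -/
def flagThread (p : ℕ) : Prog :=
  .copy 10 1 ;; .load 11 1 p ;; .const 12 1 ;; loadEnd ;; .loop (.eq 14 15) stepThread ;;
  .succ 15 15 ;;
  .ite (.eq 14 15) (.ite (.eq 12 19) (.ite (.eq 11 1) skip (.const 2 1)) skip) skip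

/-- The invariant of the walk along the thread that starts with `u`, `w`. -/
def WalkInv (G : SimpleGraph (Fin n)) (adj : Fin n → List (Fin n)) (s : Mem) (u w : Fin n)
    (m : ℕ) (s' : Mem) : Prop :=
  Agree [10, 11, 12, 13, 14, 15, 16] s s' ∧ s'.reg 10 = (track G u w m).val ∧
  s'.reg 11 = (track G u w (m + 1)).val ∧ s'.reg 12 = (m + 1) % 3 ∧
  s'.reg 13 = start adj (track G u w (m + 1)).val ∧
  s'.reg 14 = start adj (track G u w (m + 1)).val + deg G (track G u w (m + 1)) ∧
  s'.reg 15 = start adj (track G u w (m + 1)).val + 2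

/-- Of the two listed neighbours, the next vertex is the one that is not the previous vertex. The
counter goes from 2 back to 0, so no division is needed. -/
lemma stepThread_spec (hadj : IsAdjLists G adj) {s s' : Mem} (h : HasInput adj s)
    (h20 : s.reg 20 = 2) {u w : Fin n} {m : ℕ} (hd : deg G (track G u w (m + 1)) = 2)
    (hback : G.Adj (track G u w (m + 1)) (track G u w m)) (hs : WalkInv G adj s u w m s') :
    Halts stepThread s' 13 (WalkInv G adj s u w (m + 1)) := by
  obtain ⟨a, h10, h11, h12, h13, h14, h15⟩ := hs
  obtain ⟨hne, hnext⟩ := track_spec u w m hd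
  have hin := h.of_agree a (by simp)
  have hlen : (adj (track G u w (m + 1))).length = 2 := by rw [← deg_eq_length hadj, hd]
  have g0 := hin.arr_one (track G u w (m + 1)) (k := 0) (by omega)
  have g1 := hin.arr_one (track G u w (m + 1)) (k := 1) (by omega)
  rw [add_zero] at g0
  have hmem : ∀ k (hk : k < (adj (track G u w (m + 1))).length),
      (adj (track G u w (m + 1)))[k] = track G u w m ∨
      (adj (track G u w (m + 1)))[k] = track G u w (m + 2) := fun k hk =>
    eq_or_eq_of_deg_le_two hd.le hback hnext hne.symm (((hadj _).2 _).1 (List.getElem_mem _))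
  have hne01 : (adj (track G u w (m + 1)))[0] ≠ (adj (track G u w (m + 1)))[1] := fun h' => by
    have := (hadj _).1.getElem_inj_iff.1 h'
    omega
  have h20' : s'.reg 20 = 2 := by rw [a.2 20 (by simp), h20]
  have choose : Halts (.ite (.eq 16 10) (.succ 13 13 ;; .load 16 1 13) skip)
      (s'.setReg 16 (s'.arr 1 (s'.reg 13))) 3 fun s1 => Agree [13, 16] s' s1 ∧
      s1.reg 16 = (track G u w (m + 2)).val := by
    refine .ite (fun hb => .seq_succ (.load ⟨⟨rfl, fun r hr => ?_⟩, ?_⟩))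
      (fun hb => .skip ⟨⟨rfl, fun r hr => ?_⟩, ?_⟩)
    · simp at hr
      simp [hr]
    · simp [h13, g0, h10] at hb
      have h0 := Fin.ext hb
      have h1 := (hmem 1 (by omega)).resolve_left fun h' => hne01 (h0.trans h'.symm)
      simp [h13, g1, h1]
    · simp at hr
      simp [hr]
    · simp [h13, g0, h10] at hb
      have h0 := (hmem 0 (by omega)).resolve_left fun h' => hb (by rw [h'])
      simp [h13, g0, h0]
  refine .seq_load (Halts.seq (T := 3) (T' := 9) (choose.mono le_rfl ?_))
  rintro s1 ⟨a1, c16⟩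
  refine .seq_copy (.seq_copy (Halts.seq (T := 2) (T' := 5) ?_))
  have hcont : ∀ s2 : Mem, Agree [10, 11, 12] s1 s2 → s2.reg 10 = (track G u w (m + 1)).val →
      s2.reg 11 = (track G u w (m + 2)).val → s2.reg 12 = (m + 2) % 3 →
      Halts loadEnd s2 5 (WalkInv G adj s u w (m + 1)) := by
    intro s2 a2 d10 d11 d12
    have hin2 := (hin.of_agree a1 (by simp)).of_agree a2 (by simp)
    refine (loadEnd_spec hin2 _ d11).mono le_rfl ?_
    rintro s3 ⟨a3, c13, c14, c15⟩
    refine ⟨⟨by rw [a3.1, a2.1, a1.1, a.1], fun r hr => ?_⟩, ?_, ?_, ?_, c13, ?_, c15⟩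
    · have := a.2 r hr
      simp at hr
      rw [a3.2 r (by simp [hr]), a2.2 r (by simp [hr]), a1.2 r (by simp [hr]), this]
    · rw [a3.2 10 (by simp), d10]
    · rw [a3.2 11 (by simp), d11]
    · rw [a3.2 12 (by simp), d12]
    · rw [c14, deg_eq_length hadj]
  have e11 : s1.reg 11 = (track G u w (m + 1)).val := by rw [a1.2 11 (by simp), h11]
  have e12 : s1.reg 12 = (m + 1) % 3 := by rw [a1.2 12 (by simp), h12]
  have e20 : s1.reg 20 = 2 := by rw [a1.2 20 (by simp), h20']
  refine .ite (fun hb => .const (hcont _ ⟨rfl, fun r hr => ?_⟩ ?_ ?_ ?_))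
    (fun hb => .succ (hcont _ ⟨rfl, fun r hr => ?_⟩ ?_ ?_ ?_))
  · simp at hr
    simp [hr]
  · simp [e11]
  · simp [c16]
  · simp [e12, e20] at hb
    simp
    omega
  · simp at hr
    simp [hr]
  · simp [e11]
  · simp [c16]
  · simp [e12, e20] at hb
    simp [e12]
    omega

/-- The walk begins after the first edge, so the counter starts at 1 and the loop runs `threadLength
- 1` times, at 14 steps per round. Register `10` is overwritten before the place in register `p` is
read, whence `p ≠ 10`. -/
lemma flagThread_spec (hadj : IsAdjLists G adj) {s : Mem} (h : HasInput adj s)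
    (h19 : s.reg 19 = 0) (h20 : s.reg 20 = 2) {p : ℕ} (hp : p ≠ 10) {u w : Fin n}
    (h1 : s.reg 1 = u) (hd : deg G u = 3) (huw : G.Adj u w) (hw : s.arr 1 (s.reg p) = w) :
    Halts (flagThread p) s (14 * threadLength G u w + 13) fun s' =>
      Agree [2, 10, 11, 12, 13, 14, 15, 16] s s' ∧
      (0 < s'.reg 2 ↔ 0 < s.reg 2 ∨ BadThread G u w) := by
  obtain ⟨hpos, ht, hend⟩ := threadLength_spec huw (by omega)
  obtain ⟨k, hk⟩ : ∃ k, threadLength G u w = k + 1 := ⟨threadLength G u w - 1, by omega⟩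
  have htip : tip G u w = track G u w (k + 1) := by rw [tip, hk]
  rw [htip] at hend
  rw [BadThread, htip, hk]
  rw [hk] at ht
  have hloop : ∀ s0 : Mem, WalkInv G adj s u w 0 s0 → Halts (.loop (.eq 14 15) stepThread) s0
      (k * (13 + 1) + 1) (WalkInv G adj s u w k) := by
    intro s0 h0
    refine Halts.loop_const (fun m hm s1 hs1 => ⟨?_, ?_⟩) (fun s1 hs1 => ?_) h0
    · have := (ht.2 m (by omega)).1
      rw [holds_eq, hs1.2.2.2.2.2.1, hs1.2.2.2.2.2.2, this]
    · exact stepThread_spec hadj h h20 (ht.2 m (by omega)).1 (ht.1 m (by omega)).symm hs1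
    · rw [holds_eq, hs1.2.2.2.2.2.1, hs1.2.2.2.2.2.2]
      omega
  refine Halts.mono (T := (5 + ((k * (13 + 1) + 1) + 5)) + 1 + 1 + 1)
    (.seq_copy (.seq_load (.seq_const (Halts.seq ?_)))) (by omega) (fun _ => id)
  generalize hs2 : ((s.setReg 10 (s.reg 1)).setReg 11 ((s.setReg 10 (s.reg 1)).arr 1
    ((s.setReg 10 (s.reg 1)).reg p))).setReg 12 1 = s2
  have a2 : Agree [10, 11, 12] s s2 := ⟨by rw [← hs2]; rfl, fun r hr => by
    simp at hr
    rw [← hs2]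
    simp [hr]⟩
  have r10 : s2.reg 10 = u.val := by rw [← hs2]; simp [h1]
  have r11 : s2.reg 11 = w.val := by rw [← hs2]; simp [hp, hw]
  have r12 : s2.reg 12 = 1 := by rw [← hs2]; simp
  refine (loadEnd_spec (h.of_agree a2 (by simp)) w r11).mono le_rfl ?_
  rintro s3 ⟨a3, c13, c14, c15⟩
  refine Halts.seq ((hloop s3 ⟨⟨by rw [a3.1, a2.1], fun r hr => ?_⟩, ?_, ?_, ?_, ?_, ?_, ?_⟩).mono
    le_rfl ?_)
  · simp at hr
    rw [a3.2 r (by simp [hr]), a2.2 r (by simp [hr])]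
  · rw [a3.2 10 (by simp), r10, track_zero]
  · rw [a3.2 11 (by simp), r11, zero_add, track_one]
  · rw [a3.2 12 (by simp), r12]
  · rw [c13, zero_add, track_one]
  · rw [c14, zero_add, track_one, deg_eq_length hadj]
  · rw [c15, zero_add, track_one]
  rintro s4 ⟨a4, d10, d11, d12, d13, d14, d15⟩
  have e1 : s4.reg 1 = u.val := by rw [a4.2 1 (by simp), h1]
  have e2 : s4.reg 2 = s.reg 2 := a4.2 2 (by simp)
  have e19 : s4.reg 19 = 0 := by rw [a4.2 19 (by simp), h19]
  have keep : ∀ r, r ∉ [2, 10, 11, 12, 13, 14, 15, 16] → (s4.setReg 15 (s4.reg 15 + 1)).reg r =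
      s.reg r := fun r hr => by
    simp at hr
    simp [hr, a4.2 r (by simp [hr])]
  -- Register `15` now points 3 places after the start of the list of the tip, so the test compares
  -- its degree with 3.
  refine .seq_succ (.ite (fun hb => .ite (fun hb' => .ite (fun hb'' => .skip ⟨⟨a4.1, keep⟩, ?_⟩)
    (fun hb'' => .const (T := 0) ⟨⟨a4.1, fun r hr => ?_⟩, ?_⟩)) (fun hb' => .skip ⟨⟨a4.1, keep⟩, ?_⟩))
    (fun hb => .skip ⟨⟨a4.1, keep⟩, ?_⟩))
  · simp [d11, e1] at hb''
    simp [e2, Fin.ext hb'']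
  · have := keep r hr
    simp at hr
    rw [← this]
    simp [hr]
  · simp [d14, d15] at hb
    simp [d12, e19] at hb'
    simp [d11, e1] at hb''
    have : track G u w (k + 1) ≠ u := fun h => hb'' (by rw [h])
    simp [this, hb']
    omega
  · simp [d12, e19] at hb'
    simp [e2, hb']
  · simp [d14, d15] at hb
    have : deg G (track G u w (k + 1)) ≠ 3 := by omega
    simp [e2, this]

/-- Set register `2` if a bad thread starts at the vertex in register `1`. -/
def flagThreads : Prog :=
  loadDeg ;; .ite (.eq 4 7) (flagThread 3 ;; flagThread 5 ;; flagThread 6) skip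

lemma flagThreads_spec (hadj : IsAdjLists G adj) (v : Fin n) {s : Mem} {q : Prop}
    {p : Fin n → Prop} (h : FlagInv adj q p v s) :
    Halts flagThreads s (14 * threadWork G adj v + 46) fun s' =>
      HasInput adj s' ∧ s'.reg 1 = v ∧ s'.reg 19 = 0 ∧ s'.reg 20 = 2 ∧
      (0 < s'.reg 2 ↔ 0 < s.reg 2 ∨ (deg G v = 3 ∧ ∃ w, G.Adj v w ∧ BadThread G v w)) := by
  obtain ⟨hin, h1, h19, h20, -⟩ := h
  refine Halts.mono (T := 6 + (14 * threadWork G adj v + 39 + 1)) (Halts.seq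
    ((loadDeg_spec hin v h1).mono le_rfl ?_)) (by omega) (fun _ => id)
  rintro s1 ⟨a1, b3, b4, b5, b6, b7⟩
  rw [← deg_eq_length hadj] at b4
  have hin1 := hin.of_agree a1 (by simp)
  rw [← a1.2 1 (by simp)] at h1
  rw [← a1.2 19 (by simp)] at h19
  rw [← a1.2 20 (by simp)] at h20
  rw [← a1.2 2 (by simp)]
  refine .ite (fun hb => ?_) (fun hb => .skip ⟨hin1, h1, h19, h20, ?_⟩)
  swap
  · rw [holds_eq, b4, b7] at hb
    have : deg G v ≠ 3 := by omega
    simp [this]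
  rw [holds_eq, b4, b7] at hb
  have hd : deg G v = 3 := by omega
  have hlen : (adj v).length = 3 := by rw [← deg_eq_length hadj, hd]
  have hnb : ∀ k (hk : k < (adj v).length), G.Adj v (adj v)[k] := fun k hk =>
    ((hadj v).2 _).1 (List.getElem_mem _)
  have hwork : threadWork G adj v = threadLength G v (adj v)[0] + (threadLength G v (adj v)[1] +
      threadLength G v (adj v)[2]) := by
    rw [threadWork, dif_pos v.2, if_pos hd]
    have : adj v = [(adj v)[0], (adj v)[1], (adj v)[2]] := by
      apply List.ext_getElem
      · simp [hlen]
      · intro k hk hk'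
        have : k < 3 := by omega
        interval_cases k <;> rfl
    conv_lhs => rw [this]
    simp
  have hbad : (∃ w, G.Adj v w ∧ BadThread G v w) ↔ BadThread G v (adj v)[0] ∨
      BadThread G v (adj v)[1] ∨ BadThread G v (adj v)[2] := by
    constructor
    · rintro ⟨w, hw, hbw⟩
      obtain ⟨k, hk, rfl⟩ := List.getElem_of_mem (((hadj v).2 w).2 hw)
      have : k < 3 := by omega
      interval_cases k
      exacts [Or.inl hbw, Or.inr (Or.inl hbw), Or.inr (Or.inr hbw)]
    · rintro (h | h | h)
      exacts [⟨_, hnb 0 (by omega), h⟩, ⟨_, hnb 1 (by omega), h⟩, ⟨_, hnb 2 (by omega), h⟩]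
  have g0 := hin1.arr_one v (k := 0) (by omega)
  have g1 := hin1.arr_one v (k := 1) (by omega)
  have g2 := hin1.arr_one v (k := 2) (by omega)
  rw [add_zero, ← b3] at g0
  rw [← b5] at g1
  rw [← b6] at g2
  refine Halts.mono (T := (14 * threadLength G v (adj v)[0] + 13) +
    ((14 * threadLength G v (adj v)[1] + 13) + (14 * threadLength G v (adj v)[2] + 13)))
    (Halts.seq ?_) (by omega) (fun _ => id)
  refine (flagThread_spec hadj hin1 h19 h20 (by simp) h1 hd (hnb 0 (by omega)) g0).mono le_rfl ?_
  rintro s2 ⟨a2, c2⟩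
  have hin2 := hin1.of_agree a2 (by simp)
  refine Halts.seq ((flagThread_spec hadj hin2 (by rw [a2.2 19 (by simp), h19])
    (by rw [a2.2 20 (by simp), h20]) (by simp) (by rw [a2.2 1 (by simp), h1]) hd
    (hnb 1 (by omega)) (by rw [a2.1, a2.2 5 (by simp), g1])).mono le_rfl ?_)
  rintro s3 ⟨a3, c3⟩
  have hin3 := hin2.of_agree a3 (by simp)
  refine (flagThread_spec hadj hin3 (by rw [a3.2 19 (by simp), a2.2 19 (by simp), h19])
    (by rw [a3.2 20 (by simp), a2.2 20 (by simp), h20]) (by simp)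
    (by rw [a3.2 1 (by simp), a2.2 1 (by simp), h1]) hd
    (hnb 2 (by omega))
    (by rw [a3.1, a2.1, a3.2 6 (by simp), a2.2 6 (by simp), g2])).mono le_rfl ?_
  rintro s4 ⟨a4, c4⟩
  refine ⟨hin3.of_agree a4 (by simp), ?_, ?_, ?_, ?_⟩
  · rw [a4.2 1 (by simp), a3.2 1 (by simp), a2.2 1 (by simp), h1]
  · rw [a4.2 19 (by simp), a3.2 19 (by simp), a2.2 19 (by simp), h19]
  · rw [a4.2 20 (by simp), a3.2 20 (by simp), a2.2 20 (by simp), h20]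
  · rw [c4, c3, c2, hbad]
    simp only [hd, true_and, or_assoc]

/-- Decide membership in the class `𝒞`. -/
def recognize : Prog :=
  .const 20 2 ;; forVertices flagMaxDegree ;; .ite (.lt 19 2) (.const 0 0)
    (forVertices flagClaw ;; forVertices flagThreads ;; .ite (.lt 19 2) (.const 0 0) (.const 0 1))

/-- Degrees are tested first because the time bounds of the other two tests need them: claws are
found in constant time only in short lists, and the total thread length is at most `3 n` only when
degrees are at most 3. -/
theorem recognize_decides :
    DecidesInLinearTime recognize (fun _ _ => True) (fun _ G => InC G) := by
  refine ⟨182, fun n hn G adj hadj _ => ?_⟩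
  have key : Halts recognize (initialMem adj) (172 * n + 10) fun s' =>
      (InC G → s'.reg 0 = 1) ∧ (¬ InC G → s'.reg 0 = 0) := by
    have hin : HasInput adj ((initialMem adj).setReg 20 2) := ⟨rfl, by simp [initialMem]⟩
    refine Halts.mono (T := (∑ i ∈ Finset.range n, (8 + 2) + 2) + (162 * n + 6 + 1) + 1)
      (.seq_const (Halts.seq ((forVertices_spec (q := False) (B := fun _ => 8)
      (fun v s hs => flagMaxDegree_spec hadj v hs) hin (by simp [initialMem]) (by simp)
      (by simp [initialMem])).mono le_rfl ?_)))
      (by rw [Finset.sum_const, Finset.card_range, smul_eq_mul]; omega) (fun _ => id)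
    rintro s1 ⟨hin1, h19, h20, h2⟩
    rw [false_or] at h2
    refine .ite (fun hb => .const ?_) (fun hb => ?_)
    · rw [holds_lt, h19, h2] at hb
      obtain ⟨v, hv⟩ := hb
      have : ¬ InC G := fun h => absurd (h.1 v) (by omega)
      simp [this]
    rw [holds_lt, h19, h2] at hb
    have hmax : ∀ v, deg G v ≤ 3 := fun v => not_lt.1 fun h => hb ⟨v, h⟩
    have hwork := sum_threadWork_le hadj hmax
    refine Halts.mono (T := (∑ i ∈ Finset.range n, (70 + 2) + 2) +
      ((∑ i ∈ Finset.range n, (14 * threadWork G adj i + 46 + 2) + 2) + 2)) (Halts.seq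
      ((forVertices_spec (q := False) (B := fun _ => 70)
      (fun v s hs => flagClaw_spec hadj hmax v hs) hin1 h19 h20 (h2.trans (iff_false_intro hb))).mono
      le_rfl ?_)) ?_ (fun _ => id)
    swap
    · rw [Finset.sum_const, Finset.card_range, smul_eq_mul, Finset.sum_add_distrib,
        Finset.sum_add_distrib, ← Finset.mul_sum, Finset.sum_const, Finset.sum_const,
        Finset.card_range, smul_eq_mul, smul_eq_mul]
      omega
    rintro s2 ⟨hin2, h19, h20, h2⟩
    rw [false_or] at h2
    -- The flag is not reset between the two loops: the existence of a claw center enters the last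
    -- loop as `q`.
    refine Halts.seq ((forVertices_spec (B := fun i => 14 * threadWork G adj i + 46)
      (fun v s hs => flagThreads_spec hadj v hs) hin2 h19 h20 h2).mono le_rfl ?_)
    rintro s3 ⟨hin3, h19, h20, h2⟩
    have hC : InC G ↔ ¬ 0 < s3.reg 2 := by
      rw [h2, inC_iff, clawFree_iff, not_or]
      refine (and_iff_right hmax).trans (and_congr_right fun _ => ?_)
      push Not
      exact ⟨fun h u hu w => h u w hu, fun h u w hu => h u hu w⟩
    rw [hC]
    refine .ite (fun hb => .const ?_) (fun hb => .const ?_)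
    · rw [holds_lt, h19] at hb
      simp [hb]
    · rw [holds_lt, h19] at hb
      simp [hb]
  obtain ⟨t, s, hr, ht, hs⟩ := key
  exact ⟨t, s, hr, by omega, hs⟩

end Recognition

end DynCol

/-- 1. `𝒞` is recognized in linear time. 2. For connected graphs in `𝒞`, dynamic 3-colorability is
decided in linear time. 3. For these graphs the answer of the determination algorithm is computed
in linear time, and 4. it is correct unless the graph is a cycle (a connected graph all of whose
vertices have degree 2). -/
theorem mainTheorem7 :
    (∃ P : DynCol.Prog,
      DynCol.DecidesInLinearTime P (fun _ _ => True) (fun _ G => DynCol.InC G)) ∧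
    (∃ P : DynCol.Prog,
      DynCol.DecidesInLinearTime P (fun _ G => G.Connected ∧ DynCol.InC G)
        (fun _ G => DynCol.DynThreeColorable G)) ∧
    (∃ P : DynCol.Prog,
      DynCol.DecidesInLinearTime P (fun _ G => G.Connected ∧ DynCol.InC G)
        (fun _ G => DynCol.DeterminationAnswer G)) ∧
    (∀ (n : ℕ) (G : SimpleGraph (Fin n)), G.Connected → DynCol.InC G →
      ¬ (∀ v, DynCol.deg G v = 2) →
      (DynCol.DynThreeColorable G ↔ DynCol.DeterminationAnswer G)) := by
  exact ⟨⟨_, DynCol.recognize_decides⟩, ⟨_, DynCol.decideColorable_decides⟩,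
    ⟨_, DynCol.determine_decides⟩, fun _ _ hconn hG h2 =>
      DynCol.dynThreeColorable_iff_determinationAnswer hconn hG h2⟩
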